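/- Diagrams lie in the oriented plane. A crossing of oriented strands is positive if, when it is drawn with both strands going up, the strand going from the lower left to the upper right is the over-strand; otherwise it is negative. **The polynomials.** Let $K$ be a field (for instance $\mathbb{Q}(a,q)$) and let $a,q\in K$ with $a\neq 0$, $q\ne 0$, $q^2\neq 1$. The HOMFLY-PT polynomial $P=P(a,q)$ is the unique $K$-valued invariant of framed oriented links (with blackboard framing; i.e. the unique function on oriented diagrams invariant under planar isotopy, the second and third Reidemeister moves, and the replacement of a curl by the curl with the same crossing sign on the other side of the strand) such that $$P(X_+)-P(X_-)=(q-q^{-1})\,P(X_0),$$ where $X_+,X_-,X_0$ agree outside a disc, in which they are a positive crossing, a negative crossing and its oriented smoothing, such that removing a curl with positive (negative) crossing multiplies $P$ as $P(\text{with curl})=a^{\pm1}P(\text{without curl})$ (sign $+$ for positive, $-$ for negative), and such that $P(\bigcirc)=\frac{a-a^{-1}}{q-q^{-1}}$ and $P(\emptyset)=1$. The Kauffman polynomial $F=F(a,q)$ is the unique $K$-valued invariant of framed unoriented links such that $$F(\times)-F(\times')=(q-q^{-1})\bigl(F(\,)(\,)-F(\asymp)\bigr),$$ where $\times$ is the crossing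 whose over-strand runs from the lower left to the upper right, $\times'$ is the opposite crossing, $)($ is the smoothing into two vertical arcs and $\asymp$ the one into two horizontal arcs, such that $F(\text{with negative curl})=a^{-2}q\,F(\text{without curl})$, and such that $F(\bigcirc)=\frac{a^2q^{-1}-a^{-2}q}{q-q^{-1}}+1$ and $F(\emptyset)=1$. These relations involve $a$ only through $a^2$, so that $F(aq^{1/2},q)$ makes sense: $a^2$ is replaced by $a^2q$ throughout. The $\mathfrak{sl}_n$ polynomial is $P$ at $a=q^n$, and the $\mathfrak{so}_N$ polynomial is $F$ at $a^2=q^N$. **States.** A state $\sigma$ of an unoriented diagram $D$ is obtained by replacing each crossing by one of the local pictures below and by orienting or dashing every strand so that orientations and dashes match everywhere (so each closed curve of the result is either oriented coherently or entirely dashed). Turn each crossing so that the over-strand runs from the lower left to the upper right. The local pictures and their weights are: * weight $q-q^{-1}$: the vertical smoothing $)($ with (left arc, right arc) = (down, up), (down, dashed) or (dashed, up); * weight $-(q-q^{-1})$: the horizontal smoothing $\asymp$ with (upper arc, lower arc) = (left to right, right to left), (left to right, dashed) or (dashed, right to left); * weight $1$: the crossing kept, with its two strands oriented in any of the four ways,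 or with both strands dashed; * weight $-1$: the crossing kept, with exactly one of its two strands dashed and the other one oriented in any way. The pictures do not change when the crossing is turned by a half turn, so this is well defined. The weight $w(\sigma)$ is the product of the local weights. Erasing all dashed curves of $\sigma$ leaves an oriented diagram $\vec\sigma$ (possibly empty); put $[\sigma]_{B_n}=a^{-\operatorname{rot}\vec\sigma}P(\vec\sigma)$, where $\operatorname{rot}$ is the rotation number (the sum of the turning numbers of the components; a counterclockwise circle has rotation number $1$). **Statement.** Let $q\in K$ with $q\neq0$ and $q^2\neq1$. 1. For every $a\in K$ with $a\ne0$, the invariants $P(a,q)$ and $F(aq^{1/2},q)$ exist and are unique, and for every unoriented link diagram $D$ $$\sum_{\sigma}w(\sigma)\,a^{-\operatorname{rot}\vec\sigma}P(a,q)(\vec\sigma)=F(aq^{1/2},q)(D),$$ where $\sigma$ runs over the states of $D$. 2. In particular, for $a=q^n$, $n\in\mathbb{N}$, this is an $\mathfrak{sl}_n$-expansion of the $\mathfrak{so}_{2n+1}$ polynomial: the $\mathfrak{sl}_n$ and $\mathfrak{so}_{2n+1}$ polynomials exist and are unique, and the $\mathfrak{so}_{2n+1}$ polynomial of $D$ equals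 $\sum_\sigma w(\sigma)\,q^{-n\operatorname{rot}\vec\sigma}P(q^n,q)(\vec\sigma)$. -/

import Mathlib

namespace Jaeger

/-!  Link diagrams are taken in general position with respect to the height function and are cut
into elementary pieces, which are listed from bottom to top.  A piece `(i, g)` has exactly `i`
strands running vertically to its left. -/

/-- Elementary pieces of an unoriented diagram: a minimum `∪`, a maximum `∩`, and the two
crossings.  In `cross true` the strand running from the lower left to the upper right is the
over-strand; in `cross false` it is the strand running from the lower right to the upper left. -/
inductive Piece where
  | cup : Piece
  | cap : Piece
  | cross (e : Bool) : Piece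

/-- Number of strands at the bottom of a piece. -/
def Piece.bot : Piece → ℕ
  | .cup => 0
  | .cap => 2
  | .cross _ => 2

/-- Number of strands at the top of a piece. -/
def Piece.top : Piece → ℕ
  | .cup => 2
  | .cap => 0
  | .cross _ => 2

/-- Moves a word (a list of positioned pieces) to the right, past `k` strands. -/
def shift {G : Type} (k : ℕ) (w : List (ℕ × G)) : List (ℕ × G) :=
  w.map fun p => (k + p.1, p.2)

/-- `IsTangle w m n`: the word `w` is a tangle diagram with `m` strands at its bottom and `n`
strands at its top. -/
inductive IsTangle : List (ℕ × Piece) → ℕ → ℕ → Prop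
  | nil (n : ℕ) : IsTangle [] n n
  | cons (l r n : ℕ) (g : Piece) (w : List (ℕ × Piece)) :
      IsTangle w (l + g.top + r) n → IsTangle ((l, g) :: w) (l + g.bot + r) n

/-- Diagrams of unoriented links: tangle diagrams without end points. -/
structure Diagram where
  word : List (ℕ × Piece)
  closed : IsTangle word 0 0

/-- The elementary moves between unoriented tangle diagrams that represent the same framed
tangle: planar isotopy, the second and the third Reidemeister move, and the framed version of the
first one, which replaces a curl by the curl of the same crossing sign on the other side of the
strand. -/
inductive Move : List (ℕ × Piece) → List (ℕ × Piece) → Prop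
  | exchange (g h : Piece) (m : ℕ) :
      Move [(0, g), (g.top + m, h)] [(g.bot + m, h), (0, g)]
  | zigzag_left : Move [(1, .cup), (0, .cap)] []
  | zigzag_right : Move [(0, .cup), (1, .cap)] []
  | slide_cap (e : Bool) :
      Move [(1, .cross e), (0, .cap)] [(0, .cross !e), (1, .cap)]
  | slide_cup (e : Bool) :
      Move [(0, .cup), (1, .cross e)] [(1, .cup), (0, .cross !e)]
  | reidemeister_two (e : Bool) : Move [(0, .cross e), (0, .cross !e)] []
  | reidemeister_three (e : Bool) :
      Move [(0, .cross e), (1, .cross e), (0, .cross e)]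
        [(1, .cross e), (0, .cross e), (1, .cross e)]
  | framed_one (e : Bool) :
      Move [(1, .cup), (0, .cross e), (1, .cap)] [(0, .cup), (1, .cross e), (0, .cap)]

/-- `F` is the Kauffman polynomial `F(a, q)` with values in the field `K`, where `A` stands for
`a ^ 2` (the defining relations involve `a` only through `a ^ 2`). The empty diagram has value `1`.

The relations are local: `D₁`, `D₂`, … agree outside a small disc, that is, they have the same
pieces `u` below and `v` above, and the same number `k` of strands to the left. -/
structure IsKauffman {K : Type*} [Field K] (A q : K) (F : Diagram → K) : Prop where
  invariant : ∀ (x y u v : List (ℕ × Piece)) (k : ℕ) (D₁ D₂ : Diagram), Move x y →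
    D₁.word = u ++ shift k x ++ v → D₂.word = u ++ shift k y ++ v → F D₁ = F D₂
  skein : ∀ (u v : List (ℕ × Piece)) (k : ℕ) (D₁ D₂ D₃ D₄ : Diagram),
    D₁.word = u ++ shift k [(0, .cross true)] ++ v →
    D₂.word = u ++ shift k [(0, .cross false)] ++ v →
    D₃.word = u ++ v →
    D₄.word = u ++ shift k [(0, .cap), (0, .cup)] ++ v →
    F D₁ - F D₂ = (q - q⁻¹) * (F D₃ - F D₄)
  curl : ∀ (u v : List (ℕ × Piece)) (k : ℕ) (D₁ D₂ : Diagram),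
    D₁.word = u ++ shift k [(0, .cup), (1, .cross false), (0, .cap)] ++ v →
    D₂.word = u ++ v → F D₁ = A⁻¹ * q * F D₂
  loop : ∀ D : Diagram, D.word = [(0, .cup), (0, .cap)] →
    F D = (A * q⁻¹ - A⁻¹ * q) / (q - q⁻¹) + 1
  empty : ∀ D : Diagram, D.word = [] → F D = 1

/-- Orientation of a strand at a given height. -/
inductive Dir where
  | up : Dir
  | down : Dir
deriving DecidableEq

/-- The opposite orientation. -/
def Dir.op : Dir → Dir
  | .up => .down
  | .down => .up

/-- Elementary pieces of an oriented diagram. In `cup x` and `cap x`, `x` is the orientation of the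
left leg (the right leg has the opposite one); in `cross e x y`, `x` and `y` are the orientations
of the strands starting at the lower left and at the lower right, and `e` is as for `Piece`. -/
inductive OPiece where
  | cup (x : Dir) : OPiece
  | cap (x : Dir) : OPiece
  | cross (e : Bool) (x y : Dir) : OPiece

/-- Orientations of the strands at the bottom of an oriented piece, from left to right. -/
def OPiece.bot : OPiece → List Dir
  | .cup _ => []
  | .cap x => [x, x.op]
  | .cross _ x y => [x, y]

/-- Orientations of the strands at the top of an oriented piece, from left to right. -/
def OPiece.top : OPiece → List Dir
  | .cup x => [x, x.op]
  | .cap _ => []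
  | .cross _ x y => [y, x]

/-- `IsOTangle w s t`: the word `w` is a coherently oriented tangle diagram with orientations `s`
of its strands at the bottom and `t` at the top. -/
inductive IsOTangle : List (ℕ × OPiece) → List Dir → List Dir → Prop
  | nil (t : List Dir) : IsOTangle [] t t
  | cons (l r t : List Dir) (g : OPiece) (w : List (ℕ × OPiece)) :
      IsOTangle w (l ++ g.top ++ r) t → IsOTangle ((l.length, g) :: w) (l ++ g.bot ++ r) t

/-- Diagrams of oriented links. -/
structure ODiagram where
  word : List (ℕ × OPiece)
  closed : IsOTangle word [] []

/-- The oriented versions of the elementary moves. -/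
inductive OMove : List (ℕ × OPiece) → List (ℕ × OPiece) → Prop
  | exchange (g h : OPiece) (m : ℕ) :
      OMove [(0, g), (g.top.length + m, h)] [(g.bot.length + m, h), (0, g)]
  | zigzag_left (s : Dir) : OMove [(1, .cup s.op), (0, .cap s)] []
  | zigzag_right (s : Dir) : OMove [(0, .cup s), (1, .cap s.op)] []
  | slide_cap (e : Bool) (x y : Dir) :
      OMove [(1, .cross e y x.op), (0, .cap x)] [(0, .cross (!e) x y), (1, .cap x)]
  | slide_cup (e : Bool) (x y : Dir) :
      OMove [(0, .cup x), (1, .cross e x.op y)] [(1, .cup x), (0, .cross (!e) y x)]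
  | reidemeister_two (e : Bool) (x y : Dir) :
      OMove [(0, .cross e x y), (0, .cross (!e) y x)] []
  | reidemeister_three (e : Bool) (x y z : Dir) :
      OMove [(0, .cross e x y), (1, .cross e x z), (0, .cross e y z)]
        [(1, .cross e y z), (0, .cross e x z), (1, .cross e x y)]
  | framed_one (e : Bool) (s : Dir) :
      OMove [(1, .cup s), (0, .cross e s s), (1, .cap s)]
        [(0, .cup s.op), (1, .cross e s s), (0, .cap s.op)]

/-- `P` is the HOMFLY-PT polynomial `P(a, q)` of framed oriented links, with values in the field
`K`. The empty diagram has value `1`. -/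
structure IsHomfly {K : Type*} [Field K] (a q : K) (P : ODiagram → K) : Prop where
  invariant : ∀ (x y u v : List (ℕ × OPiece)) (k : ℕ) (D₁ D₂ : ODiagram), OMove x y →
    D₁.word = u ++ shift k x ++ v → D₂.word = u ++ shift k y ++ v → P D₁ = P D₂
  skein : ∀ (u v : List (ℕ × OPiece)) (k : ℕ) (D₁ D₂ D₃ : ODiagram),
    D₁.word = u ++ shift k [(0, .cross true .up .up)] ++ v →
    D₂.word = u ++ shift k [(0, .cross false .up .up)] ++ v →
    D₃.word = u ++ v →
    P D₁ - P D₂ = (q - q⁻¹) * P D₃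
  curl_pos : ∀ (u v : List (ℕ × OPiece)) (k : ℕ) (s : Dir) (D₁ D₂ : ODiagram),
    D₁.word = u ++ shift k [(1, .cup s), (0, .cross true s s), (1, .cap s)] ++ v →
    D₂.word = u ++ v → P D₁ = a * P D₂
  curl_neg : ∀ (u v : List (ℕ × OPiece)) (k : ℕ) (s : Dir) (D₁ D₂ : ODiagram),
    D₁.word = u ++ shift k [(0, .cup s.op), (1, .cross false s s), (0, .cap s.op)] ++ v →
    D₂.word = u ++ v → P D₁ = a⁻¹ * P D₂
  loop : ∀ (s : Dir) (D : ODiagram), D.word = [(0, .cup s), (0, .cap s)] →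
    P D = (a - a⁻¹) / (q - q⁻¹)
  empty : ∀ D : ODiagram, D.word = [] → P D = 1

/-- The `sl_n` polynomial: the HOMFLY-PT polynomial at `a = q ^ n`. -/
def IsSl {K : Type*} [Field K] (n : ℕ) (q : K) (P : ODiagram → K) : Prop :=
  IsHomfly (q ^ n) q P

/-- The `so_N` polynomial: the Kauffman polynomial at `a ^ 2 = q ^ N`. -/
def IsSo {K : Type*} [Field K] (N : ℕ) (q : K) (F : Diagram → K) : Prop :=
  IsKauffman (q ^ N) q F

/-- Contribution of a piece to the rotation number: `1` for a minimum run through from left to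
right, `-1` for a maximum run through from left to right, `0` otherwise. -/
def OPiece.rot : OPiece → ℤ
  | .cup .down => 1
  | .cap .up => -1
  | _ => 0

/-- The rotation number of an oriented diagram, i.e. the degree of its Gauss map (the sum of the
turning numbers of its components, positive for a counterclockwise circle), computed as the signed
number of points at which the tangent vector points to the right. -/
def rot (w : List (ℕ × OPiece)) : ℤ :=
  (w.map fun p => p.2.rot).sum

/-- A local state of a piece. Each end is oriented (`some x`) or dashed (`none`); `bot` and `top`
list the ends at the bottom and at the top, `weight` is the coefficient, and `word` is what remains
of the piece after erasing the dashed strands. -/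
structure LocalState (K : Type*) where
  bot : List (Option Dir)
  top : List (Option Dir)
  weight : K
  word : List (ℕ × OPiece)

/-- The local states of the `B_n` assignment. -/
def localStates {K : Type*} [Field K] (q : K) : Piece → List (LocalState K)
  | .cup =>
    [⟨[], [some .up, some .down], 1, [(0, .cup .up)]⟩,
     ⟨[], [some .down, some .up], 1, [(0, .cup .down)]⟩,
     ⟨[], [none, none], 1, []⟩]
  | .cap =>
    [⟨[some .up, some .down], [], 1, [(0, .cap .up)]⟩,
     ⟨[some .down, some .up], [], 1, [(0, .cap .down)]⟩,
     ⟨[none, none], [], 1, []⟩]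
  | .cross true =>
    -- the smoothing into two vertical strands
    [⟨[some .down, some .up], [some .down, some .up], q - q⁻¹, []⟩,
     ⟨[none, some .up], [none, some .up], q - q⁻¹, []⟩,
     ⟨[some .down, none], [some .down, none], q - q⁻¹, []⟩,
    -- the smoothing into a maximum (below) and a minimum (above)
     ⟨[some .down, some .up], [some .down, some .up], -(q - q⁻¹),
        [(0, .cap .down), (0, .cup .down)]⟩,
     ⟨[some .down, some .up], [none, none], -(q - q⁻¹), [(0, .cap .down)]⟩,
     ⟨[none, none], [some .down, some .up], -(q - q⁻¹), [(0, .cup .down)]⟩,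
    -- the strands cross
     ⟨[none, none], [none, none], 1, []⟩,
     ⟨[some .up, some .up], [some .up, some .up], 1, [(0, .cross true .up .up)]⟩,
     ⟨[some .down, some .down], [some .down, some .down], 1, [(0, .cross true .down .down)]⟩,
     ⟨[some .up, some .down], [some .down, some .up], 1, [(0, .cross true .up .down)]⟩,
     ⟨[some .down, some .up], [some .up, some .down], 1, [(0, .cross true .down .up)]⟩,
     ⟨[some .up, none], [none, some .up], -1, []⟩,
     ⟨[none, some .up], [some .up, none], -1, []⟩,
     ⟨[some .down, none], [none, some .down], -1, []⟩,
     ⟨[none, some .down], [some .down, none], -1, []⟩]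
  -- the other crossing is the first one turned by a right angle, and so are its states
  | .cross false =>
    [⟨[some .up, some .down], [some .up, some .down], q - q⁻¹,
        [(0, .cap .up), (0, .cup .up)]⟩,
     ⟨[none, none], [some .up, some .down], q - q⁻¹, [(0, .cup .up)]⟩,
     ⟨[some .up, some .down], [none, none], q - q⁻¹, [(0, .cap .up)]⟩,
     ⟨[some .up, some .down], [some .up, some .down], -(q - q⁻¹), []⟩,
     ⟨[some .up, none], [some .up, none], -(q - q⁻¹), []⟩,
     ⟨[none, some .down], [none, some .down], -(q - q⁻¹), []⟩,
     ⟨[none, none], [none, none], 1, []⟩,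
     ⟨[some .up, some .up], [some .up, some .up], 1, [(0, .cross false .up .up)]⟩,
     ⟨[some .down, some .down], [some .down, some .down], 1, [(0, .cross false .down .down)]⟩,
     ⟨[some .up, some .down], [some .down, some .up], 1, [(0, .cross false .up .down)]⟩,
     ⟨[some .down, some .up], [some .up, some .down], 1, [(0, .cross false .down .up)]⟩,
     ⟨[some .up, none], [none, some .up], -1, []⟩,
     ⟨[none, some .up], [some .up, none], -1, []⟩,
     ⟨[some .down, none], [none, some .down], -1, []⟩,
     ⟨[none, some .down], [some .down, none], -1, []⟩]

/-- The states of the word `w` whose bottom ends are labelled by `t` and which have no top ends: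
one local state is chosen for each piece, and the labels of adjacent ends have to agree. A state is
recorded as its weight (the product of the local weights) and the oriented diagram that remains
after erasing the dashed strands. A piece to whose left the labels `t'` are found has as many
remaining strands to its left as there are oriented labels in `t'`. -/
def states {K : Type*} [Field K] (q : K) :
    List (ℕ × Piece) → List (Option Dir) → List (K × List (ℕ × OPiece))
  | [], t => if t = [] then [(1, [])] else []
  | (i, g) :: w, t =>
    (localStates q g).flatMap fun s =>
      if i ≤ t.length ∧ s.bot <+: t.drop i then
        (states q w (t.take i ++ s.top ++ t.drop (i + s.bot.length))).map fun p =>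
          (s.weight * p.1, shift (t.take i).reduceOption.length s.word ++ p.2)
      else []

theorem IsOTangle.append {u v : List (ℕ × OPiece)} {s t r : List Dir}
    (hu : IsOTangle u s t) (hv : IsOTangle v t r) : IsOTangle (u ++ v) s r := by
  induction hu with
  | nil t => simpa using hv
  | cons l r' t g w _ ih => exact IsOTangle.cons l r' _ g _ (ih hv)

theorem IsOTangle.whisker {u : List (ℕ × OPiece)} {s t : List Dir} (hu : IsOTangle u s t)
    (a b : List Dir) : IsOTangle (shift a.length u) (a ++ s ++ b) (a ++ t ++ b) := by
  induction hu with
  | nil t => exact IsOTangle.nil _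
  | cons l r' t g w _ ih =>
    have h := IsOTangle.cons (a ++ l) (r' ++ b) (a ++ t ++ b) g (shift a.length w)
      (by simpa [List.append_assoc] using ih)
    simpa [shift, List.append_assoc] using h

theorem localStates_isOTangle {K : Type*} [Field K] (q : K) (g : Piece) (s : LocalState K)
    (hs : s ∈ localStates q g) : IsOTangle s.word s.bot.reduceOption s.top.reduceOption := by
  have h0 : ∀ t, IsOTangle [] t t := IsOTangle.nil
  have h1 : ∀ g : OPiece, IsOTangle [(0, g)] g.bot g.top := fun g => by
    simpa using IsOTangle.cons [] [] g.top g [] (by simpa using h0 g.top)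
  have h2 : ∀ x : Dir, IsOTangle [(0, .cap x), (0, .cup x)] [x, x.op] [x, x.op] := fun x =>
    (h1 (.cap x)).append (h1 (.cup x))
  rcases g with _ | _ | e
  · simp only [localStates, List.mem_cons, List.not_mem_nil, or_false] at hs
    rcases hs with rfl | rfl | rfl
    exacts [h1 (.cup .up), h1 (.cup .down), h0 _]
  · simp only [localStates, List.mem_cons, List.not_mem_nil, or_false] at hs
    rcases hs with rfl | rfl | rfl
    exacts [h1 (.cap .up), h1 (.cap .down), h0 _]
  · cases e <;> simp only [localStates, List.mem_cons, List.not_mem_nil, or_false] at hs <;>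
      rcases hs with rfl | rfl | rfl | rfl | rfl | rfl | rfl | rfl | rfl | rfl | rfl | rfl | rfl |
        rfl | rfl <;>
      first
        | exact h0 _
        | exact h1 (.cup _)
        | exact h1 (.cap _)
        | exact h1 (.cross _ _ _)
        | exact h2 _

/-- What remains of a state after erasing the dashed strands is a coherently oriented diagram. -/
theorem states_isOTangle {K : Type*} [Field K] (q : K) (w : List (ℕ × Piece)) :
    ∀ (t : List (Option Dir)) (p : K × List (ℕ × OPiece)), p ∈ states q w t →
      IsOTangle p.2 t.reduceOption [] := by
  induction w with
  | nil =>
    intro t p hp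
    by_cases ht : t = []
    · subst ht
      simp only [states, if_true, List.mem_singleton] at hp
      subst hp
      exact IsOTangle.nil _
    · simp [states, ht] at hp
  | cons c w ih =>
    obtain ⟨i, g⟩ := c
    intro t p hp
    simp only [states, List.mem_flatMap] at hp
    obtain ⟨s, hs, hp⟩ := hp
    split_ifs at hp with hc
    · obtain ⟨p', hp', rfl⟩ := List.mem_map.1 hp
      obtain ⟨_, r, hr⟩ := hc
      have ht : t = t.take i ++ s.bot ++ r := by
        rw [List.append_assoc, hr, List.take_append_drop]
      have hd : t.drop (i + s.bot.length) = r := by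
        rw [← List.drop_drop, ← hr, List.drop_left]
      have h1 := (localStates_isOTangle q g s hs).whisker (t.take i).reduceOption r.reduceOption
      have h2 := ih _ _ hp'
      rw [hd, List.reduceOption_append, List.reduceOption_append] at h2
      have h3 := h1.append h2
      rw [← List.reduceOption_append, ← List.reduceOption_append, ← ht] at h3
      exact h3
    · simp at hp

/-- The `B_n` state sum of an unoriented diagram `D`: the sum over all states `σ` of `D` of the
weight of `σ` times `[σ] = a ^ (-rot σ) * P σ`. -/
noncomputable def stateSum {K : Type*} [Field K] (a q : K) (P : ODiagram → K) (D : Diagram) : K :=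
  ((states q D.word []).attach.map fun σ =>
    σ.1.1 * (a ^ (-rot σ.1.2) * P ⟨σ.1.2, states_isOTangle q D.word [] σ.1 σ.2⟩)).sum

end Jaeger

set_option linter.unusedSectionVars false

namespace Jaeger

/-! ### Words and their types -/

/-! The proof rests on one reduction principle and on two state sums.

Brackets. A tangle `x` from `s` to `t` is represented by `br P s t x`, the function sending each
possible surroundings to the value of `P` on the completed diagram. A local relation is then a
linear relation between brackets, and putting tangles into a larger one is a linear map (`ext`).

Reduction (`Reducible.exists_smul`). Let `P` take values in a module, be invariant under framed
isotopy, exchange the two crossings up to smoothings, and lose curls and circles at the cost of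
scalars. Then `P w = c • P []` for every closed `w`. Indeed a word without bottom ends can be
rewritten as a combination of standard words, in which each new arc starts at the far left and its
right leg passes over the strands it meets; this goes by induction on the number of strands. Since
the module may be a product, all members of a family of solutions share the scalar `c`. For a family
of two this is uniqueness (`IsHomfly.unique`, `IsKauffman.unique`); for an infinite family it gives
existence, see below.

State sums. A linear relation between state sums follows from the same relation between local
values, where the labels at the bottom are fixed and an arbitrary functional is applied to the rest
(`StateModel.br_value_relation`). For concrete tangles these are finitely many identities between
oriented tangles modulo the HOMFLY-PT relations; they are decided by a rewriting procedure with
symbolic coefficients that is proved sound (`StateModel.br_of_checks`). Only the exchange of distant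
pieces, an infinite family, is proved by hand. For the `B_n` states and the function `a ^ (-rot) *
P` this shows that the state sum satisfies the Kauffman relations with `A = a ^ 2 * q`
(`jaeger_uskein`). Hence `F` exists, and by uniqueness it is the state sum.

Existence of `P`. A second state model expresses a solution at `a * q` through one at `a`: strands
either remain or are erased as strands of the `sl_1` theory (`colour_hskein`). Starting at `a = 1`,
where the function vanishing on all non-empty diagrams is a solution, this gives solutions at all `a
= q ^ n`. Over the rational functions in `q` they form one family over the ring `Univ = ℤ[q, a]`
with `q`, `a`, `q ^ 2 - 1` inverted, where `a` acts on the `n`-th member as `q ^ n`. Reduction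
yields a single `c D` in `Univ` that specializes to all of them. An element of `Univ` that vanishes
at every `a = q ^ n` is zero, so `c` satisfies the HOMFLY-PT relations, and `Univ` maps to `K` for
all admissible `a` and `q` (`exists_isHomfly`). -/

theorem shift_nil {G : Type} (k : ℕ) : shift k ([] : List (ℕ × G)) = [] := rfl

theorem shift_cons {G : Type} (k i : ℕ) (g : G) (w : List (ℕ × G)) :
    shift k ((i, g) :: w) = (k + i, g) :: shift k w := rfl

theorem shift_append {G : Type} (k : ℕ) (v w : List (ℕ × G)) :
    shift k (v ++ w) = shift k v ++ shift k w := by simp [shift]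

theorem shift_shift {G : Type} (k l : ℕ) (w : List (ℕ × G)) :
    shift k (shift l w) = shift (k + l) w := by simp [shift, Nat.add_assoc]

theorem shift_zero {G : Type} (w : List (ℕ × G)) : shift 0 w = w := by simp [shift]

/-- Words in pieces of type `G`. -/
abbrev Word (G : Type) := List (ℕ × G)

/-- Pieces of diagrams whose strands carry labels in `L`. -/
class PieceSys (G : Type) (L : outParam Type) where
  bot : G → List L
  top : G → List L

open PieceSys

section typing
variable {G L : Type} [PieceSys G L] [DecidableEq L]

/-- Effect of a positioned piece on the labels of the strands. -/
def step (p : ℕ × G) (s : List L) : Option (List L) :=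
  if p.1 ≤ s.length ∧ bot p.2 <+: s.drop p.1 then
    some (s.take p.1 ++ (top p.2 ++ s.drop (p.1 + (bot p.2).length)))
  else none

/-- Labels at the top of a word, given those at its bottom. -/
def run : Word G → List L → Option (List L)
  | [], s => some s
  | p :: w, s => (step p s).bind (run w)

/-- The word `w` is a tangle diagram with labels `s` at the bottom and `t` at the top. -/
def Tng (w : Word G) (s t : List L) : Prop := run w s = some t

theorem step_eq (l r : List L) (g : G) :
    step (l.length, g) (l ++ (bot g ++ r)) = some (l ++ (top g ++ r)) := by
  simp [step, ← List.drop_drop]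

theorem step_inv {i : ℕ} {g : G} {s t : List L} (h : step (i, g) s = some t) :
    ∃ l r, l.length = i ∧ s = l ++ (bot g ++ r) ∧ t = l ++ (top g ++ r) := by
  unfold step at h
  split_ifs at h with hc
  obtain ⟨h1, r, h2⟩ := hc
  have hs : s = s.take i ++ (bot g ++ r) := by rw [h2, List.take_append_drop]
  refine ⟨s.take i, r, by simpa using h1, hs, ?_⟩
  have : s.drop (i + (bot g).length) = r := by
    rw [← List.drop_drop, ← h2]; simp
  simpa [this] using h.symm

theorem Tng.nil (s : List L) : Tng ([] : Word G) s s := rfl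

theorem tng_nil_iff {s t : List L} : Tng ([] : Word G) s t ↔ s = t := by simp [Tng, run]

theorem Tng.cons {i : ℕ} {g : G} {w : Word G} {t : List L} (l r : List L) (hi : l.length = i)
    (h : Tng w (l ++ (top g ++ r)) t) : Tng ((i, g) :: w) (l ++ (bot g ++ r)) t := by
  subst hi
  simpa [Tng, run, step_eq] using h

theorem Tng.single (l r : List L) (g : G) :
    Tng [(l.length, g)] (l ++ (bot g ++ r)) (l ++ (top g ++ r)) := Tng.cons l r rfl (Tng.nil _)

theorem tng_cons_iff {i : ℕ} {g : G} {w : Word G} {s t : List L} :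
    Tng ((i, g) :: w) s t ↔
      ∃ l r, l.length = i ∧ s = l ++ (bot g ++ r) ∧ Tng w (l ++ (top g ++ r)) t := by
  constructor
  · intro h
    obtain ⟨s', hs, hw⟩ := Option.bind_eq_some_iff.1 h
    obtain ⟨l, r, hl, rfl, rfl⟩ := step_inv hs
    exact ⟨l, r, hl, rfl, hw⟩
  · rintro ⟨l, r, hl, rfl, h⟩
    exact Tng.cons l r hl h

theorem Tng.append {v w : Word G} {s t r : List L} (hv : Tng v s t) (hw : Tng w t r) :
    Tng (v ++ w) s r := by
  induction v generalizing s with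
  | nil => rw [tng_nil_iff] at hv; subst hv; exact hw
  | cons p v ih =>
    obtain ⟨i, g⟩ := p
    obtain ⟨l, r, hl, rfl, h⟩ := tng_cons_iff.1 hv
    exact Tng.cons l r hl (ih h)

theorem tng_append_iff {v w : Word G} {s r : List L} :
    Tng (v ++ w) s r ↔ ∃ t, Tng v s t ∧ Tng w t r := by
  constructor
  · intro h
    induction v generalizing s with
    | nil => exact ⟨s, Tng.nil s, h⟩
    | cons p v ih =>
      obtain ⟨i, g⟩ := p
      obtain ⟨l, r, hl, rfl, h1⟩ := tng_cons_iff.1 h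
      obtain ⟨t, ht, h'⟩ := ih h1
      exact ⟨t, Tng.cons l r hl ht, h'⟩
  · rintro ⟨t, h1, h2⟩
    exact h1.append h2

/-- Typing is a computed partial function of the bottom labels. Hence labels at intermediate heights
can be recovered, and typings of concrete words hold by `rfl`. -/
theorem Tng.unique {w : Word G} {s t t' : List L} (h : Tng w s t) (h' : Tng w s t') : t = t' :=
  Option.some.inj (h.symm.trans h')

theorem Tng.whisker {w : Word G} {s t : List L} (h : Tng w s t) (l r : List L) :
    Tng (shift l.length w) (l ++ (s ++ r)) (l ++ (t ++ r)) := by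
  induction w generalizing s with
  | nil => rw [tng_nil_iff] at h; subst h; exact Tng.nil _
  | cons p w ih =>
    obtain ⟨i, g⟩ := p
    obtain ⟨l', r', hl, rfl, h1⟩ := tng_cons_iff.1 h
    have := Tng.cons (i := l.length + i) (g := g) (w := shift l.length w) (t := l ++ (t ++ r))
      (l ++ l') (r' ++ r) (by simp [hl]) (by simpa [List.append_assoc] using ih h1)
    simpa [shift_cons, List.append_assoc] using this

theorem Tng.left {w : Word G} {s t : List L} (h : Tng w s t) (r : List L) :
    Tng w (s ++ r) (t ++ r) := by simpa [shift_zero] using h.whisker [] r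

end typing

/-! ### Local linear relations -/

section brackets
variable {M R : Type*} {G L : Type} [PieceSys G L] [DecidableEq L]

/-- Surroundings of a tangle: strands to the left and to the right, the words below and above. -/
abbrev Ctx (G L : Type) := List L × List L × Word G × Word G

/-- `c` can surround a tangle with labels `s` at the bottom and `t` at the top. -/
def Ctx.Fits (c : Ctx G L) (s t : List L) : Prop :=
  Tng c.2.2.1 [] (c.1 ++ (s ++ c.2.1)) ∧ Tng c.2.2.2 (c.1 ++ (t ++ c.2.1)) []

/-- The diagram consisting of the tangle `w` and its surroundings. -/
def Ctx.fill (c : Ctx G L) (w : Word G) : Word G := c.2.2.1 ++ (shift c.1.length w ++ c.2.2.2)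

open Classical in
/-- The values of `P` on the diagrams that contain the tangle `w : s → t`. -/
noncomputable def br [Zero M] (P : Word G → M) (s t : List L) (w : Word G) : Ctx G L → M := fun c =>
  if c.Fits s t then P (c.fill w) else 0

theorem br_of_fits [Zero M] (P : Word G → M) {s t : List L} (w : Word G) {c : Ctx G L}
    (h : c.Fits s t) : br P s t w c = P (c.fill w) := if_pos h

theorem br_of_not_fits [Zero M] (P : Word G → M) {s t : List L} (w : Word G) {c : Ctx G L}
    (h : ¬ c.Fits s t) : br P s t w c = 0 := if_neg h

/-- The surroundings `c`, enlarged by the strands `l` and `r` and the words `u` and `v`. -/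
def Ctx.grow (c : Ctx G L) (l r : List L) (u v : Word G) : Ctx G L :=
  (c.1 ++ l, r ++ c.2.1, c.2.2.1 ++ shift c.1.length u, shift c.1.length v ++ c.2.2.2)

theorem Ctx.fill_grow (c : Ctx G L) (l r : List L) (u v w : Word G) :
    (c.grow l r u v).fill w = c.fill (u ++ (shift l.length w ++ v)) := by
  simp [Ctx.fill, Ctx.grow, shift_append, shift_shift, List.append_assoc]

theorem Ctx.Fits.grow {c : Ctx G L} {s' t' s t l r : List L} {u v : Word G} (h : c.Fits s' t')
    (hu : Tng u s' (l ++ (s ++ r))) (hv : Tng v (l ++ (t ++ r)) t') :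
    (c.grow l r u v).Fits s t := by
  constructor
  · have := h.1.append (hu.whisker c.1 c.2.1)
    simpa [Ctx.grow, List.append_assoc] using this
  · have := (hv.whisker c.1 c.2.1).append h.2
    simpa [Ctx.grow, List.append_assoc] using this

section
variable [CommRing R] [AddCommGroup M] [Module R M]

open Classical in
/-- Placing tangles into a larger tangle, as a linear map. -/
noncomputable def ext (R : Type*) [CommRing R] [Module R M] (s' t' l r : List L) (u v : Word G) :
    (Ctx G L → M) →ₗ[R] (Ctx G L → M) where
  toFun h c := if c.Fits s' t' then h (c.grow l r u v) else 0
  map_add' h h' := by funext c; by_cases hc : c.Fits s' t' <;> simp [hc]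
  map_smul' a h := by funext c; by_cases hc : c.Fits s' t' <;> simp [hc]

/-- Filling a larger tangle into `c` is the same as filling the small one into `c` enlarged by the
rest. Both sides are `0` where the larger tangle does not fit, so every linear relation between
brackets carries over to larger tangles. -/
theorem ext_br (P : Word G → M) {s' t' s t l r : List L} {u v : Word G}
    (hu : Tng u s' (l ++ (s ++ r))) (hv : Tng v (l ++ (t ++ r)) t') (w : Word G) :
    ext R s' t' l r u v (br P s t w) = br P s' t' (u ++ (shift l.length w ++ v)) := by
  funext c
  by_cases hc : c.Fits s' t'
  · simp [ext, hc, br_of_fits P _ (hc.grow hu hv), br_of_fits P _ hc, Ctx.fill_grow]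
  · simp [ext, hc, br_of_not_fits P _ hc]
end

theorem br_congr [AddCommGroup M] {P : Word G → M} {s t : List L} {x y : Word G}
    (h : br P s t x = br P s t y) {s' t' : List L} (l r : List L) (u v : Word G)
    (hu : Tng u s' (l ++ (s ++ r))) (hv : Tng v (l ++ (t ++ r)) t') :
    br P s' t' (u ++ (shift l.length x ++ v)) = br P s' t' (u ++ (shift l.length y ++ v)) := by
  -- Equalities need no scalars, so the additive structure over `ℤ` is enough.
  rw [← ext_br (R := ℤ) P hu hv, ← ext_br (R := ℤ) P hu hv, h]

theorem br_append [AddCommGroup M] {P : Word G → M} {s t : List L} {x y : Word G}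
    (h : br P s t x = br P s t y) {s' t' : List L} (u v : Word G)
    (hu : Tng u s' s) (hv : Tng v t t') :
    br P s' t' (u ++ (x ++ v)) = br P s' t' (u ++ (y ++ v)) := by
  simpa [shift_zero] using br_congr h [] [] u v (by simpa using hu) (by simpa using hv)

theorem br_post [AddCommGroup M] {P : Word G → M} {s t : List L} {x y : Word G}
    (h : br P s t x = br P s t y) {t' : List L} (v : Word G) (hv : Tng v t t') :
    br P s t' (x ++ v) = br P s t' (y ++ v) := br_append h [] v (Tng.nil s) hv

theorem br_pre [AddCommGroup M] {P : Word G → M} {s t : List L} {x y : Word G}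
    (h : br P s t x = br P s t y) {s' : List L} (u : Word G) (hu : Tng u s' s) :
    br P s' t (u ++ x) = br P s' t (u ++ y) := by
  simpa using br_append h u [] hu (Tng.nil t)

theorem br_whisker [AddCommGroup M] {P : Word G → M} {s t : List L} {x y : Word G}
    (h : br P s t x = br P s t y) (l r : List L) :
    br P (l ++ (s ++ r)) (l ++ (t ++ r)) (shift l.length x) =
      br P (l ++ (s ++ r)) (l ++ (t ++ r)) (shift l.length y) := by
  simpa using br_congr h l r [] [] (Tng.nil _) (Tng.nil _)

end brackets

end Jaeger

/-! ### Planar isotopy, the second Reidemeister move, curls and circles. -/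

namespace Jaeger
open PieceSys

/-- Labels of strands with an operation that turns a strand around. -/
class Reversal (L : Type) where
  op : L → L
  op_op : ∀ x, op (op x) = x

open Reversal

/-- Systems of pieces that consist of minima, maxima and crossings. -/
class CrossSys (G : Type) (L : outParam Type) extends PieceSys G L, Reversal L where
  cup : L → G
  cap : L → G
  cross : Bool → L → L → G
  bot_cup : ∀ x, bot (cup x) = []
  top_cup : ∀ x, top (cup x) = [x, op x]
  bot_cap : ∀ x, bot (cap x) = [x, op x]
  top_cap : ∀ x, top (cap x) = []
  bot_cross : ∀ e x y, bot (cross e x y) = [x, y]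
  top_cross : ∀ e x y, top (cross e x y) = [y, x]

open CrossSys

attribute [simp] bot_cup top_cup bot_cap top_cap bot_cross top_cross op_op

/-- `P` is invariant under planar isotopy, the second Reidemeister move, and sliding a strand
past a minimum or maximum. -/
structure Isotopy {M : Type*} {G L : Type} [CrossSys G L] [DecidableEq L] [AddCommGroup M]
    (P : Word G → M) : Prop where
  exchange : ∀ (g h : G) (m : List L),
    br P (bot g ++ (m ++ bot h)) (top g ++ (m ++ top h))
        [(0, g), ((top g).length + m.length, h)] =
      br P (bot g ++ (m ++ bot h)) (top g ++ (m ++ top h))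
        [((bot g).length + m.length, h), (0, g)]
  zigzag_left : ∀ s : L, br P [s] [s] [(1, cup (op s)), (0, cap s)] = br P [s] [s] []
  zigzag_right : ∀ s : L, br P [s] [s] [(0, cup s), (1, cap (op s))] = br P [s] [s] []
  slide_cap : ∀ (e : Bool) (x y : L),
    br P [x, y, op x] [y] [(1, cross e y (op x)), (0, cap x)] =
      br P [x, y, op x] [y] [(0, cross (!e) x y), (1, cap x)]
  slide_cup : ∀ (e : Bool) (x y : L),
    br P [y] [x, y, op x] [(0, cup x), (1, cross e (op x) y)] =
      br P [y] [x, y, op x] [(1, cup x), (0, cross (!e) y x)]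
  r2 : ∀ (e : Bool) (x y : L),
    br P [x, y] [x, y] [(0, cross e x y), (0, cross (!e) y x)] = br P [x, y] [x, y] []

variable {G L : Type} {M R : Type*} [CrossSys G L] [DecidableEq L] [AddCommGroup M]
  [CommRing R] [Module R M] {P : Word G → M}

/-- The word of a strand `x` that passes over the strands `s` from left to right. -/
def overpass (G : Type) {L : Type} [CrossSys G L] (x : L) : List L → Word G
  | [] => []
  | y :: s => (0, cross true x y) :: shift 1 (overpass G x s)

theorem tng_over (x : L) (s : List L) : Tng (overpass G x s) (x :: s) (s ++ [x]) := by
  induction s with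
  | nil => exact Tng.nil _
  | cons y s ih =>
    have h := ih.whisker [y] []
    have := Tng.cons (i := 0) (g := cross true x y) (w := shift 1 (overpass G x s))
      (t := y :: (s ++ [x])) [] s rfl (by simpa using h)
    simpa [overpass] using this

theorem over_append (x : L) (s t : List L) :
    overpass G x (s ++ t) = overpass G x s ++ shift s.length (overpass G x t) := by
  induction s with
  | nil => simp [overpass, shift_zero]
  | cons y s ih => simp [overpass, ih, shift_append, shift_shift, Nat.add_comm]

namespace Isotopy

/-- The piece `h` moves down past the pieces of `v` one at a time; the strands between it and the
current piece vary, which is why `m` is arbitrary in `Isotopy.exchange`. -/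
theorem exchange_piece (hP : Isotopy P) {v : Word G} {s s' : List L} (hv : Tng v s s') (m : List L)
    (h : G) :
    br P (s ++ (m ++ bot h)) (s' ++ (m ++ top h)) (v ++ [(s'.length + m.length, h)]) =
      br P (s ++ (m ++ bot h)) (s' ++ (m ++ top h)) ((s.length + m.length, h) :: v) := by
  induction v generalizing s with
  | nil => rw [tng_nil_iff] at hv; subst hv; rfl
  | cons p v ih =>
    obtain ⟨i, g⟩ := p
    obtain ⟨l, r, rfl, rfl, h1⟩ := tng_cons_iff.1 hv
    have e1 := br_pre (ih h1) [(l.length, g)]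
      (s' := l ++ (bot g ++ r) ++ (m ++ bot h)) (by
        simpa [List.append_assoc] using Tng.single l (r ++ (m ++ bot h)) g)
    have e2 := br_congr (hP.exchange g h (r ++ m)) l [] [] v
      (s' := l ++ (bot g ++ r) ++ (m ++ bot h)) (t' := s' ++ (m ++ top h))
      (by simpa [List.append_assoc] using Tng.nil _)
      (by simpa [List.append_assoc] using h1.left (m ++ top h))
    simp only [List.cons_append, List.nil_append, shift_cons, shift_nil] at e1 e2 ⊢
    rw [e1]
    convert e2 using 2 <;> simp [Nat.add_assoc]

/-- Tangles side by side commute: induction on `w`, one piece at a time by `exchange_piece`. -/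
theorem exchange_word (hP : Isotopy P) {v w : Word G} {s s' t t' : List L} (hv : Tng v s s')
    (hw : Tng w t t') :
    br P (s ++ t) (s' ++ t') (v ++ shift s'.length w) =
      br P (s ++ t) (s' ++ t') (shift s.length w ++ v) := by
  induction w generalizing t with
  | nil => rw [tng_nil_iff] at hw; subst hw; simp [shift_nil]
  | cons p w ih =>
    obtain ⟨i, g⟩ := p
    obtain ⟨l, r, rfl, rfl, h1⟩ := tng_cons_iff.1 hw
    have e1 := br_pre (ih h1) [(s.length + l.length, g)]
      (s' := s ++ (l ++ (bot g ++ r))) (by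
        simpa [List.append_assoc] using Tng.single (s ++ l) r g)
    have e2 := br_congr (hP.exchange_piece hv l g) [] r [] (shift s'.length w)
      (s' := s ++ (l ++ (bot g ++ r))) (t' := s' ++ t')
      (by simpa [List.append_assoc] using Tng.nil _)
      (by simpa [List.append_assoc] using h1.whisker s' [])
    simp only [List.append_assoc, Nat.zero_add, List.cons_append, List.nil_append,
      shift_cons, shift_zero, List.length_nil] at e1 e2 ⊢
    rw [e2, e1]

/-- A minimum can be pulled through below a strand. -/
theorem over_cup (hP : Isotopy P) (x y : L) :
    br P [x] [y, op y, x] ((1, cup y) :: overpass G x [y, op y]) = br P [x] [y, op y, x] [(0, cup y)] := by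
  have e1 := br_post (hP.slide_cup false y x) (t' := [y, op y, x]) [(1, cross true x (op y))]
    (by simp [Tng, run, step])
  have e2 := br_congr (hP.r2 false (op y) x) [y] [] [(0, cup y)] [] (s' := [x]) (t' := [y, op y, x])
    (by simp [Tng, run, step]) (by simp [Tng, run])
  exact e1.symm.trans e2

/-- A maximum can be pulled through below a strand. -/
theorem over_cap (hP : Isotopy P) (x y : L) :
    br P [x, y, op y] [x] (overpass G x [y, op y] ++ [(0, cap y)]) =
      br P [x, y, op y] [x] [(1, cap y)] := by
  have e1 := br_pre (hP.slide_cap true y x) (s' := [x, y, op y]) [(0, cross true x y)]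
    (by simp [Tng, run, step])
  have e2 := br_congr (hP.r2 true x y) [] [op y] [] [(1, cap y)] (s' := [x, y, op y]) (t' := [x])
    (by simp [Tng, run]) (by simp [Tng, run, step])
  exact e1.trans e2

/-- A circle can be pulled through below a strand. -/
theorem loop_right (hP : Isotopy P) (x y : L) :
    br P [x] [x] [(1, cup y), (1, cap y)] = br P [x] [x] [(0, cup y), (0, cap y)] := by
  have e1 := br_pre (hP.over_cap x y) (s' := [x]) [(1, cup y)] (by simp [Tng, run, step])
  have e2 := br_post (hP.over_cup x y) (t' := [x]) [(0, cap y)] (by simp [Tng, run, step])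
  exact e1.symm.trans e2

/-- A zigzag is inserted into the strand that leaves at the upper right, and its minimum is moved
below the crossing. -/
theorem rotate_aux (hP : Isotopy P) (e : Bool) (x y : L) :
    br P [x, y] [y, x] [(0, cross e x y)] =
      br P [x, y] [y, x] [(2, cup (op x)), (0, cross e x y), (1, cap x)] := by
  have e1 := br_congr (hP.zigzag_left x) [y] [] [(0, cross e x y)] [] (s' := [x, y]) (t' := [y, x])
    (by simp [Tng, run, step]) (by simp [Tng, run])
  have e2 := br_post (hP.exchange (cross e x y) (cup (op x)) []) (t' := [y, x]) [(1, cap x)]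
    (by simp [Tng, run, step])
  simp at e2
  exact e1.symm.trans e2

/-- A crossing is the opposite crossing turned by a right angle. -/
theorem rotate (hP : Isotopy P) (e : Bool) (x y : L) :
    br P [x, y] [y, x] [(0, cross e x y)] =
      br P [x, y] [y, x] [(2, cup (op x)), (1, cross (!e) y (op x)), (0, cap x)] := by
  rw [hP.rotate_aux]
  have e1 := br_congr (hP.slide_cap (!e) x y) [] [x] [(2, cup (op x))] [] (s' := [x, y])
    (t' := [y, x]) (by simp [Tng, run, step]) (by simp [Tng, run])
  simpa [shift_zero] using e1.symm

/-- Turning a crossing by a right angle, as a linear map. -/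
theorem exists_rotate (hP : Isotopy P) (R : Type*) [CommRing R] [Module R M] (x y : L) :
    ∃ Λ : (Ctx G L → M) →ₗ[R] (Ctx G L → M),
      (∀ e, Λ (br P [y, op x] [op x, y] [(0, cross e y (op x))]) =
        br P [x, y] [y, x] [(0, cross (!e) x y)]) ∧
      (∀ w, Tng w [y, op x] [op x, y] → Λ (br P [y, op x] [op x, y] w) =
        br P [x, y] [y, x] ((2, cup (op x)) :: (shift 1 w ++ [(0, cap x)]))) := by
  have key : ∀ w, Tng w [y, op x] [op x, y] →
      ext R [x, y] [y, x] [x] [x] [(2, cup (op x))] [(0, cap x)]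
        (br P [y, op x] [op x, y] w) =
      br P [x, y] [y, x] ((2, cup (op x)) :: (shift 1 w ++ [(0, cap x)])) := fun w _ => by
    rw [ext_br P (by simp [Tng, run, step]) (by simp [Tng, run, step])]
    simp
  refine ⟨_, fun e => ?_, key⟩
  rw [key _ (by simp [Tng, run, step]), hP.rotate]
  simp [shift]

/-! ### Curls -/

/-- A curl on a minimum multiplies the value by `κ`. -/
def _root_.Jaeger.CupCurl (P : Word G → M) (e : Bool) (x : L) (κ : R) : Prop :=
  br P [] [op x, x] [(0, cup x), (0, cross e x (op x))] = κ • br P [] [op x, x] [(0, cup (op x))]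

theorem curl_right_eq (hP : Isotopy P) (e : Bool) (s : L) :
    br P [s] [s] [(1, cup s), (0, cross e s s), (1, cap s)] =
      br P [s] [s] [(1, cup s), (1, cross (!e) s (op s)), (0, cap s)] := by
  have := br_pre (hP.slide_cap (!e) s s) (s' := [s]) [(1, cup s)] (by simp [Tng, run, step])
  simpa using this.symm

theorem curl_left_eq (hP : Isotopy P) (e : Bool) (s : L) :
    br P [s] [s] [(0, cup (op s)), (1, cross e s s), (0, cap (op s))] =
      br P [s] [s] [(0, cup (op s)), (0, cross (!e) (op s) s), (1, cap (op s))] := by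
  have := br_pre (hP.slide_cap e (op s) s) (s' := [s]) [(0, cup (op s))]
    (by simp [Tng, run, step])
  simpa using this

/-- Sliding the crossing past the maximum reverses it and leaves a curl on a minimum followed by
half of a zigzag. -/
theorem curl_right (hP : Isotopy P) {e : Bool} {s : L} {κ : R} (h : CupCurl P (!e) s κ) :
    br P [s] [s] [(1, cup s), (0, cross e s s), (1, cap s)] = κ • br P [s] [s] [] := by
  rw [hP.curl_right_eq, ← hP.zigzag_left]
  have := congrArg (ext R [s] [s] [s] [] [] [(0, cap s)]) h
  rwa [map_smul, ext_br P (by simp [Tng, run]) (by simp [Tng, run, step]),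
    ext_br P (by simp [Tng, run]) (by simp [Tng, run, step])] at this

theorem curl_left (hP : Isotopy P) {e : Bool} {s : L} {κ : R} (h : CupCurl P (!e) (op s) κ) :
    br P [s] [s] [(0, cup (op s)), (1, cross e s s), (0, cap (op s))] = κ • br P [s] [s] [] := by
  rw [hP.curl_left_eq, ← hP.zigzag_right]
  have := congrArg (ext R [s] [s] [] [s] [] [(1, cap (op s))]) h
  rw [map_smul, ext_br P (by simp [Tng, run]) (by simp [Tng, run, step]),
    ext_br P (by simp [Tng, run]) (by simp [Tng, run, step])] at this
  simpa [shift] using this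

/-- Converse of `curl_right`: a minimum attached to the lower end of the strand turns the curl on
the strand into a curl on that minimum, once a zigzag is straightened. -/
theorem cupCurl_of_curl_right (hP : Isotopy P) {e : Bool} {s : L} {κ : R}
    (h : br P [s] [s] [(1, cup s), (0, cross e s s), (1, cap s)] = κ • br P [s] [s] []) :
    CupCurl P (!e) s κ := by
  rw [hP.curl_right_eq] at h
  have h1 := congrArg (ext R [] [op s, s] [op s] [] [(0, cup (op s))] []) h
  rw [map_smul, ext_br P (by simp [Tng, run, step]) (by simp [Tng, run]),
    ext_br P (by simp [Tng, run, step]) (by simp [Tng, run])] at h1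
  have h2 := hP.exchange_word (v := [(0, cup (op s))]) (w := [(0, cup s), (0, cross (!e) s (op s))])
    (s := []) (s' := [op s, s]) (t := []) (t' := [op s, s]) (by simp [Tng, run, step])
    (by simp [Tng, run, step])
  have h3 := br_post h2 (t' := [op s, s]) [(1, cap s)] (by simp [Tng, run, step])
  have h4 := br_congr (hP.zigzag_right (op s)) [] [s] [(0, cup s), (0, cross (!e) s (op s))] []
    (s' := []) (t' := [op s, s]) (by simp [Tng, run, step]) (by simp [Tng, run])
  simp [shift] at h1 h3 h4
  rw [CupCurl, ← h1, h3, h4]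

/-- The curl is carried along the strand from a minimum to a maximum: the curl on a strand, closed
by a maximum at its upper end, becomes a curl on the maximum after sliding and straightening a
zigzag. -/
theorem capCurl (hP : Isotopy P) {e : Bool} {x : L} {κ : R} (h : CupCurl P e (op x) κ) :
    br P [x, op x] [] [(0, cross e x (op x)), (0, cap (op x))] =
      κ • br P [x, op x] [] [(0, cap x)] := by
  have h0 := hP.curl_right (e := !e) (s := op x) (κ := κ) (by simpa using h)
  have h1 := br_post (hP.slide_cup e (op x) (op x)) (t' := [op x]) [(1, cap (op x))]
    (by simp [Tng, run, step])
  simp at h1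
  rw [← h1] at h0
  have h2 := congrArg (ext R [x, op x] [] [x] [] [] [(0, cap x)]) h0
  rw [map_smul, ext_br P (by simp [Tng, run, step]) (by simp [Tng, run, step]),
    ext_br P (by simp [Tng, run, step]) (by simp [Tng, run, step])] at h2
  have h3 := hP.exchange_word (v := [(0, cap x)]) (w := [(0, cross e x (op x)), (0, cap (op x))])
    (s := [x, op x]) (s' := []) (t := [x, op x]) (t' := []) (by simp [Tng, run, step])
    (by simp [Tng, run, step])
  have h4 := br_pre h3 (s' := [x, op x]) [(1, cup (op x))] (by simp [Tng, run, step])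
  have h5 := br_congr (hP.zigzag_left x) [] [op x] [] [(0, cross e x (op x)), (0, cap (op x))]
    (s' := [x, op x]) (t' := []) (by simp [Tng, run, step]) (by simp [Tng, run, step])
  simp [shift] at h2 h4 h5
  rw [← h2, ← h4, h5]

/-! ### Loops -/

/-- If a circle next to a strand and an isolated circle can be removed, then so can every
circle. -/
theorem loop_of (hP : Isotopy P) (exh : ∀ g : G, (∃ x, g = cup x) ∨ (∃ x, g = cap x) ∨
      ∃ e x y, g = cross e x y) {d : L} {δ : R}
    (h1 : ∀ x, br P [x] [x] [(1, cup d), (1, cap d)] = δ • br P [x] [x] [])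
    (h0 : P [(0, cup d), (0, cap d)] = δ • P []) :
    br P [] [] [(0, cup d), (0, cap d)] = δ • br P [] [] [] := by
  funext ⟨l, r, u, v⟩
  by_cases hc : Ctx.Fits (G := G) (l, r, u, v) [] []
  swap
  · simp [br_of_not_fits P _ hc]
  have hcu := hc.1
  have hcv := hc.2
  simp only [List.nil_append] at hcu hcv
  rw [Pi.smul_apply, br_of_fits P _ hc, br_of_fits P _ hc]
  -- a circle to the left of a strand, in arbitrary surroundings
  have key : ∀ (x : L) (l r : List L) (u v : Word G), Tng u [] (l ++ x :: r) →
      Tng v (l ++ x :: r) [] →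
      P (u ++ (shift l.length [(0, cup d), (0, cap d)] ++ v)) = δ • P (u ++ v) := by
    intro x l r u v hu hv
    have h2 := (hP.loop_right x d).symm.trans (h1 x)
    have := congrFun h2 (l, r, u, v)
    have hf : Ctx.Fits (G := G) (l, r, u, v) [x] [x] := ⟨by simpa using hu, by simpa using hv⟩
    simpa [br_of_fits P _ hf, Ctx.fill, shift_nil] using this
  rcases r with _ | ⟨x, r⟩
  swap
  · simpa [Ctx.fill, shift_nil] using key x l r u v hcu hcv
  rcases List.eq_nil_or_concat l with rfl | ⟨l, x, rfl⟩
  swap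
  · have := congrFun (h1 x) (l, [], u, v)
    have hf : Ctx.Fits (G := G) (l, [], u, v) [x] [x] :=
      ⟨by simpa using hcu, by simpa using hcv⟩
    simpa [br_of_fits P _ hf, Ctx.fill, shift] using this
  -- no strands beside the circle
  simp only [List.nil_append] at hcu hcv
  simp only [Ctx.fill, List.length_nil, shift_zero]
  -- The last piece of `u` ends at a level without strands, so it is a maximum; if `u` is empty, the
  -- first piece of `v` is a minimum. Exchanging the circle with that piece brings it beside a
  -- strand. Only a circle that is the whole diagram needs `h0`.
  rcases List.eq_nil_or_concat u with rfl | ⟨u, ⟨i, g⟩, rfl⟩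
  · rcases v with _ | ⟨⟨i, g⟩, v⟩
    · simpa using h0
    obtain ⟨l', r', rfl, h2, h3⟩ := tng_cons_iff.1 hcv
    have h2' := h2.symm
    simp only [List.append_eq_nil_iff] at h2'
    obtain ⟨rfl, h4, rfl⟩ := h2'
    rcases exh g with ⟨x, rfl⟩ | ⟨x, rfl⟩ | ⟨e, x, y, rfl⟩
    · have e1 := hP.exchange_word (v := [(0, cup d), (0, cap d)]) (w := [(0, cup x)]) (s := [])
        (s' := []) (t := []) (t' := [x, op x]) (by simp [Tng, run, step])
        (by simp [Tng, run, step])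
      have hf : Ctx.Fits (G := G) ([], [], [], v) [] [x, op x] :=
        ⟨by simp [Tng, run], by simpa using h3⟩
      have e2 := congrFun e1 ([], [], [], v)
      simp only [List.nil_append, br_of_fits P _ hf] at e2
      have e3 := key x [] [op x] [(0, cup x)] v (by simp [Tng, run, step]) (by simpa using h3)
      simp [Ctx.fill, shift] at e2 e3 ⊢
      exact e2.trans e3
    · simp at h4
    · simp at h4
  · obtain ⟨t, hu1, hu2⟩ := tng_append_iff.1 (by simpa using hcu)
    obtain ⟨l', r', rfl, rfl, h3⟩ := tng_cons_iff.1 hu2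
    have h3' := tng_nil_iff.1 h3
    simp only [List.append_eq_nil_iff] at h3'
    obtain ⟨rfl, h4, rfl⟩ := h3'
    rcases exh g with ⟨x, rfl⟩ | ⟨x, rfl⟩ | ⟨e, x, y, rfl⟩
    · simp at h4
    · have e1 := hP.exchange_word (v := [(0, cup d), (0, cap d)]) (w := [(0, cap x)]) (s := [])
        (s' := []) (t := [x, op x]) (t' := []) (by simp [Tng, run, step])
        (by simp [Tng, run, step])
      have hf : Ctx.Fits (G := G) ([], [], u, v) [x, op x] [] :=
        ⟨by simpa using hu1, by simpa using hcv⟩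
      have e2 := congrFun e1 ([], [], u, v)
      simp only [List.nil_append, br_of_fits P _ hf] at e2
      have e3 := key x [] [op x] u ((0, cap x) :: v) (by simpa using hu1)
        (by
          simpa using Tng.cons (i := 0) (g := cap x) (w := v) (t := []) [] [] rfl
            (by simpa using hcv))
      simp [Ctx.fill, shift] at e2 e3 ⊢
      exact e2.symm.trans e3
    · simp at h4

end Isotopy

end Jaeger

/-! ### Pulling pieces below an overpassing strand; arcs and standard words. -/

namespace Jaeger
open PieceSys Reversal CrossSys

variable {G L : Type} {M R : Type*} [CrossSys G L] [DecidableEq L] [AddCommGroup M]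
  [CommRing R] [Module R M] {P : Word G → M}

/-- A generator can be pulled through below the strand `x`. -/
def PullsThrough (P : Word G → M) (x : L) (g : G) : Prop :=
  br P (x :: bot g) (top g ++ [x]) (overpass G x (bot g) ++ [(0, g)]) =
    br P (x :: bot g) (top g ++ [x]) ((1, g) :: overpass G x (top g))

namespace Isotopy

theorem pullsThrough_cup (hP : Isotopy P) (x y : L) : PullsThrough P x (cup y : G) := by
  simpa [PullsThrough, overpass] using (hP.over_cup x y).symm

theorem pullsThrough_cap (hP : Isotopy P) (x y : L) : PullsThrough P x (cap y : G) := by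
  simpa [PullsThrough, overpass] using hP.over_cap x y

/-- The piece moves past the part of the overpass to its right (`e1`), then through the part above
it (`e2`), then past the part to its left (`e3`). -/
theorem overpass_natural (hP : Isotopy P) {x : L} {g : G} (hg : PullsThrough P x g)
    (a b : List L) :
    br P (x :: (a ++ (bot g ++ b))) (a ++ (top g ++ (b ++ [x])))
        (overpass G x (a ++ (bot g ++ b)) ++ [(a.length, g)]) =
      br P (x :: (a ++ (bot g ++ b))) (a ++ (top g ++ (b ++ [x])))
        ((1 + a.length, g) :: overpass G x (a ++ (top g ++ b))) := by
  have e1 := br_congr (hP.exchange_word (v := [(0, g)]) (by simpa using Tng.single [] [] g)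
    (tng_over x b)) a [] (overpass G x a ++ shift a.length (overpass G x (bot g))) []
    (s' := x :: (a ++ (bot g ++ b))) (t' := a ++ (top g ++ (b ++ [x])))
    (by
      refine Tng.append (t := a ++ (x :: bot g ++ b)) ?_ ?_
      · simpa using (tng_over x a).left (bot g ++ b)
      · simpa using (tng_over x (bot g)).whisker a b)
    (by simpa using Tng.nil _)
  have e2 := br_congr hg a b (overpass G x a)
    (shift (a.length + (top g).length) (overpass G x b))
    (s' := x :: (a ++ (bot g ++ b))) (t' := a ++ (top g ++ (b ++ [x])))
    (by simpa using (tng_over x a).left (bot g ++ b))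
    (by simpa using (tng_over x b).whisker (a ++ top g) [])
  have e3 := br_congr (hP.exchange_piece (tng_over x a) [] g) [] b []
    (shift a.length (overpass G x (top g)) ++
      shift (a.length + (top g).length) (overpass G x b))
    (s' := x :: (a ++ (bot g ++ b))) (t' := a ++ (top g ++ (b ++ [x])))
    (by simpa using Tng.nil _)
    (by
      refine Tng.append (t := a ++ (top g ++ (x :: b))) ?_ ?_
      · simpa using (tng_over x (top g)).whisker a b
      · simpa using (tng_over x b).whisker (a ++ top g) [])
  simp only [over_append, shift_append, shift_shift, shift_cons, shift_nil, List.append_assoc,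
    List.cons_append, List.nil_append, List.append_nil, Nat.add_zero, shift_zero, List.length_nil,
    List.length_append, List.length_cons, List.length_nil, Nat.zero_add,
    Nat.add_comm _ 1] at e1 e2 e3 ⊢
  rw [← e1, e2, e3]

end Isotopy

/-- The word of an arc: a minimum at the far left whose right leg passes over the strands `s`. -/
def arc (G : Type) {L : Type} [CrossSys G L] (d : L) (s : List L) : Word G :=
  (0, cup d) :: shift 1 (overpass G (op d) s)

theorem tng_arc (d : L) (s r : List L) :
    Tng (arc G d s) (s ++ r) (d :: (s ++ (op d :: r))) := by
  have h := Tng.cons (i := 0) (g := (cup d : G)) (w := shift 1 (overpass G (op d) s))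
    (t := d :: (s ++ (op d :: r))) [] (s ++ r) rfl
    (by simpa using (tng_over (G := G) (op d) s).whisker [d] r)
  simpa [arc] using h

/-- A piece acting on strands under the arc can be moved below it. The piece then acts on two
strands fewer, which drives the induction; `arc_exchange` does the same for a piece to the right of
the arc. -/
theorem Isotopy.arc_natural (hP : Isotopy P) {d : L} {g : G} (hg : PullsThrough P (op d) g)
    (a b r : List L) :
    br P (a ++ (bot g ++ (b ++ r))) (d :: (a ++ (top g ++ (b ++ (op d :: r)))))
        (arc G d (a ++ (bot g ++ b)) ++ [(1 + a.length, g)]) =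
      br P (a ++ (bot g ++ (b ++ r))) (d :: (a ++ (top g ++ (b ++ (op d :: r)))))
        ((a.length, g) :: arc G d (a ++ (top g ++ b))) := by
  have e1 := br_congr (hP.overpass_natural hg a b) [d] r [(0, cup d)] []
    (s' := a ++ (bot g ++ (b ++ r))) (t' := d :: (a ++ (top g ++ (b ++ (op d :: r)))))
    (by simpa using Tng.single [] (a ++ (bot g ++ (b ++ r))) (cup d : G))
    (by simpa using Tng.nil _)
  have e2 := br_congr (hP.exchange (cup d) g a) [] (b ++ r) []
    (shift 1 (overpass G (op d) (a ++ (top g ++ b))))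
    (s' := a ++ (bot g ++ (b ++ r))) (t' := d :: (a ++ (top g ++ (b ++ (op d :: r)))))
    (by simpa using Tng.nil _)
    (by simpa using (tng_over (G := G) (op d) (a ++ (top g ++ b))).whisker [d] r)
  simp [arc, shift_append, shift_cons, shift_nil, shift_zero, ← Nat.add_assoc] at e1 e2 ⊢
  rw [e1, ← e2]

theorem Isotopy.arc_exchange (hP : Isotopy P) (d : L) (g : G) (s a b : List L) :
    br P (s ++ (a ++ (bot g ++ b))) (d :: (s ++ (op d :: (a ++ (top g ++ b)))))
        (arc G d s ++ [(s.length + 2 + a.length, g)]) =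
      br P (s ++ (a ++ (bot g ++ b))) (d :: (s ++ (op d :: (a ++ (top g ++ b)))))
        ((s.length + a.length, g) :: arc G d s) := by
  have e1 := br_congr (hP.exchange_piece (tng_arc d s []) a g) [] b [] []
    (s' := s ++ (a ++ (bot g ++ b))) (t' := d :: (s ++ (op d :: (a ++ (top g ++ b)))))
    (by simpa using Tng.nil _) (by simpa using Tng.nil _)
  simpa [shift_zero] using e1

/-! ### Standard diagrams -/

/-- Standard words without bottom ends: arcs are added one after the other. -/
inductive Std : List L → Word G → Prop
  | nil : Std [] []
  | arc (d : L) (s r : List L) (w : Word G) :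
      Std (s ++ r) w → Std (d :: (s ++ (op d :: r))) (w ++ Jaeger.arc G d s)

theorem Std.tng {s : List L} {w : Word G} (h : Std s w) : Tng w [] s := by
  induction h with
  | nil => exact Tng.nil _
  | arc d s r w _ ih => exact ih.append (tng_arc d s r)

variable (R) in
/-- The span of the standard words. -/
noncomputable def stdSpan (P : Word G → M) (s : List L) : Submodule R (Ctx G L → M) :=
  Submodule.span R {f | ∃ w, Std s w ∧ f = br P [] s w}

variable (R) in
/-- The word `v` maps combinations of standard words to combinations of standard words. -/
def Closed (P : Word G → M) (s t : List L) (v : Word G) : Prop :=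
  ∀ w, Std s w → br P [] t (w ++ v) ∈ stdSpan R P t

theorem Closed.map_mem {s t : List L} {v : Word G} (h : Closed R P s t v) (hv : Tng v s t)
    {f : Ctx G L → M} (hf : f ∈ stdSpan R P s) : ext R [] t [] [] [] v f ∈ stdSpan R P t := by
  suffices stdSpan R P s ≤ (stdSpan R P t).comap (ext R [] t [] [] [] v) from this hf
  refine Submodule.span_le.2 ?_
  rintro _ ⟨w, hw, rfl⟩
  have := ext_br (R := R) (s' := []) (s := []) (l := []) (r := []) (u := []) P (Tng.nil _)
    (by simpa using hv) w
  simp only [List.append_nil, List.nil_append, List.length_nil, shift_zero] at this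
  simpa [this] using h w hw

theorem Closed.comp {s t r : List L} {v w : Word G} (hv : Closed R P s t v)
    (hw : Closed R P t r w) (hw' : Tng w t r) : Closed R P s r (v ++ w) := by
  intro u hu
  have h := hw.map_mem hw' (hv u hu)
  have := ext_br (R := R) (s' := []) (s := []) (l := []) (r := []) (u := []) P (Tng.nil _)
    (by simpa using hw') (u ++ v)
  simp only [List.append_nil, List.nil_append, List.length_nil, shift_zero] at this
  rwa [this, List.append_assoc] at h

/-- Preceding by a standard word is a linear map on brackets, so it suffices to write the bracket as
a combination of brackets of words already treated. Relations between tangles are used only in this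
way below. -/
theorem Closed.of_mem {s t : List L} {x : Word G}
    (h : br P s t x ∈ Submodule.span R {f | ∃ y, Closed R P s t y ∧ f = br P s t y}) :
    Closed R P s t x := by
  intro w hw
  have key : ∀ y, ext R [] t [] [] w [] (br P s t y) = br P [] t (w ++ y) := fun y => by
    rw [ext_br P (by simpa using hw.tng) (by simpa using Tng.nil _)]
    simp [shift_zero]
  suffices Submodule.span R {f | ∃ y, Closed R P s t y ∧ f = br P s t y} ≤
      (stdSpan R P t).comap (ext R [] t [] [] w []) by
    have := this h
    rwa [Submodule.mem_comap, key] at this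
  refine Submodule.span_le.2 ?_
  rintro _ ⟨y, hy, rfl⟩
  simpa [key] using hy w hw

theorem Closed.mem {s t : List L} {y : Word G} (h : Closed R P s t y) :
    br P s t y ∈ Submodule.span R {f | ∃ y, Closed R P s t y ∧ f = br P s t y} :=
  Submodule.subset_span ⟨y, h, rfl⟩

theorem Closed.of_eq {s t : List L} {x y : Word G} (h : Closed R P s t y)
    (e : br P s t x = br P s t y) : Closed R P s t x := Closed.of_mem (e ▸ h.mem)

theorem Closed.of_smul {s t : List L} {x y : Word G} {κ : R} (h : Closed R P s t y)
    (e : br P s t x = κ • br P s t y) : Closed R P s t x :=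
  Closed.of_mem (e ▸ Submodule.smul_mem _ κ h.mem)

theorem Closed.nil (s : List L) : Closed R P s s [] := fun w hw => by
  rw [List.append_nil]; exact Submodule.subset_span ⟨w, hw, rfl⟩

theorem Closed.arc (d : L) (s r : List L) :
    Closed R P (s ++ r) (d :: (s ++ (op d :: r))) (Jaeger.arc G d s) := fun w hw =>
  Submodule.subset_span ⟨_, Std.arc d s r w hw, rfl⟩

/-- Case distinction on the last arc of a standard word. It starts at the far left, so its left leg
is the first strand. -/
theorem Closed.of_arcs {s t : List L} {v : Word G}
    (h0 : s = [] → Closed R P [] t v)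
    (h : ∀ d s' r, s = d :: (s' ++ (op d :: r)) → Closed R P (s' ++ r) t (Jaeger.arc G d s' ++ v)) :
    Closed R P s t v := by
  intro w hw
  cases hw with
  | nil => exact h0 rfl _ Std.nil
  | arc d s' r w' hw' =>
    rw [List.append_assoc]
    exact h d s' r rfl _ hw'

end Jaeger

/-! ### Every closed diagram reduces to a multiple of the empty one. -/

namespace Jaeger
open PieceSys Reversal CrossSys

variable {G L : Type} {M R : Type*} [CrossSys G L] [DecidableEq L] [AddCommGroup M]
  [CommRing R] [Module R M] {P : Word G → M}

variable (R) in
/-- `P` satisfies relations by which every closed diagram can be reduced to the empty one. -/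
structure Reducible (P : Word G → M) : Prop extends Isotopy P where
  exhaust : ∀ g : G, (∃ x, g = cup x) ∨ (∃ x, g = cap x) ∨ ∃ e x y, g = cross e x y
  r3 : ∀ x y z : L, PullsThrough P x (cross true y z : G)
  -- The two smoothings carry matching labels only if `x = y` and `y = op x`, respectively;
  -- otherwise the coefficient must be `0`, since the bracket of an ill-typed word has no meaning.
  switch : ∀ x y : L, ∃ α β : R, (x ≠ y → α = 0) ∧ (y ≠ op x → β = 0) ∧
    br P [x, y] [y, x] [(0, cross true x y)] - br P [x, y] [y, x] [(0, cross false x y)] =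
      α • br P [x, y] [y, x] [] + β • br P [x, y] [y, x] [(0, cap x), (0, cup y)]
  curl : ∀ (e : Bool) (x : L), ∃ κ : R, CupCurl P e x κ
  loop : ∀ x : L, ∃ δ : R, br P [] [] [(0, cup x), (0, cap x)] = δ • br P [] [] []

theorem append_eq_arc {l r s t : List L} {d : L} (h : l ++ r = s ++ (d :: t)) :
    (∃ b, s = l ++ b ∧ r = b ++ (d :: t)) ∨ (∃ a, l = s ++ (d :: a) ∧ t = a ++ r) := by
  rcases List.append_eq_append_iff.1 h with ⟨a, rfl, rfl⟩ | ⟨a, rfl, h'⟩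
  · exact Or.inl ⟨a, rfl, rfl⟩
  · cases a with
    | nil => exact Or.inl ⟨[], by simp, by simpa using h'.symm⟩
    | cons c a =>
      simp only [List.cons_append, List.cons.injEq] at h'
      obtain ⟨rfl, rfl⟩ := h'
      exact Or.inr ⟨a, rfl, rfl⟩

/-- The positions of two adjacent strands relative to the right leg `d` of the outermost arc: both
under the arc, the leg second, the leg first, both beyond the leg. -/
theorem append_two_eq_arc {l r s t : List L} {x y d : L}
    (h : l ++ (x :: y :: r) = s ++ (d :: t)) :
    (∃ b, s = l ++ (x :: y :: b) ∧ r = b ++ (d :: t)) ∨ (s = l ++ [x] ∧ y = d ∧ t = r) ∨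
      (s = l ∧ x = d ∧ t = y :: r) ∨ ∃ a, l = s ++ (d :: a) ∧ t = a ++ (x :: y :: r) := by
  rcases append_eq_arc h with ⟨b, rfl, h'⟩ | h'
  · rcases b with _ | ⟨b1, _ | ⟨b2, b⟩⟩ <;> simp at h'
    · obtain ⟨rfl, rfl⟩ := h'
      simp
    · obtain ⟨rfl, rfl, rfl⟩ := h'
      simp
    · obtain ⟨rfl, rfl, rfl⟩ := h'
      simp
  · exact Or.inr (Or.inr (Or.inr h'))

namespace Reducible

/-- By `arc_natural` the piece can act before the arc is added, and adding an arc preserves standard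
words. -/
theorem closed_natural (hP : Reducible R P) {d : L} {g : G} (hg : PullsThrough P (op d) g)
    {a b r : List L}
    (h : Closed R P (a ++ (bot g ++ (b ++ r))) (a ++ (top g ++ (b ++ r))) [(a.length, g)]) :
    Closed R P (a ++ (bot g ++ (b ++ r))) (d :: (a ++ (top g ++ (b ++ (op d :: r)))))
      (arc G d (a ++ (bot g ++ b)) ++ [(1 + a.length, g)]) := by
  refine Closed.of_eq ?_ (hP.arc_natural hg a b r)
  have := h.comp (w := arc G d (a ++ (top g ++ b)))
    (t := a ++ (top g ++ (b ++ r))) (r := d :: (a ++ (top g ++ (b ++ (op d :: r)))))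
    (by simpa using Closed.arc (R := R) (P := P) d (a ++ (top g ++ b)) r)
    (by simpa using tng_arc (G := G) d (a ++ (top g ++ b)) r)
  exact this

theorem closed_exchange (hP : Reducible R P) {d : L} {g : G} {s a b : List L}
    (h : Closed R P (s ++ (a ++ (bot g ++ b))) (s ++ (a ++ (top g ++ b)))
      [(s.length + a.length, g)]) :
    Closed R P (s ++ (a ++ (bot g ++ b))) (d :: (s ++ (op d :: (a ++ (top g ++ b)))))
      (arc G d s ++ [(s.length + 2 + a.length, g)]) :=
  Closed.of_eq (h.comp (Closed.arc d s (a ++ (top g ++ b))) (tng_arc d s _))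
    (hP.arc_exchange d g s a b)

/-- A minimum at the far left is itself an arc over no strands. Any other minimum lies under the
outermost arc or beyond its right leg, and below that arc it has fewer strands to its left. -/
theorem closed_cup (hP : Reducible R P) (x : L) (n : ℕ) : ∀ l r : List L, l.length ≤ n →
    Closed R P (l ++ r) (l ++ (x :: op x :: r)) [(l.length, cup x)] := by
  induction n with
  | zero =>
    intro l r hl
    obtain rfl := List.length_eq_zero_iff.1 (Nat.le_zero.1 hl)
    simpa [arc, overpass, shift] using Closed.arc (R := R) (P := P) x [] r
  | succ n ih =>
    intro l r hl
    rcases l with _ | ⟨d, l⟩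
    · exact ih [] r (Nat.zero_le _)
    simp only [List.length_cons, Nat.add_le_add_iff_right] at hl
    refine Closed.of_arcs (by simp) fun d' s' r' h => ?_
    simp only [List.cons_append, List.cons.injEq] at h
    obtain ⟨rfl, h⟩ := h
    rcases append_eq_arc h with ⟨b, rfl, rfl⟩ | ⟨a, rfl, rfl⟩
    · simpa [Nat.add_comm] using hP.closed_natural (d := d) (hP.pullsThrough_cup (op d) x)
        (a := l) (b := b) (r := r') (by simpa using ih l (b ++ r') hl)
    · have := hP.closed_exchange (d := d) (g := cup x) (s := s') (a := a) (b := r) (by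
        simpa [Nat.add_assoc] using ih (s' ++ a) r (by simp at hl ⊢; omega))
      simpa [Nat.add_assoc, Nat.add_comm, Nat.add_left_comm] using this

/-- The overpass is treated crossing by crossing. The bound `k` allows it to be used while crossings
at the far left are still unknown. -/
theorem closed_overpass {k n : ℕ}
    (hcross : ∀ e l x y r, k ≤ l.length → (l ++ (x :: y :: r)).length ≤ n →
      Closed R P (l ++ (x :: y :: r)) (l ++ (y :: x :: r)) [(l.length, cross e x y)])
    (x : L) (s : List L) : ∀ l r, k ≤ l.length → (l ++ (x :: (s ++ r))).length ≤ n →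
      Closed R P (l ++ (x :: (s ++ r))) (l ++ (s ++ (x :: r)))
        (shift l.length (overpass G x s)) := by
  induction s with
  | nil => intro l r _ _; simpa [overpass, shift] using Closed.nil (R := R) (P := P) (l ++ x :: r)
  | cons y s ih =>
    intro l r hk hl
    have h1 := hcross true l x y (s ++ r) hk (by simpa using hl)
    have h2 := ih (l ++ [y]) r (by simp; omega) (by simp at hl ⊢; omega)
    have h3 := (tng_over (G := G) x s).whisker (l ++ [y]) r
    have := h1.comp (by simpa using h2) (by simpa using h3)
    simpa [overpass, shift_cons, shift_shift] using this

/-- Capping the right leg of the arc with its neighbour `d` makes the arc a hook, which carries the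
strand `d` over `s` to the far left. Sliding the crossings of the hook past the maximum, starting
with the last, turns them into crossings below the arc, with two strands fewer. -/
theorem closed_arc_cap (hP : Reducible R P) {n : ℕ}
    (hcross : ∀ e l x y r, (l ++ (x :: y :: r)).length ≤ n →
      Closed R P (l ++ (x :: y :: r)) (l ++ (y :: x :: r)) [(l.length, cross e x y)])
    (d : L) (s : List L) : ∀ r : List L, (s ++ (d :: r)).length ≤ n →
      Closed R P (s ++ (d :: r)) (d :: (s ++ r)) (arc G d s ++ [(1 + s.length, cap (op d))]) := by
  induction s using List.reverseRecOn with
  | nil =>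
    intro r _
    refine Closed.of_eq (Closed.nil _) ?_
    simpa [arc, overpass, shift] using br_whisker (hP.zigzag_right d) [] r
  | append_singleton s y ih =>
    intro r hl
    have h1 := (hcross false s y d r (by simpa using hl)).comp
      (ih (y :: r) (by simp at hl ⊢; omega))
      ((tng_arc (G := G) d s (d :: y :: r)).append (by
        simpa [Nat.add_comm] using Tng.single (G := G) (d :: s) (y :: r) (cap (op d))))
    have e1 := br_congr (hP.slide_cap false (op d) y) (d :: s) r (arc G d s) []
      (s' := s ++ (y :: d :: r)) (t' := d :: (s ++ (y :: r)))
      (by simpa using tng_arc (G := G) d s (y :: d :: r)) (by simpa using Tng.nil _)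
    have e2 := br_congr (hP.arc_exchange d (cross false y d) s [] r) [] []
      [] [(1 + s.length, cap (op d))]
      (s' := s ++ (y :: d :: r)) (t' := d :: (s ++ (y :: r)))
      (by simpa using Tng.nil _)
      (by simpa [Nat.add_comm] using Tng.single (G := G) (d :: s) (y :: r) (cap (op d)))
    refine Closed.of_eq (by simpa using h1) ?_
    simp [arc, over_append, overpass, shift_cons, shift_nil, shift_append, shift_zero, Nat.add_comm,
      Nat.add_left_comm] at e1 e2 ⊢
    rw [← e1, e2]

/-- All caps on `n` strands map combinations of standard words to such. -/
theorem closed_cap (hP : Reducible R P) {n : ℕ}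
    (hcap : ∀ l x r, (l ++ (x :: op x :: r)).length ≤ n →
      Closed R P (l ++ (x :: op x :: r)) (l ++ r) [(l.length, cap x)])
    (hcross : ∀ e l x y r, (l ++ (x :: y :: r)).length ≤ n →
      Closed R P (l ++ (x :: y :: r)) (l ++ (y :: x :: r)) [(l.length, cross e x y)])
    (l : List L) (x : L) (r : List L) (hl : (l ++ (x :: op x :: r)).length ≤ n + 2) :
    Closed R P (l ++ (x :: op x :: r)) (l ++ r) [(l.length, cap x)] := by
  refine Closed.of_arcs (by simp) fun d s r' h => ?_
  rcases l with _ | ⟨d', l⟩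
  · simp only [List.nil_append, List.cons.injEq] at h ⊢
    obtain ⟨rfl, h⟩ := h
    rcases s with _ | ⟨y, s⟩
    -- The maximum joins the two legs of the arc: a circle.
    · simp only [List.nil_append, List.cons.injEq, true_and] at h
      subst h
      obtain ⟨δ, hδ⟩ := hP.loop x
      refine Closed.of_smul (Closed.nil r) (κ := δ) ?_
      have := congrArg (ext R r r [] r [] []) hδ
      rw [map_smul, ext_br P (by simpa using Tng.nil _) (by simpa using Tng.nil _),
        ext_br P (by simpa using Tng.nil _) (by simpa using Tng.nil _)] at this
      simpa [arc, overpass, shift] using this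
    -- The maximum joins the left leg to the first strand that the right leg passes over: a curl.
    -- After its removal an overpass over `s` remains, on two strands fewer.
    · simp only [List.cons_append, List.cons.injEq] at h
      obtain ⟨rfl, rfl⟩ := h
      obtain ⟨κ, hκ⟩ := hP.curl false x
      have h1 := hP.curl_left (e := true) (s := op x) (κ := κ) (by simpa using hκ)
      refine Closed.of_smul (κ := κ) (y := overpass G (op x) s) ?_ ?_
      · have := closed_overpass (k := 0) (fun e l x y r _ => hcross e l x y r) (op x) s [] r'
          le_rfl (by simp at hl ⊢; omega)
        simpa [shift_zero] using this
      · have e1 := br_congr (hP.exchange_word (v := [(0, cap x)]) (s := [x, op x]) (s' := [])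
          (by simp [Tng, run, step]) (tng_over (op x) s)) [] r'
          [(0, cup x), (1, cross true (op x) (op x))] []
          (s' := op x :: (s ++ r')) (t' := s ++ (op x :: r'))
          (by simp [Tng, run, step]) (by simpa using Tng.nil _)
        have e2 := congrArg (ext R (op x :: (s ++ r')) (s ++ (op x :: r')) [] (s ++ r') []
          (overpass G (op x) s)) h1
        have h2 := (tng_over (G := G) (op x) s).left r'
        rw [map_smul, ext_br P (by simpa using Tng.nil _) (by simpa using h2),
          ext_br P (by simpa using Tng.nil _) (by simpa using h2)] at e2
        simp [arc, overpass, shift_cons, shift_nil, shift_append, shift_shift, shift_zero] at e1 e2 ⊢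
        rw [← e1, e2]
  · simp only [List.cons_append, List.cons.injEq] at h
    obtain ⟨rfl, h⟩ := h
    rcases append_two_eq_arc h with ⟨b, rfl, rfl⟩ | ⟨rfl, h', rfl⟩ | ⟨rfl, rfl, rfl⟩ | ⟨a, rfl, rfl⟩
    · have h1 := hcap l x (b ++ r') (by simp at hl ⊢; omega)
      simpa [Nat.add_comm] using hP.closed_natural (d := d') (hP.pullsThrough_cap (op d') x)
        (a := l) (b := b) (r := r') (by simpa using h1)
    -- The maximum joins the right leg to the last strand it has crossed: a curl on the maximum,
    -- whose removal leaves the hook of `closed_arc_cap`.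
    · obtain rfl : x = d' := by simpa using congrArg op h'
      obtain ⟨κ, hκ⟩ := hP.curl true x
      have h1 := hP.capCurl (e := true) (x := op x) (κ := κ) (by simpa using hκ)
      refine Closed.of_smul (κ := κ)
        (by simpa using hP.closed_arc_cap hcross x l r' (by simp at hl ⊢; omega)) ?_
      have e2 := congrArg (ext R (l ++ (x :: r')) (x :: (l ++ r')) (x :: l) r' (arc G x l) []) h1
      have h2 := tng_arc (G := G) x l (x :: r')
      rw [map_smul, ext_br P (by simpa using h2) (by simpa using Tng.nil _),
        ext_br P (by simpa using h2) (by simpa using Tng.nil _)] at e2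
      simpa [arc, over_append, overpass, shift_cons, shift_nil, shift_append, Nat.add_comm] using e2
    · simpa [Nat.add_comm] using hP.closed_arc_cap hcross d' s r (by simp at hl ⊢; omega)
    · have h1 := hcap (s ++ a) x r (by simp at hl ⊢; omega)
      have := hP.closed_exchange (d := d') (g := cap x) (s := s) (a := a) (b := r)
        (by simpa using h1)
      simpa [Nat.add_assoc, Nat.add_comm, Nat.add_left_comm] using this

/-- It suffices to treat one of the two crossings. -/
theorem closed_switch (hP : Reducible R P) {s l r : List L} {x y : L} {u : Word G} (e : Bool)
    (hu : Tng u s (l ++ (x :: y :: r))) (hu' : Closed R P s (l ++ (x :: y :: r)) u)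
    (hcap : y = op x → Closed R P (l ++ (x :: y :: r)) (l ++ r) [(l.length, cap x)])
    (h : Closed R P s (l ++ (y :: x :: r)) (u ++ [(l.length, cross (!e) x y)])) :
    Closed R P s (l ++ (y :: x :: r)) (u ++ [(l.length, cross e x y)]) := by
  obtain ⟨α, β, hα, hβ, h1⟩ := hP.switch x y
  have e1 := congrArg (ext R s (l ++ (y :: x :: r)) l r u []) h1
  have key : ∀ w, ext R s (l ++ (y :: x :: r)) l r u [] (br P [x, y] [y, x] w) =
      br P s (l ++ (y :: x :: r)) (u ++ shift l.length w) := fun w => by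
    rw [ext_br P (by simpa using hu) (by simpa using Tng.nil _)]
    simp
  simp only [map_sub, map_add, map_smul, key, shift_cons, shift_nil, Nat.add_zero,
    List.append_nil] at e1
  have h2 : α • br P s (l ++ (y :: x :: r)) u ∈ Submodule.span R
      {f | ∃ v, Closed R P s (l ++ (y :: x :: r)) v ∧ f = br P s (l ++ (y :: x :: r)) v} := by
    by_cases hxy : x = y
    · subst hxy
      exact Submodule.smul_mem _ _ hu'.mem
    · simp [hα hxy]
  have h3 : β • br P s (l ++ (y :: x :: r)) (u ++ [(l.length, cap x), (l.length, cup y)]) ∈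
      Submodule.span R
        {f | ∃ v, Closed R P s (l ++ (y :: x :: r)) v ∧ f = br P s (l ++ (y :: x :: r)) v} := by
    by_cases hxy : y = op x
    · have h4 := (hcap hxy).comp (hP.closed_cup y l.length l r le_rfl)
        (by simpa using Tng.single (G := G) l r (cup y))
      have h5 : Tng [(l.length, (cap x : G)), (l.length, cup y)] (l ++ (x :: y :: r))
          (l ++ (y :: x :: r)) := by
        subst hxy
        have h6 := Tng.single (G := G) l r (cap x)
        have h7 := Tng.single (G := G) l r (cup (op x))
        simp only [bot_cap, top_cap, bot_cup, top_cup, op_op] at h6 h7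
        exact h6.append h7
      have h8 := hu'.comp (by subst hxy; simpa using h4) h5
      exact Submodule.smul_mem _ _ h8.mem
    · simp [hβ hxy]
  refine Closed.of_mem ?_
  rw [sub_eq_iff_eq_add] at e1
  cases e
  · rw [← sub_eq_iff_eq_add'.2 e1]
    exact Submodule.sub_mem _ h.mem (Submodule.add_mem _ h2 h3)
  · rw [e1]
    exact Submodule.add_mem _ (Submodule.add_mem _ h2 h3) h.mem

/-- Relative to the outermost arc, the crossing lies under it, beyond it, or involves one of its
legs. In each position one of the two crossings simplifies by isotopy, and the other is reduced to
it by the skein relation. The horizontal smoothing in that relation is the reason why maxima on `n +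
2` strands have to be treated first. -/
theorem closed_cross (hP : Reducible R P) {n : ℕ}
    (hcap : ∀ l x r, (l ++ (x :: op x :: r)).length ≤ n + 2 →
      Closed R P (l ++ (x :: op x :: r)) (l ++ r) [(l.length, cap x)])
    (hcross : ∀ e l x y r, (l ++ (x :: y :: r)).length ≤ n →
      Closed R P (l ++ (x :: y :: r)) (l ++ (y :: x :: r)) [(l.length, cross e x y)])
    (e : Bool) (l : List L) (x y : L) (r : List L) (hl : (l ++ (x :: y :: r)).length ≤ n + 2) :
    Closed R P (l ++ (x :: y :: r)) (l ++ (y :: x :: r)) [(l.length, cross e x y)] := by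
  -- One of the two crossings is enough, and it may be chosen according to the position.
  have key : ∀ d s r' l x y r, d :: (s ++ (op d :: r')) = l ++ (x :: y :: r) →
      (l ++ (x :: y :: r)).length ≤ n + 2 →
      (∃ e, Closed R P (s ++ r') (l ++ (y :: x :: r))
        (arc G d s ++ [(l.length, cross e x y)])) →
      ∀ e, Closed R P (s ++ r') (l ++ (y :: x :: r))
        (arc G d s ++ [(l.length, cross e x y)]) := by
    rintro d s r' l x y r h hl ⟨e', h'⟩ e
    rcases Bool.eq_or_eq_not e e' with rfl | rfl
    · exact h'
    · refine hP.closed_switch _ (h ▸ tng_arc d s r') (h ▸ Closed.arc d s r') (fun hxy => ?_)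
        (by simpa using h')
      subst hxy
      exact hcap l x r hl
  -- Crossings that avoid the first strand come first: a crossing at the far left is reduced below
  -- to an overpass on the same number of strands, and that overpass avoids the first strand.
  have hpos : ∀ e d l x y r, (d :: l ++ (x :: y :: r)).length ≤ n + 2 →
      Closed R P (d :: l ++ (x :: y :: r)) (d :: l ++ (y :: x :: r))
        [((d :: l).length, cross e x y)] := by
    intro e d l x y r hl
    refine Closed.of_arcs (by simp) fun d' s r' h => ?_
    refine key d' s r' (d :: l) x y r h.symm hl ?_ e
    simp only [List.cons_append, List.cons.injEq] at h
    obtain ⟨rfl, h⟩ := h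
    -- Under the arc, the crossing is pulled through by the third move. With the leg second, `cross
    -- false` cancels the last crossing of the arc; with the leg first, `cross true` makes the arc
    -- longer. Beyond the leg it is exchanged with the arc.
    rcases append_two_eq_arc h with ⟨b, rfl, rfl⟩ | ⟨rfl, rfl, rfl⟩ | ⟨rfl, rfl, rfl⟩ |
      ⟨a, rfl, rfl⟩
    · have h1 := hcross true l x y (b ++ r') (by simp at hl ⊢; omega)
      have h2 := hP.closed_natural (d := d) (hP.r3 (op d) x y) (a := l) (b := b) (r := r')
        (by simpa using h1)
      exact ⟨true, by simpa [Nat.add_comm] using h2⟩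
    · refine ⟨false, Closed.of_eq (y := arc G d l) (by simpa using Closed.arc d l (x :: r')) ?_⟩
      have := br_congr (hP.r2 true (op d) x) (d :: l) r' (arc G d l) []
        (s' := l ++ (x :: r')) (t' := d :: (l ++ (op d :: x :: r')))
        (by simpa using tng_arc (G := G) d l (x :: r')) (by simpa using Tng.nil _)
      simpa [arc, over_append, overpass, shift_cons, shift_nil, shift_append, Nat.add_comm]
        using this
    · refine ⟨true, ?_⟩
      have := Closed.arc (R := R) (P := P) d (s ++ [y]) r
      simpa [arc, over_append, overpass, shift_cons, shift_nil, shift_append, Nat.add_comm]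
        using this
    · have h1 := hcross true (s ++ a) x y r (by simp at hl ⊢; omega)
      have := hP.closed_exchange (d := d) (g := cross true x y) (s := s) (a := a) (b := r)
        (by simpa using h1)
      exact ⟨true, by simpa [Nat.add_assoc, Nat.add_comm, Nat.add_left_comm] using this⟩
  rcases l with _ | ⟨d, l⟩
  swap
  · exact hpos e d l x y r hl
  refine Closed.of_arcs (by simp) fun d s r' h => ?_
  refine key d s r' [] x y r h.symm hl ?_ e
  simp only [List.nil_append, List.cons.injEq] at h hl
  obtain ⟨rfl, h⟩ := h
  -- The left leg of the arc is involved. If the arc passes over nothing, the crossing is a curl on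
  -- a minimum. Otherwise sliding the minimum past the second strand creates the opposite crossing,
  -- which cancels the given one.
  rcases s with _ | ⟨z, s⟩
  · simp only [List.nil_append, List.cons.injEq] at h
    obtain ⟨rfl, rfl⟩ := h
    obtain ⟨κ, hκ⟩ := hP.curl true x
    refine ⟨true, Closed.of_smul (κ := κ) (y := arc G (op x) [])
      (by simpa using Closed.arc (R := R) (P := P) (op x) [] r) ?_⟩
    have := congrArg (ext R r (op x :: x :: r) [] r [] []) hκ
    rw [map_smul, ext_br P (by simpa using Tng.nil _) (by simpa using Tng.nil _),
      ext_br P (by simpa using Tng.nil _) (by simpa using Tng.nil _)] at this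
    simpa [arc, overpass, shift] using this
  · simp only [List.cons_append, List.cons.injEq] at h
    obtain ⟨rfl, rfl⟩ := h
    have h1 := hP.closed_cup x 1 [y] (s ++ r') le_rfl
    have h2 : Closed R P ([y, x] ++ (op x :: (s ++ r'))) ([y, x] ++ (s ++ (op x :: r')))
        (shift 2 (overpass G (op x) s)) := by
      refine closed_overpass (k := 1) (n := n + 2) (fun e l x y r hk hl => ?_) (op x) s [y, x] r'
        (by simp) (by simp at hl ⊢; omega)
      rcases l with _ | ⟨d, l⟩
      · simp at hk
      · exact hpos e d l x y r hl
    have h3 := (tng_over (G := G) (op x) s).whisker [y, x] r'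
    refine ⟨true, Closed.of_eq (h1.comp h2 (by simpa using h3)) ?_⟩
    have e1 := br_congr (hP.exchange_word (v := [(0, cross true x y)]) (s := [x, y])
      (s' := [y, x]) (by simp [Tng, run, Jaeger.step]) (tng_over (op x) s)) [] r'
      [(0, cup x), (1, cross true (op x) y)] []
      (s' := y :: (s ++ r')) (t' := y :: x :: (s ++ (op x :: r')))
      (by simp [Tng, run, Jaeger.step]) (by simpa using Tng.nil _)
    have e2 := br_congr (hP.slide_cup true x y) [] (s ++ r') []
      ((0, cross true x y) :: shift 2 (overpass G (op x) s))
      (s' := y :: (s ++ r')) (t' := y :: x :: (s ++ (op x :: r')))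
      (by simpa using Tng.nil _) (by
        have := Tng.cons (i := 0) (g := (cross true x y : G)) [] (op x :: (s ++ r')) rfl
          (by simpa using h3)
        simpa using this)
    have e3 := br_congr (hP.r2 false y x) [] (op x :: (s ++ r')) [(1, cup x)]
      (shift 2 (overpass G (op x) s))
      (s' := y :: (s ++ r')) (t' := y :: x :: (s ++ (op x :: r')))
      (by simp [Tng, run, Jaeger.step]) (by simpa using h3)
    simp [arc, overpass, shift_cons, shift_nil, shift_append, shift_shift, shift_zero] at e1 e2 e3 ⊢
    rw [← e1, e2, e3]

/-- The induction has step two because moving a piece below an arc removes the two legs. -/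
theorem closed_all (hP : Reducible R P) (n : ℕ) :
    (∀ l x r, (l ++ (x :: op x :: r)).length ≤ n →
      Closed R P (l ++ (x :: op x :: r)) (l ++ r) [(l.length, cap x)]) ∧
    (∀ e l x y r, (l ++ (x :: y :: r)).length ≤ n →
      Closed R P (l ++ (x :: y :: r)) (l ++ (y :: x :: r)) [(l.length, cross e x y)]) := by
  induction n using Nat.twoStepInduction with
  | zero => exact ⟨fun l x r h => by simp at h, fun e l x y r h => by simp at h⟩
  | one => exact ⟨fun l x r h => by simp at h; omega, fun e l x y r h => by simp at h; omega⟩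
  | more n ih _ =>
    have h := hP.closed_cap ih.1 ih.2
    exact ⟨h, hP.closed_cross h ih.2⟩

theorem closed_word (hP : Reducible R P) (w : Word G) : ∀ s t, Tng w s t → Closed R P s t w := by
  induction w with
  | nil => intro s t h; rw [tng_nil_iff] at h; subst h; exact Closed.nil s
  | cons p w ih =>
    intro s t h
    obtain ⟨i, g⟩ := p
    obtain ⟨l, r, rfl, rfl, h1⟩ := tng_cons_iff.1 h
    refine Closed.comp (v := [(l.length, g)]) ?_ (ih _ _ h1) h1
    rcases hP.exhaust g with ⟨x, rfl⟩ | ⟨x, rfl⟩ | ⟨e, x, y, rfl⟩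
    · simpa using hP.closed_cup x _ l r le_rfl
    · simpa using (hP.closed_all _).1 l x r le_rfl
    · simpa using (hP.closed_all _).2 e l x y r le_rfl

/-- The value on a closed diagram is a multiple of the value on the empty diagram. -/
theorem exists_smul (hP : Reducible R P) {w : Word G} (hw : Tng w [] []) :
    ∃ c : R, P w = c • P [] := by
  have h := hP.closed_word w [] [] hw [] Std.nil
  have h1 : ∀ v : Word G, Std ([] : List L) v → v = [] := by
    intro v hv
    generalize hs : ([] : List L) = s at hv
    cases hv with
    | nil => rfl
    | arc => simp at hs
  have h2 : {f | ∃ v : Word G, Std ([] : List L) v ∧ f = br P [] [] v} = {br P [] [] []} := by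
    ext f
    constructor
    · rintro ⟨v, hv, rfl⟩
      rw [h1 v hv]; rfl
    · rintro rfl
      exact ⟨[], Std.nil, rfl⟩
  rw [stdSpan, h2, Submodule.mem_span_singleton] at h
  obtain ⟨c, hc⟩ := h
  have hf : Ctx.Fits (G := G) ([], [], [], []) ([] : List L) [] := ⟨Tng.nil _, Tng.nil _⟩
  have := congrFun hc ([], [], [], [])
  refine ⟨c, ?_⟩
  simpa [br_of_fits P _ hf, Ctx.fill, shift_nil, shift_zero] using this.symm

end Reducible

end Jaeger

/-! ### All versions of the third Reidemeister move from a single one. -/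

namespace Jaeger
open PieceSys Reversal CrossSys

variable {G L : Type} {M R : Type*} [CrossSys G L] [DecidableEq L] [AddCommGroup M]
  [CommRing R] [Module R M] {P : Word G → M}

/-- The third Reidemeister move for three strands with given crossings. -/
def ThirdMove (P : Word G → M) (e₁ e₂ e₃ : Bool) (x y z : L) : Prop :=
  br P [x, y, z] [z, y, x] [(0, cross e₁ x y), (1, cross e₂ x z), (0, cross e₃ y z)] =
    br P [x, y, z] [z, y, x] [(1, cross e₃ y z), (0, cross e₂ x z), (1, cross e₁ x y)]

namespace ThirdMove

/-- Conjugation by the inverse of the crossing of the first two strands: that crossing is cancelled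
on one side and appears reversed on the other. -/
theorem swap_left (hP : Isotopy P) {e₁ e₂ e₃ : Bool} {x y z : L} (h : ThirdMove P e₁ e₂ e₃ x y z) :
    ThirdMove P (!e₁) e₃ e₂ y x z := by
  have h1 := br_append h (s' := [y, x, z]) (t' := [z, x, y]) [(0, cross (!e₁) y x)]
    [(1, cross (!e₁) y x)] (by simp [Tng, run, step]) (by simp [Tng, run, step])
  have h2 := br_congr (hP.r2 (!e₁) y x) [] [z] []
    [(1, cross e₂ x z), (0, cross e₃ y z), (1, cross (!e₁) y x)]
    (s' := [y, x, z]) (t' := [z, x, y]) (by simp [Tng, run]) (by simp [Tng, run, step])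
  have h3 := br_congr (hP.r2 e₁ x y) [z] []
    [(0, cross (!e₁) y x), (1, cross e₃ y z), (0, cross e₂ x z)] []
    (s' := [y, x, z]) (t' := [z, x, y]) (by simp [Tng, run, step]) (by simp [Tng, run])
  simp [shift] at h1 h2 h3
  rw [ThirdMove, ← h3, ← h1, h2]

theorem swap_right (hP : Isotopy P) {e₁ e₂ e₃ : Bool} {x y z : L}
    (h : ThirdMove P e₁ e₂ e₃ x y z) : ThirdMove P e₂ e₁ (!e₃) x z y := by
  have h1 := br_append h (s' := [x, z, y]) (t' := [y, z, x]) [(1, cross (!e₃) z y)]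
    [(0, cross (!e₃) z y)] (by simp [Tng, run, step]) (by simp [Tng, run, step])
  have h2 := br_congr (hP.r2 (!e₃) z y) [x] [] []
    [(0, cross e₂ x z), (1, cross e₁ x y), (0, cross (!e₃) z y)]
    (s' := [x, z, y]) (t' := [y, z, x]) (by simp [Tng, run]) (by simp [Tng, run, step])
  have h3 := br_congr (hP.r2 e₃ y z) [] [x]
    [(1, cross (!e₃) z y), (0, cross e₁ x y), (1, cross e₂ x z)] []
    (s' := [x, z, y]) (t' := [y, z, x]) (by simp [Tng, run, step]) (by simp [Tng, run])
  simp [shift] at h1 h2 h3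
  rw [ThirdMove, ← h2, ← h1, h3]

/-- The strand `x`, which crosses two strands and then turns down, may turn down first and cross
them on the other side. Each slide reverses a crossing. -/
theorem sweep (hP : Isotopy P) (e₁ e₂ : Bool) (x y z : L) :
    br P [x, y, z, op x] [y, z] [(0, cross e₁ x y), (1, cross e₂ x z), (2, cap x)] =
      br P [x, y, z, op x] [y, z]
        [(2, cross (!e₂) z (op x)), (1, cross (!e₁) y (op x)), (0, cap x)] := by
  have h1 := br_congr (hP.slide_cap (!e₂) x z) [y] [] [(0, cross e₁ x y)] []
    (s' := [x, y, z, op x]) (t' := [y, z]) (by simp [Tng, run, step]) (by simp [Tng, run])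
  have h2 := br_congr (hP.exchange (cross e₁ x y) (cross (!e₂) z (op x)) []) [] [] []
    [(1, cap x)] (s' := [x, y, z, op x]) (t' := [y, z]) (by simp [Tng, run])
    (by simp [Tng, run, step])
  have h3 := br_congr (hP.slide_cap (!e₁) x y) [] [z] [(2, cross (!e₂) z (op x))] []
    (s' := [x, y, z, op x]) (t' := [y, z]) (by simp [Tng, run, step]) (by simp [Tng, run])
  simp [shift] at h1 h2 h3
  rw [← h1, h2, ← h3]

/-- The strand `x` is bent around the other two by a minimum on the left and a maximum on the right.
After sweeping it across and straightening a zigzag, it runs backwards as the last of the three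
strands. -/
theorem rotate (hP : Isotopy P) {e₁ e₂ e₃ : Bool} {x y z : L} (h : ThirdMove P e₁ e₂ e₃ x y z) :
    ThirdMove P e₃ (!e₁) (!e₂) y z (op x) := by
  have h0 := br_congr h [op x] [op x] [(0, cup (op x))] [(3, cap x)] (s' := [y, z, op x])
    (t' := [op x, z, y]) (by simp [Tng, run, step]) (by simp [Tng, run, step])
  -- the left-hand side
  have l1 := br_congr (hP.exchange (cross e₃ y z) (cap x) []) [op x] []
    [(0, cup (op x)), (1, cross e₁ x y), (2, cross e₂ x z)] [] (s' := [y, z, op x])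
    (t' := [op x, z, y]) (by simp [Tng, run, step]) (by simp [Tng, run])
  have l2 := br_congr (sweep hP e₁ e₂ x y z) [op x] [] [(0, cup (op x))] [(1, cross e₃ y z)]
    (s' := [y, z, op x]) (t' := [op x, z, y]) (by simp [Tng, run, step])
    (by simp [Tng, run, step])
  have l3 := hP.exchange_word (v := [(0, cup (op x))])
    (w := [(1, cross (!e₂) z (op x)), (0, cross (!e₁) y (op x))]) (s := []) (s' := [op x, x])
    (t := [y, z, op x]) (t' := [op x, y, z]) (by simp [Tng, run, step]) (by simp [Tng, run, step])
  have l4 := br_post l3 (t' := [op x, z, y]) [(1, cap x), (1, cross e₃ y z)]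
    (by simp [Tng, run, step])
  have l5 := br_congr (hP.zigzag_right (op x)) [] [y, z]
    [(1, cross (!e₂) z (op x)), (0, cross (!e₁) y (op x))] [(1, cross e₃ y z)]
    (s' := [y, z, op x]) (t' := [op x, z, y]) (by simp [Tng, run, step]) (by simp [Tng, run, step])
  -- the right-hand side
  have r2 := br_congr (sweep hP e₂ e₁ x z y) [op x] [] [(0, cup (op x)), (2, cross e₃ y z)] []
    (s' := [y, z, op x]) (t' := [op x, z, y]) (by simp [Tng, run, step])
    (by simp [Tng, run])
  have r3 := hP.exchange_word (v := [(0, cup (op x))])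
    (w := [(0, cross e₃ y z), (1, cross (!e₁) y (op x)), (0, cross (!e₂) z (op x))]) (s := [])
    (s' := [op x, x]) (t := [y, z, op x]) (t' := [op x, z, y]) (by simp [Tng, run, step])
    (by simp [Tng, run, step])
  have r4 := br_post r3 (t' := [op x, z, y]) [(1, cap x)] (by simp [Tng, run, step])
  have r5 := br_congr (hP.zigzag_right (op x)) [] [z, y]
    [(0, cross e₃ y z), (1, cross (!e₁) y (op x)), (0, cross (!e₂) z (op x))] []
    (s' := [y, z, op x]) (t' := [op x, z, y]) (by simp [Tng, run, step]) (by simp [Tng, run])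
  simp [shift] at h0 l1 l2 l4 l5 r2 r4 r5
  rw [ThirdMove, ← r5, ← r4, ← r2, ← h0, l1, l2, l4, l5]

/-- All third Reidemeister moves for strands with given labels. -/
def All (P : Word G → M) (x y z : L) : Prop :=
  ∀ e₁ e₂ e₃, (e₁ = e₃ → e₂ = e₁) → ThirdMove P e₁ e₂ e₃ x y z

/-- The condition in `All` excludes the two patterns in which the three strands lie cyclically above
one another. It is preserved by both swaps and by the rotation, which `decide` checks. -/
theorem All.swap_left (hP : Isotopy P) {x y z : L} (h : All P x y z) : All P y x z :=
  fun e₁ e₂ e₃ he => by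
    have := ThirdMove.swap_left hP (h (!e₁) e₃ e₂ (by revert he; revert e₁ e₂ e₃; decide))
    rwa [Bool.not_not] at this

theorem All.swap_right (hP : Isotopy P) {x y z : L} (h : All P x y z) : All P x z y :=
  fun e₁ e₂ e₃ he => by
    have := ThirdMove.swap_right hP (h e₂ e₁ (!e₃) (by revert he; revert e₁ e₂ e₃; decide))
    rwa [Bool.not_not] at this

theorem All.rotate (hP : Isotopy P) {x y z : L} (h : All P x y z) : All P y z (op x) :=
  fun e₁ e₂ e₃ he => by
    have := ThirdMove.rotate hP (h (!e₂) (!e₃) e₁ (by revert he; revert e₁ e₂ e₃; decide))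
    rwa [Bool.not_not, Bool.not_not] at this

/-- The six acyclic patterns correspond to the orders of the heights of the strands, and the swaps
connect them. -/
theorem all_of_same (hP : Isotopy P) {x : L} (h : ThirdMove P true true true x x x) :
    All P x x x := by
  have h1 := h.swap_left hP
  have h2 := h.swap_right hP
  have h3 := h1.swap_right hP
  have h4 := h2.swap_left hP
  have h5 := h3.swap_left hP
  intro e₁ e₂ e₃ he
  cases e₁ <;> cases e₂ <;> cases e₃ <;> first | assumption | simp at he

end ThirdMove

/-! ### Oriented and unoriented diagrams -/

instance : CrossSys OPiece Dir where
  bot := OPiece.bot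
  top := OPiece.top
  op := Dir.op
  op_op x := by cases x <;> rfl
  cup := .cup
  cap := .cap
  cross := .cross
  bot_cup _ := rfl
  top_cup _ := rfl
  bot_cap _ := rfl
  top_cap _ := rfl
  bot_cross _ _ _ := rfl
  top_cross _ _ _ := rfl

instance : CrossSys Piece Unit where
  bot g := List.replicate g.bot ()
  top g := List.replicate g.top ()
  op := id
  op_op _ := rfl
  cup _ := .cup
  cap _ := .cap
  cross e _ _ := .cross e
  bot_cup _ := rfl
  top_cup _ := rfl
  bot_cap _ := rfl
  top_cap _ := rfl
  bot_cross _ _ _ := rfl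
  top_cross _ _ _ := rfl

theorem opiece_bot (g : OPiece) : bot g = g.bot := rfl

theorem opiece_top (g : OPiece) : top g = g.top := rfl

theorem replicate_bot (l r : ℕ) (g : Piece) : List.replicate (l + g.bot + r) () =
    List.replicate l () ++ (bot g ++ List.replicate r ()) := by
  rw [Nat.add_assoc, List.replicate_add, List.replicate_add]; rfl

theorem replicate_top (l r : ℕ) (g : Piece) : List.replicate (l + g.top + r) () =
    List.replicate l () ++ (top g ++ List.replicate r ()) := by
  rw [Nat.add_assoc, List.replicate_add, List.replicate_add]; rfl

theorem isOTangle_iff {w : Word OPiece} {s t : List Dir} : IsOTangle w s t ↔ Tng w s t := by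
  constructor
  · intro h
    induction h with
    | nil => exact Tng.nil _
    | cons l r t g w _ ih =>
      have := Tng.cons (g := g) l r rfl (by simpa [opiece_top] using ih)
      simpa [opiece_bot] using this
  · intro h
    induction w generalizing s with
    | nil => rw [tng_nil_iff] at h; subst h; exact IsOTangle.nil _
    | cons p w ih =>
      obtain ⟨i, g⟩ := p
      obtain ⟨l, r, rfl, rfl, h1⟩ := tng_cons_iff.1 h
      have := IsOTangle.cons l r t g w (by simpa [opiece_top] using ih h1)
      simpa [opiece_bot] using this

theorem isTangle_iff {w : Word Piece} {m n : ℕ} :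
    IsTangle w m n ↔ Tng w (List.replicate m ()) (List.replicate n ()) := by
  constructor
  · intro h
    induction h with
    | nil => exact Tng.nil _
    | cons l r n g w _ ih =>
      have := Tng.cons (i := l) (g := g) (List.replicate l ()) (List.replicate r ()) (by simp)
        (by rwa [replicate_top] at ih)
      rwa [replicate_bot]
  · intro h
    induction w generalizing m with
    | nil =>
      rw [tng_nil_iff] at h
      obtain rfl : m = n := by simpa using congrArg List.length h
      exact IsTangle.nil _
    | cons p w ih =>
      obtain ⟨i, g⟩ := p
      obtain ⟨l, r, rfl, hs, h1⟩ := tng_cons_iff.1 h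
      have h2 : ∀ s : List Unit, s = List.replicate s.length () := fun s =>
        List.eq_replicate_iff.2 ⟨rfl, fun _ _ => rfl⟩
      have h3 := IsTangle.cons l.length r.length n g w (by
        refine ih ?_
        rwa [replicate_top, ← h2, ← h2])
      have : m = l.length + g.bot + r.length := by
        have := congrArg List.length hs
        simp only [List.length_replicate, List.length_append] at this
        rw [this, Nat.add_assoc]
        simp [bot]
      rwa [this]

theorem opiece_exhaust (g : OPiece) : (∃ x, g = cup x) ∨ (∃ x, g = cap x) ∨
    ∃ e x y, g = cross e x y := by
  cases g with
  | cup x => exact Or.inl ⟨x, rfl⟩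
  | cap x => exact Or.inr (Or.inl ⟨x, rfl⟩)
  | cross e x y => exact Or.inr (Or.inr ⟨e, x, y, rfl⟩)

theorem piece_exhaust (g : Piece) : (∃ x, g = cup x) ∨ (∃ x, g = cap x) ∨
    ∃ e x y, g = cross e x y := by
  cases g with
  | cup => exact Or.inl ⟨(), rfl⟩
  | cap => exact Or.inr (Or.inl ⟨(), rfl⟩)
  | cross e => exact Or.inr (Or.inr ⟨e, (), (), rfl⟩)

/-- Each rotation reverses one strand, so three rotations reach every number of downward strands;
the swaps then permute the strands. -/
theorem ThirdMove.all_dir {P : Word OPiece → M} (hP : Isotopy P)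
    (h : ThirdMove P true true true Dir.up Dir.up Dir.up) (x y z : Dir) : All P x y z := by
  have h0 := all_of_same hP h
  have h1 : All P .up .up .down := h0.rotate hP
  have h2 : All P .up .down .down := h1.rotate hP
  have h3 : All P .down .down .down := h2.rotate hP
  cases x <;> cases y <;> cases z
  · exact h0
  · exact h1
  · exact h1.swap_right hP
  · exact h2
  · exact (h1.swap_right hP).swap_left hP
  · exact h2.swap_left hP
  · exact (h2.swap_left hP).swap_right hP
  · exact h3

end Jaeger

namespace Jaeger
open PieceSys Reversal CrossSys

/-! ### Recognizing the surroundings of a tangle -/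

section surroundings
variable {G L : Type} [PieceSys G L] [DecidableEq L]

theorem tng_shift_iff {l s t : List L} {w : Word G} :
    Tng (shift l.length w) (l ++ s) t ↔ ∃ t', t = l ++ t' ∧ Tng w s t' := by
  constructor
  · intro h
    induction w generalizing s with
    | nil => exact ⟨s, by rwa [shift_nil, tng_nil_iff, eq_comm] at h, Tng.nil s⟩
    | cons p w ih =>
      obtain ⟨i, g⟩ := p
      obtain ⟨l', r, hl, hs, h1⟩ := tng_cons_iff.1 h
      obtain ⟨a, rfl, rfl⟩ : ∃ a, l' = l ++ a ∧ s = a ++ (bot g ++ r) := by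
        rcases List.append_eq_append_iff.1 hs with ⟨a, rfl, rfl⟩ | ⟨a, rfl, h2⟩
        · exact ⟨a, rfl, rfl⟩
        · obtain rfl : a = [] := by
            rw [← List.length_eq_zero_iff]; simp at hl; omega
          exact ⟨[], by simp, by simpa using h2.symm⟩
      obtain ⟨t', rfl, h2⟩ := ih (by rwa [List.append_assoc] at h1)
      exact ⟨t', rfl, Tng.cons a r (by simpa using hl) h2⟩
  · rintro ⟨t', rfl, h⟩
    simpa using h.whisker l []

theorem tng_around {x u v : Word G} (hx : x ≠ []) {k : ℕ} {s₀ t₀ : List L}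
    (h : Tng (u ++ shift k x ++ v) s₀ t₀) :
    ∃ l s t, l.length = k ∧ Tng u s₀ (l ++ s) ∧ Tng x s t ∧ Tng v (l ++ t) t₀ := by
  obtain ⟨t', h1, hv⟩ := tng_append_iff.1 h
  obtain ⟨s', hu, hx'⟩ := tng_append_iff.1 h1
  obtain ⟨l, s'', hl, rfl⟩ : ∃ l s'', l.length = k ∧ s' = l ++ s'' := by
    rcases x with _ | ⟨⟨i, g⟩, x⟩
    · exact absurd rfl hx
    · obtain ⟨a, b, ha, rfl, -⟩ := tng_cons_iff.1 hx'
      refine ⟨a.take k, a.drop k ++ (bot g ++ b), ?_, ?_⟩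
      · simp only [List.length_take, ha]; omega
      · conv_lhs => rw [← List.take_append_drop k a, List.append_assoc]
  subst hl
  obtain ⟨t'', rfl, h2⟩ := tng_shift_iff.1 hx'
  exact ⟨l, s'', t'', rfl, hu, h2, hv⟩

/-- The word `x` is a tangle from `s` to `t`, and it needs all the strands in `s`. -/
def Occupies (x : Word G) (s t : List L) : Prop :=
  Tng x s t ∧ x ≠ [] ∧ ∀ s' t', Tng x s' t' → s <+: s'

/-- The axioms of the polynomials speak of concatenated words without labels. As `x` requires
exactly the strands `s`, the typing of the whole word determines the strands on both sides of `x`,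
so the word is a filled context. -/
theorem Occupies.ctx {x : Word G} {s t : List L} (hx : Occupies x s t) {u v : Word G}
    {k : ℕ} (h : Tng (u ++ shift k x ++ v) [] []) :
    ∃ c : Ctx G L, c.Fits s t ∧ ∀ y, c.fill y = u ++ shift k y ++ v := by
  obtain ⟨l, s', t', rfl, hu, h2, hv⟩ := tng_around hx.2.1 h
  obtain ⟨r, rfl⟩ := hx.2.2 _ _ h2
  obtain rfl := h2.unique (hx.1.left r)
  exact ⟨(l, r, u, v), ⟨hu, hv⟩, fun y => by simp [Ctx.fill]⟩

theorem apply_eq_of_br {M : Type*} [AddCommGroup M] {P : Word G → M} {x y : Word G}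
    {s t : List L} (hx : Occupies x s t) (hP : br P s t x = br P s t y) {u v : Word G} {k : ℕ}
    (h : Tng (u ++ shift k x ++ v) [] []) : P (u ++ shift k x ++ v) = P (u ++ shift k y ++ v) := by
  obtain ⟨c, hc, hf⟩ := hx.ctx h
  have := congrFun hP c
  rwa [br_of_fits P _ hc, br_of_fits P _ hc, hf, hf] at this

end surroundings

/-- The exchange move fixes only the number `m` of strands between the two pieces, not their labels.
These are read off here from the typing of the diagram, so that `Isotopy.exchange` applies. -/
theorem exchange_apply {M : Type*} {G L : Type} [CrossSys G L] [DecidableEq L] [AddCommGroup M]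
    {P : Word G → M} (hP : Isotopy P) (g h : G) (m : ℕ) {u v : Word G} {k : ℕ}
    (hw : Tng (u ++ shift k [(0, g), ((top g).length + m, h)] ++ v) [] []) :
    P (u ++ shift k [(0, g), ((top g).length + m, h)] ++ v) =
      P (u ++ shift k [((bot g).length + m, h), (0, g)] ++ v) := by
  obtain ⟨l, s, t, rfl, hu, h2, hv⟩ := tng_around (by simp) hw
  obtain ⟨l1, r1, h3, rfl, h4⟩ := tng_cons_iff.1 h2
  obtain rfl := List.length_eq_zero_iff.1 h3
  obtain ⟨l2, r2, h5, h6, h7⟩ := tng_cons_iff.1 h4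
  rw [List.nil_append] at h6
  obtain ⟨a, rfl, rfl⟩ : ∃ a, l2 = top g ++ a ∧ r1 = a ++ (bot h ++ r2) := by
    rcases List.append_eq_append_iff.1 h6 with ⟨a, h8, h9⟩ | ⟨a, h8, h9⟩
    · exact ⟨a, h8, h9⟩
    · obtain rfl : a = [] := by
        rw [← List.length_eq_zero_iff]
        have := congrArg List.length h8
        simp at this; omega
      exact ⟨[], by simpa using h8.symm, by simpa using h9.symm⟩
  obtain rfl : a.length = m := by simpa using h5
  rw [tng_nil_iff] at h7
  subst h7
  have h8 := congrFun (hP.exchange g h a) (l, r2, u, v)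
  have hf : Ctx.Fits (G := G) (l, r2, u, v) (bot g ++ (a ++ bot h)) (top g ++ (a ++ top h)) :=
    ⟨by simpa using hu, by simpa using hv⟩
  rw [br_of_fits P _ hf, br_of_fits P _ hf] at h8
  simpa [Ctx.fill] using h8

theorem dir_op_op (x : Dir) : x.op.op = x := by cases x <;> rfl

/-- Every move other than the exchange determines its bottom labels, so it occupies its strands and
can be handled by `apply_eq_of_br`. -/
theorem OMove.br_eq {M : Type*} [AddCommGroup M] {P : Word OPiece → M} (hP : Isotopy P)
    (r3 : ∀ e x y w, ThirdMove P e e e x y w)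
    (framed : ∀ e (s : Dir), br P [s] [s] [(1, .cup s), (0, .cross e s s), (1, .cap s)] =
      br P [s] [s] [(0, .cup s.op), (1, .cross e s s), (0, .cap s.op)])
    {x y : Word OPiece} (h : OMove x y) :
    (∃ g h m, x = [(0, g), (g.top.length + m, h)] ∧ y = [(g.bot.length + m, h), (0, g)]) ∨
      ∃ s t, Occupies x s t ∧ br P s t x = br P s t y := by
  cases h with
  | exchange g h m => exact Or.inl ⟨g, h, m, rfl, rfl⟩
  | zigzag_left s =>
    refine Or.inr ⟨[s], [s], ⟨by cases s <;> rfl, by simp, fun s' t' h => ?_⟩, hP.zigzag_left s⟩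
    rcases s' with _ | ⟨a, s'⟩ <;>
    simp [Tng, run, step, Option.bind_eq_some_iff, opiece_bot, opiece_top, OPiece.bot,
      OPiece.top, dir_op_op] at h ⊢
    simp [h]
  | zigzag_right s =>
    refine Or.inr ⟨[s], [s], ⟨by cases s <;> rfl, by simp, fun s' t' h => ?_⟩, hP.zigzag_right s⟩
    rcases s' with _ | ⟨a, s'⟩ <;>
    simp [Tng, run, step, Option.bind_eq_some_iff, opiece_bot, opiece_top, OPiece.bot,
      OPiece.top, dir_op_op] at h ⊢
    simp [h]
  | slide_cap e x y =>
    refine Or.inr ⟨[x, y, x.op], [y], ⟨by cases x <;> cases y <;> rfl, by simp, fun s' t' h => ?_⟩,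
      hP.slide_cap e x y⟩
    rcases s' with _ | ⟨a, _ | ⟨b, _ | ⟨c, s'⟩⟩⟩ <;>
    simp [Tng, run, step, Option.bind_eq_some_iff, opiece_bot, opiece_top, OPiece.bot,
      OPiece.top, dir_op_op] at h ⊢
    exact ⟨h.2.1, h.1.1, h.1.2⟩
  | slide_cup e x y =>
    refine Or.inr ⟨[y], [x, y, x.op], ⟨by cases x <;> cases y <;> rfl, by simp, fun s' t' h => ?_⟩,
      hP.slide_cup e x y⟩
    rcases s' with _ | ⟨a, s'⟩ <;>
    simp [Tng, run, step, Option.bind_eq_some_iff, opiece_bot, opiece_top, OPiece.bot,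
      OPiece.top, dir_op_op] at h ⊢
    simp [h]
  | reidemeister_two e x y =>
    refine Or.inr ⟨[x, y], [x, y], ⟨by cases x <;> cases y <;> rfl, by simp, fun s' t' h => ?_⟩,
      hP.r2 e x y⟩
    rcases s' with _ | ⟨a, _ | ⟨b, s'⟩⟩ <;>
    simp [Tng, run, step, Option.bind_eq_some_iff, opiece_bot, opiece_top, OPiece.bot,
      OPiece.top, dir_op_op] at h ⊢
    simp [h]
  | reidemeister_three e x y z =>
    refine Or.inr ⟨[x, y, z], [z, y, x], ⟨by cases x <;> cases y <;> cases z <;> rfl, by simp,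
      fun s' t' h => ?_⟩, r3 e x y z⟩
    rcases s' with _ | ⟨a, _ | ⟨b, _ | ⟨c, s'⟩⟩⟩ <;>
    simp [Tng, run, step, Option.bind_eq_some_iff, opiece_bot, opiece_top, OPiece.bot,
      OPiece.top, dir_op_op] at h ⊢
    simp [h]
  | framed_one e s =>
    refine Or.inr ⟨[s], [s], ⟨by cases s <;> rfl, by simp, fun s' t' h => ?_⟩, framed e s⟩
    rcases s' with _ | ⟨a, s'⟩ <;>
    simp [Tng, run, step, Option.bind_eq_some_iff, opiece_bot, opiece_top, OPiece.bot,
      OPiece.top, dir_op_op] at h ⊢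
    simp [h]

/-! ### The relations between oriented diagrams -/

variable {M R : Type*} [AddCommGroup M] [CommRing R] [Module R M]

/-- `P` satisfies the skein relations of the HOMFLY-PT polynomial with parameter `z`; a curl of a
minimum contributes the factor `κ`, a circle the factor `δ`. -/
structure OSkein (P : Word OPiece → M) (z : R) (κ : Bool → Dir → R) (δ : Dir → R) : Prop
    extends Isotopy P where
  r3 : ∀ e x y w, ThirdMove P e e e x y w
  skein : br P [.up, .up] [.up, .up] [(0, .cross true .up .up)] -
    br P [.up, .up] [.up, .up] [(0, .cross false .up .up)] =
      z • br P [.up, .up] [.up, .up] []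
  curl : ∀ e x, CupCurl P e x (κ e x)
  loop : ∀ x, br P [] [] [(0, .cup x), (0, .cap x)] = δ x • br P [] [] []

section skein
variable {P : Word OPiece → M} {z : R}

/-- The skein relation turned by a right angle: the two crossings change places and the vertical
smoothing becomes the horizontal one. Two further turns give the relations for the remaining
orientations. -/
theorem skein_down_up (hP : Isotopy P)
    (h : br P [.up, .up] [.up, .up] [(0, .cross true .up .up)] -
      br P [.up, .up] [.up, .up] [(0, .cross false .up .up)] =
        z • br P [.up, .up] [.up, .up] []) :
    br P [.down, .up] [.up, .down] [(0, .cross false .down .up)] -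
      br P [.down, .up] [.up, .down] [(0, .cross true .down .up)] =
        z • br P [.down, .up] [.up, .down] [(0, .cap .down), (0, .cup .up)] := by
  obtain ⟨Λ, h1, h2⟩ := hP.exists_rotate R Dir.down Dir.up
  have h3 := congrArg Λ h
  have h4 := h2 [] rfl
  have h5 := hP.exchange (.cap .down) (.cup .up) []
  have e1 := h1 true
  have e2 := h1 false
  change Λ (br P [.up, .up] [.up, .up] [(0, .cross true .up .up)]) =
    br P [.down, .up] [.up, .down] [(0, .cross false .down .up)] at e1
  change Λ (br P [.up, .up] [.up, .up] [(0, .cross false .up .up)]) =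
    br P [.down, .up] [.up, .down] [(0, .cross true .down .up)] at e2
  change Λ (br P [.up, .up] [.up, .up] []) =
    br P [.down, .up] [.up, .down] [(2, .cup .up), (0, .cap .down)] at h4
  change br P [.down, .up] [.up, .down] [(0, .cap .down), (0, .cup .up)] =
    br P [.down, .up] [.up, .down] [(2, .cup .up), (0, .cap .down)] at h5
  rw [map_sub, map_smul, e1, e2, h4, ← h5] at h3
  exact h3

theorem skein_down_down (hP : Isotopy P)
    (h : br P [.up, .up] [.up, .up] [(0, .cross true .up .up)] -
      br P [.up, .up] [.up, .up] [(0, .cross false .up .up)] =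
        z • br P [.up, .up] [.up, .up] []) :
    br P [.down, .down] [.down, .down] [(0, .cross true .down .down)] -
      br P [.down, .down] [.down, .down] [(0, .cross false .down .down)] =
        z • br P [.down, .down] [.down, .down] [] := by
  obtain ⟨Λ, h1, h2⟩ := hP.exists_rotate R Dir.down Dir.down
  have h3 := congrArg Λ (skein_down_up hP h)
  have h4 := h2 [(0, .cap .down), (0, .cup .up)] rfl
  have e1 := h1 false
  have e2 := h1 true
  change Λ (br P [.down, .up] [.up, .down] [(0, .cross false .down .up)]) =
    br P [.down, .down] [.down, .down] [(0, .cross true .down .down)] at e1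
  change Λ (br P [.down, .up] [.up, .down] [(0, .cross true .down .up)]) =
    br P [.down, .down] [.down, .down] [(0, .cross false .down .down)] at e2
  change Λ (br P [.down, .up] [.up, .down] [(0, .cap .down), (0, .cup .up)]) =
    br P [.down, .down] [.down, .down]
      [(2, .cup .up), (1, .cap .down), (1, .cup .up), (0, .cap .down)] at h4
  have h5 : br P [.down, .down] [.down, .down]
      [(2, .cup .up), (1, .cap .down), (1, .cup .up), (0, .cap .down)] =
      br P [.down, .down] [.down, .down] [(1, .cup .up), (0, .cap .down)] :=
    br_congr (hP.zigzag_left Dir.down) [.down] [] [] [(1, .cup .up), (0, .cap .down)] rfl rfl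
  have h6 : br P [.down, .down] [.down, .down] [(1, .cup .up), (0, .cap .down)] =
      br P [.down, .down] [.down, .down] [] :=
    br_congr (hP.zigzag_left Dir.down) [] [.down] [] [] rfl rfl
  rw [map_sub, map_smul, e1, e2, h4, h5, h6] at h3
  exact h3

theorem skein_up_down (hP : Isotopy P)
    (h : br P [.up, .up] [.up, .up] [(0, .cross true .up .up)] -
      br P [.up, .up] [.up, .up] [(0, .cross false .up .up)] =
        z • br P [.up, .up] [.up, .up] []) :
    br P [.up, .down] [.down, .up] [(0, .cross false .up .down)] -
      br P [.up, .down] [.down, .up] [(0, .cross true .up .down)] =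
        z • br P [.up, .down] [.down, .up] [(0, .cap .up), (0, .cup .down)] := by
  obtain ⟨Λ, h1, h2⟩ := hP.exists_rotate R Dir.up Dir.down
  have h3 := congrArg Λ (skein_down_down hP h)
  have h4 := h2 [] rfl
  have h5 := hP.exchange (.cap .up) (.cup .down) []
  have e1 := h1 true
  have e2 := h1 false
  change Λ (br P [.down, .down] [.down, .down] [(0, .cross true .down .down)]) =
    br P [.up, .down] [.down, .up] [(0, .cross false .up .down)] at e1
  change Λ (br P [.down, .down] [.down, .down] [(0, .cross false .down .down)]) =
    br P [.up, .down] [.down, .up] [(0, .cross true .up .down)] at e2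
  change Λ (br P [.down, .down] [.down, .down] []) =
    br P [.up, .down] [.down, .up] [(2, .cup .down), (0, .cap .up)] at h4
  change br P [.up, .down] [.down, .up] [(0, .cap .up), (0, .cup .down)] =
    br P [.up, .down] [.down, .up] [(2, .cup .down), (0, .cap .up)] at h5
  rw [map_sub, map_smul, e1, e2, h4, ← h5] at h3
  exact h3

end skein

theorem OSkein.reducible {P : Word OPiece → M} {z : R} {κ : Bool → Dir → R} {δ : Dir → R}
    (hP : OSkein P z κ δ) : Reducible R P where
  toIsotopy := hP.toIsotopy
  exhaust := opiece_exhaust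
  r3 := hP.r3 true
  curl e x := ⟨_, hP.curl e x⟩
  loop x := ⟨_, hP.loop x⟩
  switch x y := by
    cases x <;> cases y
    · exact ⟨z, 0, by simp, by simp, by rw [zero_smul, add_zero]; exact hP.skein⟩
    · refine ⟨0, -z, by simp, by simp [op, Dir.op], ?_⟩
      rw [zero_smul, zero_add, neg_smul, ← neg_sub]
      exact congrArg _ (skein_up_down hP.toIsotopy hP.skein)
    · refine ⟨0, -z, by simp, by simp [op, Dir.op], ?_⟩
      rw [zero_smul, zero_add, neg_smul, ← neg_sub]
      exact congrArg _ (skein_down_up hP.toIsotopy hP.skein)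
    · exact ⟨z, 0, by simp, by simp, by
        rw [zero_smul, add_zero]; exact skein_down_down hP.toIsotopy hP.skein⟩

end Jaeger

/-! ### The HOMFLY-PT polynomial as a function on words. -/

namespace Jaeger
open PieceSys Reversal CrossSys

theorem Ctx.Fits.tng {G L : Type} [PieceSys G L] [DecidableEq L] {c : Ctx G L} {s t : List L}
    (hc : c.Fits s t) {w : Word G} (hw : Tng w s t) : Tng (c.fill w) [] [] :=
  hc.1.append ((hw.whisker c.1 c.2.1).append hc.2)

open Classical in
/-- A function on oriented diagrams as a function on words. -/
noncomputable def oval {M : Type*} [Zero M] (P : ODiagram → M) (w : Word OPiece) : M :=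
  if h : IsOTangle w [] [] then P ⟨w, h⟩ else 0

theorem oval_eq {M : Type*} [Zero M] (P : ODiagram → M) {w : Word OPiece}
    (h : IsOTangle w [] []) : oval P w = P ⟨w, h⟩ := dif_pos h

variable {K : Type*} [Field K] {a q : K}

/-- Invariance is assumed for closed diagrams in all surroundings, which is an equality of brackets;
where the tangle does not fit, both brackets are `0`. -/
theorem IsHomfly.br_eq {P : ODiagram → K} (h : IsHomfly a q P) {x y : Word OPiece}
    (hm : OMove x y) {s t : List Dir} (hx : Tng x s t) (hy : Tng y s t) :
    br (oval P) s t x = br (oval P) s t y := by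
  funext c
  by_cases hc : c.Fits s t
  · rw [br_of_fits _ _ hc, br_of_fits _ _ hc, oval_eq P (isOTangle_iff.2 (hc.tng hx)),
      oval_eq P (isOTangle_iff.2 (hc.tng hy))]
    exact h.invariant x y c.2.2.1 c.2.2.2 c.1.length _ _ hm (by simp [Ctx.fill])
      (by simp [Ctx.fill])
  · rw [br_of_not_fits _ _ hc, br_of_not_fits _ _ hc]

theorem IsHomfly.isotopy {P : ODiagram → K} (h : IsHomfly a q P) : Isotopy (oval P) where
  exchange g g' m := by
    have h1 := h.br_eq (.exchange g g' m.length) (s := bot g ++ (m ++ bot g'))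
      (t := top g ++ (m ++ top g'))
    refine h1 ?_ ?_
    · have h2 := (Tng.single [] (m ++ bot g') g).append (by
        simpa using Tng.single (top g ++ m) [] g')
      simpa [opiece_top] using h2
    · have h2 := (Tng.single (bot g ++ m) [] g').append (by
        simpa using Tng.single [] (m ++ top g') g)
      simpa [opiece_bot] using h2
  zigzag_left s := h.br_eq (.zigzag_left s) (by cases s <;> rfl) (by cases s <;> rfl)
  zigzag_right s := h.br_eq (.zigzag_right s) (by cases s <;> rfl) (by cases s <;> rfl)
  slide_cap e x y := h.br_eq (.slide_cap e x y) (by cases x <;> cases y <;> rfl)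
    (by cases x <;> cases y <;> rfl)
  slide_cup e x y := h.br_eq (.slide_cup e x y) (by cases x <;> cases y <;> rfl)
    (by cases x <;> cases y <;> rfl)
  r2 e x y := h.br_eq (.reidemeister_two e x y) (by cases x <;> cases y <;> rfl)
    (by cases x <;> cases y <;> rfl)

theorem smul_eq_div_smul {V : Type*} [AddCommGroup V] [Module K V] {z c : K} (hz : z ≠ 0)
    {x y : V} (h : z • x = c • y) : x = (c / z) • y := by
  rw [div_eq_inv_mul, mul_smul, ← h, smul_smul, inv_mul_cancel₀ hz, one_smul]

theorem IsHomfly.skein_br {P : ODiagram → K} (h : IsHomfly a q P) :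
    br (oval P) [.up, .up] [.up, .up] [(0, .cross true .up .up)] -
      br (oval P) [.up, .up] [.up, .up] [(0, .cross false .up .up)] =
        (q - q⁻¹) • br (oval P) [.up, .up] [.up, .up] [] := by
  funext c
  by_cases hc : c.Fits [.up, .up] [.up, .up]
  · rw [Pi.sub_apply, Pi.smul_apply, br_of_fits _ _ hc, br_of_fits _ _ hc, br_of_fits _ _ hc,
      oval_eq P (isOTangle_iff.2 (hc.tng (w := [(0, .cross true .up .up)]) rfl)),
      oval_eq P (isOTangle_iff.2 (hc.tng (w := [(0, .cross false .up .up)]) rfl)),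
      oval_eq P (isOTangle_iff.2 (hc.tng (w := []) rfl))]
    exact h.skein c.2.2.1 c.2.2.2 c.1.length _ _ _ (by simp [Ctx.fill]) (by simp [Ctx.fill])
      (by simp [Ctx.fill, shift_nil])
  · rw [Pi.sub_apply, Pi.smul_apply, br_of_not_fits _ _ hc, br_of_not_fits _ _ hc,
      br_of_not_fits _ _ hc]
    simp

theorem IsHomfly.curl_br {P : ODiagram → K} (h : IsHomfly a q P) (e : Bool) (s : Dir) :
    br (oval P) [s] [s] [(1, .cup s), (0, .cross e s s), (1, .cap s)] =
      (if e then a else a⁻¹) • br (oval P) [s] [s] [] := by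
  cases e
  · rw [h.br_eq (.framed_one false s) (by cases s <;> rfl) (by cases s <;> rfl)]
    funext c
    by_cases hc : c.Fits [s] [s]
    · rw [Pi.smul_apply, br_of_fits _ _ hc, br_of_fits _ _ hc,
        oval_eq P (isOTangle_iff.2 (hc.tng (by cases s <;> rfl))),
        oval_eq P (isOTangle_iff.2 (hc.tng (by cases s <;> rfl)))]
      exact h.curl_neg c.2.2.1 c.2.2.2 c.1.length s _ _ (by simp [Ctx.fill])
        (by simp [Ctx.fill, shift_nil])
    · rw [Pi.smul_apply, br_of_not_fits _ _ hc, br_of_not_fits _ _ hc, smul_zero]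
  · funext c
    by_cases hc : c.Fits [s] [s]
    · rw [Pi.smul_apply, br_of_fits _ _ hc, br_of_fits _ _ hc,
        oval_eq P (isOTangle_iff.2 (hc.tng (by cases s <;> rfl))),
        oval_eq P (isOTangle_iff.2 (hc.tng (by cases s <;> rfl)))]
      exact h.curl_pos c.2.2.1 c.2.2.2 c.1.length s _ _ (by simp [Ctx.fill])
        (by simp [Ctx.fill, shift_nil])
    · rw [Pi.smul_apply, br_of_not_fits _ _ hc, br_of_not_fits _ _ hc, smul_zero]

/-- The values of curls of minima in terms of those of curls of strands. -/
def curlFactor (a : K) (e : Bool) (_ : Dir) : K := if e then a⁻¹ else a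

theorem skein_same {M R : Type*} [AddCommGroup M] [CommRing R] [Module R M]
    {P : Word OPiece → M} {z : R} (hP : Isotopy P)
    (h : br P [.up, .up] [.up, .up] [(0, .cross true .up .up)] -
      br P [.up, .up] [.up, .up] [(0, .cross false .up .up)] =
        z • br P [.up, .up] [.up, .up] []) (s : Dir) :
    br P [s, s] [s, s] [(0, .cross true s s)] - br P [s, s] [s, s] [(0, .cross false s s)] =
      z • br P [s, s] [s, s] [] := by
  cases s
  · exact h
  · exact skein_down_down hP h

/-- The axiom `loop` gives the value of an isolated circle only. Circles in other diagrams are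
removed by means of the skein and curl relations. -/
theorem IsHomfly.oskein {P : ODiagram → K} (h : IsHomfly a q P) (hz : q - q⁻¹ ≠ 0) :
    OSkein (oval P) (q - q⁻¹) (curlFactor a) (fun _ => (a - a⁻¹) / (q - q⁻¹)) where
  toIsotopy := h.isotopy
  r3 e x y w := h.br_eq (.reidemeister_three e x y w) (by cases x <;> cases y <;> cases w <;> rfl)
    (by cases x <;> cases y <;> cases w <;> rfl)
  skein := h.skein_br
  curl e x := by
    have := h.isotopy.cupCurl_of_curl_right (h.curl_br (!e) x)
    cases e <;> simpa [curlFactor] using this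
  loop d := by
    refine h.isotopy.loop_of opiece_exhaust (fun x => ?_) ?_
    · refine smul_eq_div_smul hz ?_
      have h1 := skein_same h.isotopy h.skein_br x
      -- Closing one of two parallel strands turns the skein relation into `a - a⁻¹ = z * (circle)`.
      -- A circle of direction `x` arises by closing the right strand, one of the opposite direction
      -- by closing the left strand.
      by_cases hx : x = d
      · subst hx
        have h2 := congrArg (ext K [x] [x] [] [x.op] [(1, .cup x)] [(1, .cap x)]) h1
        have hu : Tng [(1, OPiece.cup x)] [x] ([] ++ ([x, x] ++ [x.op])) := by cases x <;> rfl
        have hv : Tng [(1, OPiece.cap x)] ([] ++ ([x, x] ++ [x.op])) [x] := by cases x <;> rfl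
        rw [map_sub, map_smul, ext_br _ hu hv, ext_br _ hu hv, ext_br _ hu hv] at h2
        have h3 := h.curl_br true x
        have h4 := h.curl_br false x
        simp only [if_true, Bool.false_eq_true, if_false] at h3 h4
        refine h2.symm.trans ?_
        rw [sub_smul, ← h3, ← h4]
        rfl
      · obtain rfl : d = x.op := by revert hx; cases x <;> cases d <;> simp [Dir.op]
        rw [show br (oval P) [x] [x] [(1, cup x.op), (1, cap x.op)] = _ from
          h.isotopy.loop_right x x.op]
        have h2 := congrArg (ext K [x] [x] [x.op] [] [(0, .cup x.op)] [(0, .cap x.op)]) h1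
        have hu : Tng [(0, OPiece.cup x.op)] [x] ([x.op] ++ ([x, x] ++ [])) := by
          cases x <;> rfl
        have hv : Tng [(0, OPiece.cap x.op)] ([x.op] ++ ([x, x] ++ [])) [x] := by
          cases x <;> rfl
        rw [map_sub, map_smul, ext_br _ hu hv, ext_br _ hu hv, ext_br _ hu hv] at h2
        have h3 := h.curl_br true x
        have h4 := h.curl_br false x
        rw [h.br_eq (.framed_one _ x) (by cases x <;> rfl) (by cases x <;> rfl)] at h3 h4
        simp only [if_true, Bool.false_eq_true, if_false] at h3 h4
        refine h2.symm.trans ?_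
        rw [sub_smul, ← h3, ← h4]
        rfl
    · change oval P [(0, OPiece.cup d), (0, OPiece.cap d)] = _
      rw [oval_eq P (isOTangle_iff.2 (show Tng [(0, OPiece.cup d), (0, OPiece.cap d)] [] [] by
        cases d <;> rfl)), oval_eq P (IsOTangle.nil _), h.loop d _ rfl, h.empty _ rfl]
      simp

/-- The way back from brackets to diagrams, by which functions on words constructed below become
HOMFLY-PT polynomials. -/
theorem OSkein.isHomfly {P : Word OPiece → K}
    (h : OSkein P (q - q⁻¹) (curlFactor a) (fun _ => (a - a⁻¹) / (q - q⁻¹))) (h1 : P [] = 1) :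
    IsHomfly a q (fun D => P D.word) := by
  have right : ∀ e (s : Dir), br P [s] [s] [(1, .cup s), (0, .cross e s s), (1, .cap s)] =
      (curlFactor a (!e) s) • br P [s] [s] [] := fun e s => h.toIsotopy.curl_right (h.curl (!e) s)
  have left : ∀ e (s : Dir), br P [s] [s] [(0, .cup s.op), (1, .cross e s s), (0, .cap s.op)] =
      (curlFactor a (!e) s.op) • br P [s] [s] [] :=
    fun e s => h.toIsotopy.curl_left (h.curl (!e) s.op)
  refine ⟨?_, ?_, ?_, ?_, ?_, ?_⟩
  · intro x y u v k D₁ D₂ hm h2 h3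
    have h4 := isOTangle_iff.1 D₁.closed
    simp only [h2, h3] at h4 ⊢
    rcases OMove.br_eq h.toIsotopy h.r3 (fun e s => by rw [right, left]; rfl) hm with
      ⟨g, g', m, rfl, rfl⟩ | ⟨s, t, h5, h6⟩
    · exact exchange_apply h.toIsotopy g g' m h4
    · exact apply_eq_of_br h5 h6 h4
  · intro u v k D₁ D₂ D₃ h2 h3 h4
    have h5 := isOTangle_iff.1 D₁.closed
    rw [h2] at h5
    have h6 : Occupies [(0, OPiece.cross true .up .up)] [Dir.up, .up] [.up, .up] := by
      refine ⟨rfl, by simp, fun s t h => ?_⟩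
      obtain ⟨l, r, h7, rfl, -⟩ := tng_cons_iff.1 h
      obtain rfl := List.length_eq_zero_iff.1 h7
      exact ⟨r, rfl⟩
    obtain ⟨c, hc, hf⟩ := h6.ctx h5
    have h8 := congrFun h.skein c
    rw [Pi.sub_apply, Pi.smul_apply, br_of_fits _ _ hc, br_of_fits _ _ hc, br_of_fits _ _ hc,
      hf, hf, hf, ← h2, ← h3, shift_nil, List.append_nil, ← h4] at h8
    exact h8
  · intro u v k s D₁ D₂ h2 h3
    have h5 := isOTangle_iff.1 D₁.closed
    rw [h2] at h5
    have h6 : Occupies [(1, OPiece.cup s), (0, OPiece.cross true s s), (1, OPiece.cap s)]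
        [s] [s] := by
      refine ⟨by cases s <;> rfl, by simp, fun s' t h => ?_⟩
      rcases s' with _ | ⟨b, s'⟩ <;>
      simp [Tng, run, step, Option.bind_eq_some_iff, opiece_bot, opiece_top, OPiece.bot,
        OPiece.top] at h ⊢
      simp [h]
    obtain ⟨c, hc, hf⟩ := h6.ctx h5
    have h8 := congrFun (right true s) c
    rw [Pi.smul_apply, br_of_fits _ _ hc, br_of_fits _ _ hc,
      hf, hf, ← h2, shift_nil, List.append_nil, ← h3] at h8
    exact h8
  · intro u v k s D₁ D₂ h2 h3
    have h5 := isOTangle_iff.1 D₁.closed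
    rw [h2] at h5
    have h6 : Occupies [(0, OPiece.cup s.op), (1, OPiece.cross false s s), (0, OPiece.cap s.op)]
        [s] [s] := by
      refine ⟨by cases s <;> rfl, by simp, fun s' t h => ?_⟩
      rcases s' with _ | ⟨b, s'⟩ <;>
      simp [Tng, run, step, Option.bind_eq_some_iff, opiece_bot, opiece_top, OPiece.bot,
        OPiece.top, dir_op_op] at h ⊢
      simp [h]
    obtain ⟨c, hc, hf⟩ := h6.ctx h5
    have h8 := congrFun (left false s) c
    rw [Pi.smul_apply, br_of_fits _ _ hc, br_of_fits _ _ hc,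
      hf, hf, ← h2, shift_nil, List.append_nil, ← h3] at h8
    exact h8
  · intro s D hD
    have hf : Ctx.Fits (G := OPiece) ([], [], [], []) ([] : List Dir) [] :=
      ⟨Tng.nil _, Tng.nil _⟩
    have := congrFun (h.loop s) ([], [], [], [])
    rw [Pi.smul_apply, br_of_fits P _ hf, br_of_fits P _ hf] at this
    simpa [Ctx.fill, shift, h1, hD] using this
  · intro D hD
    rw [hD, h1]

end Jaeger

namespace Jaeger
open PieceSys Reversal CrossSys

/-! ### State models -/

/-- A state of a piece whose ends carry labels in `B`: the labels, the weight and the remaining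
oriented word. -/
structure PieceState (K B : Type*) where
  bot : List B
  top : List B
  weight : K
  word : Word OPiece

/-- Local states for all pieces. A label `x` belongs to a strand labelled by `und x`, of which
`red x` remains. -/
structure StateModel (K : Type*) (G L : Type) (B : Type) [PieceSys G L] where
  und : B → L
  red : B → Option Dir
  tab : G → List (PieceState K B)
  bot_eq : ∀ g, ∀ s ∈ tab g, s.bot.map und = PieceSys.bot g
  top_eq : ∀ g, ∀ s ∈ tab g, s.top.map und = PieceSys.top g
  tng : ∀ g, ∀ s ∈ tab g, Tng s.word (s.bot.filterMap red) (s.top.filterMap red)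

namespace StateModel

section
variable {K : Type*} [One K] [Mul K] {G L B : Type} [PieceSys G L] [DecidableEq B]
  (m : StateModel K G L B)

/-- The states of a word with bottom labels `b`, recorded as weight, top labels and remaining
word. -/
def runs : Word G → List B → List (K × List B × Word OPiece)
  | [], b => [(1, b, [])]
  | (i, g) :: x, b => (m.tab g).flatMap fun s =>
      if i ≤ b.length ∧ s.bot <+: b.drop i then
        (runs x (b.take i ++ (s.top ++ b.drop (i + s.bot.length)))).map fun p =>
          (s.weight * p.1, p.2.1, shift ((b.take i).filterMap m.red).length s.word ++ p.2.2)
      else []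

/-- The states of a word without top ends. -/
def total : Word G → List B → List (K × Word OPiece)
  | [], b => if b = [] then [(1, [])] else []
  | (i, g) :: x, b => (m.tab g).flatMap fun s =>
      if i ≤ b.length ∧ s.bot <+: b.drop i then
        (total x (b.take i ++ (s.top ++ b.drop (i + s.bot.length)))).map fun p =>
          (s.weight * p.1, shift ((b.take i).filterMap m.red).length s.word ++ p.2)
      else []

variable {m} [DecidableEq L]

theorem split_of_prefix {i : ℕ} {b c : List B} (h : i ≤ b.length ∧ c <+: b.drop i) :
    ∃ l r, l.length = i ∧ b = l ++ (c ++ r) ∧ b.take i = l ∧ b.drop (i + c.length) = r := by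
  obtain ⟨h1, r, h2⟩ := h
  have h3 : b = b.take i ++ (c ++ r) := by rw [h2, List.take_append_drop]
  refine ⟨b.take i, r, by simpa using h1, h3, rfl, ?_⟩
  rw [← List.drop_drop, ← h2]; simp

theorem runs_spec {x : Word G} {b : List B} {p : K × List B × Word OPiece}
    (hp : p ∈ m.runs x b) :
    (∀ t, Tng x (b.map m.und) t → p.2.1.map m.und = t) ∧
      Tng p.2.2 (b.filterMap m.red) (p.2.1.filterMap m.red) := by
  induction x generalizing b p with
  | nil =>
    simp only [runs, List.mem_singleton] at hp
    subst hp
    exact ⟨fun t h => tng_nil_iff.1 h, Tng.nil _⟩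
  | cons q x ih =>
    obtain ⟨i, g⟩ := q
    simp only [runs, List.mem_flatMap] at hp
    obtain ⟨s, hs, hp⟩ := hp
    split_ifs at hp with hc
    · obtain ⟨l, r, rfl, rfl, h1, h2⟩ := split_of_prefix hc
      rw [h1, h2] at hp
      obtain ⟨p', hp', rfl⟩ := List.mem_map.1 hp
      obtain ⟨h3, h4⟩ := ih hp'
      constructor
      · intro t ht
        refine h3 t ?_
        obtain ⟨l', r', hl, hb, h5⟩ := tng_cons_iff.1 ht
        simp only [List.map_append, m.bot_eq g s hs, m.top_eq g s hs] at hb ⊢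
        obtain ⟨rfl, h6⟩ := List.append_inj hb (by simp [hl])
        obtain rfl := List.append_cancel_left h6
        exact h5
      · have := ((m.tng g s hs).whisker (l.filterMap m.red) (r.filterMap m.red)).append
          (by simpa using h4)
        simpa using this
    · simp at hp

theorem total_spec {x : Word G} {b : List B} {p : K × Word OPiece} (hp : p ∈ m.total x b) :
    Tng p.2 (b.filterMap m.red) [] := by
  induction x generalizing b p with
  | nil =>
    by_cases hb : b = []
    · subst hb
      simp only [total, if_true, List.mem_singleton] at hp
      subst hp
      exact Tng.nil _
    · simp [total, hb] at hp
  | cons q x ih =>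
    obtain ⟨i, g⟩ := q
    simp only [total, List.mem_flatMap] at hp
    obtain ⟨s, hs, hp⟩ := hp
    split_ifs at hp with hc
    · obtain ⟨l, r, rfl, rfl, h1, h2⟩ := split_of_prefix hc
      rw [h1, h2] at hp
      obtain ⟨p', hp', rfl⟩ := List.mem_map.1 hp
      have := ((m.tng g s hs).whisker (l.filterMap m.red) (r.filterMap m.red)).append
        (by simpa using ih hp')
      simpa using this
    · simp at hp

end

variable {K : Type*} [Field K] {G L B : Type} [PieceSys G L] [DecidableEq L] [DecidableEq B]
  (m : StateModel K G L B)

/-- The state sum. -/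
def value (P : Word OPiece → K) (w : Word G) : K :=
  ((m.total w []).map fun p => p.1 * P p.2).sum

variable {m}

/-- The states of a word that begins with `x` are obtained from the states of `x`. -/
theorem total_shift_append (x w : Word G) (l b r : List B) {t : List L}
    (hx : Tng x (b.map m.und) t) :
    m.total (shift l.length x ++ w) (l ++ (b ++ r)) =
      (m.runs x b).flatMap fun p => (m.total w (l ++ (p.2.1 ++ r))).map fun p' =>
        (p.1 * p'.1, shift (l.filterMap m.red).length p.2.2 ++ p'.2) := by
  induction x generalizing b with
  | nil => simp [runs, shift_nil]
  | cons q x ih =>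
    obtain ⟨i, g⟩ := q
    rw [shift_cons, List.cons_append, total, runs, List.flatMap_assoc]
    refine List.flatMap_congr fun s hs => ?_
    obtain ⟨l', r', hl, hb, h5⟩ := tng_cons_iff.1 hx
    have hb' := congrArg List.length hb
    have hsl := congrArg List.length (m.bot_eq g s hs)
    simp only [List.length_map, List.length_append] at hb' hsl
    have hcond : (l.length + i ≤ (l ++ (b ++ r)).length ∧
        s.bot <+: (l ++ (b ++ r)).drop (l.length + i)) ↔
        (i ≤ b.length ∧ s.bot <+: b.drop i) := by
      rw [← List.drop_drop, List.drop_left, List.drop_append_of_le_length (by omega)]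
      constructor
      · rintro ⟨-, h2⟩
        refine ⟨by omega, List.prefix_of_prefix_length_le h2 (List.prefix_append _ _) ?_⟩
        simp; omega
      · rintro ⟨h1, h2⟩
        exact ⟨by simp; omega, h2.trans (List.prefix_append _ _)⟩
    by_cases hc : i ≤ b.length ∧ s.bot <+: b.drop i
    · rw [if_pos hc, if_pos (hcond.2 hc)]
      obtain ⟨l2, r2, rfl, rfl, h1, h2⟩ := split_of_prefix hc
      have h3 : (l ++ (l2 ++ (s.bot ++ r2) ++ r)).take (l.length + l2.length) = l ++ l2 := by
        rw [show l ++ (l2 ++ (s.bot ++ r2) ++ r) = (l ++ l2) ++ (s.bot ++ (r2 ++ r)) by simp]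
        exact List.take_left' (by simp)
      have h4 : (l ++ (l2 ++ (s.bot ++ r2) ++ r)).drop (l.length + l2.length + s.bot.length) =
          r2 ++ r := by
        rw [show l ++ (l2 ++ (s.bot ++ r2) ++ r) = (l ++ l2 ++ s.bot) ++ (r2 ++ r) by simp]
        exact List.drop_left' (by simp [Nat.add_assoc])
      simp only [List.map_append, m.bot_eq g s hs] at hb
      obtain ⟨rfl, h6⟩ := List.append_inj hb (by simp [hl])
      obtain rfl := List.append_cancel_left h6
      have h7 := ih (l2 ++ (s.top ++ r2)) (by
        simpa only [List.map_append, m.top_eq g s hs] using h5)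
      rw [h1, h2, h3, h4]
      simp only [List.append_assoc] at h7 ⊢
      rw [h7, List.map_flatMap, List.flatMap_map]
      refine List.flatMap_congr fun p _ => ?_
      simp [mul_assoc, shift_append, shift_shift]
    · rw [if_neg hc, if_neg (mt hcond.1 hc)]
      rfl

variable (m) in
/-- Value of a word with bottom labels `b` under a linear functional. -/
noncomputable def localValue (P : Word OPiece → K) (x : Word G) (b : List B)
    (Θ : List B → (Ctx OPiece Dir → K) →ₗ[K] K) : K :=
  ((m.runs x b).map fun p =>
    p.1 * Θ p.2.1 (br P (b.filterMap m.red) (p.2.1.filterMap m.red) p.2.2)).sum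

theorem sum_map_flatMap {α β : Type*} (l : List α) (f : α → List β) (g : β → K) :
    ((l.flatMap f).map g).sum = (l.map fun a => ((f a).map g).sum).sum := by
  induction l with
  | nil => rfl
  | cons a l ih => simp [ih]

/-- The state sum depends on a part of a diagram only through its local values. -/
theorem exists_localValue (P : Word OPiece → K) {s t : List L} {c : Ctx G L} (hc : c.Fits s t) :
    ∃ J : List (K × List B × (List B → (Ctx OPiece Dir → K) →ₗ[K] K)),
      (∀ j ∈ J, j.2.1.map m.und = s) ∧ ∀ x, Tng x s t →
        m.value P (c.fill x) = (J.map fun j => j.1 * m.localValue P x j.2.1 j.2.2).sum := by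
  obtain ⟨l, r, u, v⟩ := c
  obtain ⟨hu, hv⟩ := hc
  simp only at hu hv
  -- parts of the label list at the height of the tangle
  let lt : List B → List B := fun b => b.take l.length
  let md : List B → List B := fun b => (b.drop l.length).take s.length
  let rt : List B → List B := fun b => (b.drop l.length).drop s.length
  have hsplit : ∀ b : List B, b = lt b ++ (md b ++ rt b) := fun b => by
    simp only [lt, md, rt]
    rw [List.take_append_drop, List.take_append_drop]
  have hmap : ∀ p ∈ m.runs u [], (lt p.2.1).map m.und = l ∧ (md p.2.1).map m.und = s ∧
      (rt p.2.1).map m.und = r := by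
    intro p hp
    have := (runs_spec hp).1 _ hu
    simp only [lt, md, rt, List.map_take, List.map_drop, this]
    simp
  -- For a state `p` of the word below, `Θ p t'` sums over the states of the word above that start
  -- with the labels `t'` on the tangle. What remains of both states forms the surroundings of the
  -- oriented tangle that is left of `x`.
  let Θ : K × List B × Word OPiece → List B → (Ctx OPiece Dir → K) →ₗ[K] K := fun p t' =>
    { toFun := fun h => ((m.total v (lt p.2.1 ++ (t' ++ rt p.2.1))).map fun p' =>
        p'.1 * h ((lt p.2.1).filterMap m.red, (rt p.2.1).filterMap m.red, p.2.2, p'.2)).sum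
      map_add' := fun h h' => by simp [mul_add, List.sum_map_add]
      map_smul' := fun a h => by
        simp only [Pi.smul_apply, smul_eq_mul, RingHom.id_apply, ← List.sum_map_mul_left]
        simp only [mul_left_comm] }
  refine ⟨(m.runs u []).map fun p => (p.1, md p.2.1, Θ p), ?_, ?_⟩
  · simp only [List.mem_map]
    rintro _ ⟨p, hp, rfl⟩
    exact (hmap p hp).2.1
  · intro x hx
    have h1 := total_shift_append (m := m) u (shift l.length x ++ v) [] [] [] (by simpa using hu)
    simp only [List.length_nil, shift_zero, List.nil_append, List.append_nil,
      List.filterMap_nil] at h1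
    rw [value, Ctx.fill, h1, sum_map_flatMap, List.map_map]
    refine congrArg List.sum (List.map_congr_left fun p hp => ?_)
    obtain ⟨h2, h3, h4⟩ := hmap p hp
    have h5 := total_shift_append (m := m) x v (lt p.2.1) (md p.2.1) (rt p.2.1) (t := t)
      (by rwa [h3])
    rw [show (lt p.2.1).length = l.length by rw [← h2, List.length_map], ← hsplit] at h5
    rw [h5, Function.comp_apply, localValue, List.map_map, sum_map_flatMap,
      ← List.sum_map_mul_left]
    refine congrArg List.sum (List.map_congr_left fun p1 hp1 => ?_)
    have h6 := runs_spec hp1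
    simp only [List.map_map, Θ, LinearMap.coe_mk, AddHom.coe_mk, ← List.sum_map_mul_left]
    refine congrArg List.sum (List.map_congr_left fun p' hp' => ?_)
    have h7 := total_spec hp'
    have h8 := (runs_spec hp).2
    rw [hsplit p.2.1] at h8
    simp only [List.filterMap_append, List.filterMap_nil] at h7 h8
    rw [br_of_fits P _ ⟨by simpa using h8, by simpa using h7⟩]
    simp [Ctx.fill, mul_assoc]

end StateModel

end Jaeger

/-! ### Relations between state sums from relations between local values. -/

namespace Jaeger
open PieceSys Reversal CrossSys

namespace StateModel

variable {K : Type*} [Field K] {G L B : Type} [DecidableEq L] [DecidableEq B]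

theorem sum_map_comm {α β : Type*} (l : List α) (l' : List β) (f : α → β → K) :
    (l.map fun a => (l'.map fun b => f a b).sum).sum =
      (l'.map fun b => (l.map fun a => f a b).sum).sum := by
  induction l with
  | nil => simp
  | cons a l ih => simp [ih, List.sum_map_add]

section piece
variable [PieceSys G L] {m : StateModel K G L B} {P : Word OPiece → K}

/-- A linear relation between local values is a local linear relation between state sums. -/
theorem br_value_relation {s t : List L} (X : List (K × Word G)) (hX : ∀ x ∈ X, Tng x.2 s t)
    (h : ∀ b : List B, b.map m.und = s → ∀ Θ : List B → (Ctx OPiece Dir → K) →ₗ[K] K,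
      (X.map fun x => x.1 * m.localValue P x.2 b Θ).sum = 0) :
    (X.map fun x => x.1 • br (m.value P) s t x.2).sum = 0 := by
  funext c
  have hsum : ∀ Y : List (K × Word G),
      (Y.map fun x => x.1 • br (m.value P) s t x.2).sum c =
        (Y.map fun x => x.1 * br (m.value P) s t x.2 c).sum := by
    intro Y
    induction Y with
    | nil => rfl
    | cons y Y ih => simp [ih]
  rw [hsum]
  by_cases hc : c.Fits s t
  · obtain ⟨J, hJ, hx⟩ := exists_localValue (m := m) P hc
    have h1 : (X.map fun x => x.1 * br (m.value P) s t x.2 c) =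
        X.map fun x => (J.map fun j => j.1 * (x.1 * m.localValue P x.2 j.2.1 j.2.2)).sum := by
      refine List.map_congr_left fun x hxX => ?_
      rw [br_of_fits _ _ hc, hx _ (hX x hxX), ← List.sum_map_mul_left]
      simp only [mul_left_comm]
    rw [h1, sum_map_comm]
    have h2 : (J.map fun j => (X.map fun x =>
        j.1 * (x.1 * m.localValue P x.2 j.2.1 j.2.2)).sum) = J.map fun _ => (0 : K) := by
      refine List.map_congr_left fun j hj => ?_
      rw [List.sum_map_mul_left, h _ (hJ j hj), mul_zero]
    rw [h2]
    simp
  · have h1 : (X.map fun x => x.1 * br (m.value P) s t x.2 c) = X.map fun _ => (0 : K) :=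
      List.map_congr_left fun x _ => by rw [br_of_not_fits _ _ hc, mul_zero]
    rw [h1]
    simp

theorem br_value_eq_smul {s t : List L} {x y : Word G} (κ : K) (hx : Tng x s t) (hy : Tng y s t)
    (h : ∀ b : List B, b.map m.und = s → ∀ Θ : List B → (Ctx OPiece Dir → K) →ₗ[K] K,
      m.localValue P x b Θ = κ * m.localValue P y b Θ) :
    br (m.value P) s t x = κ • br (m.value P) s t y := by
  have := br_value_relation (m := m) (P := P) (s := s) (t := t) [(1, x), (-κ, y)] (by simp [hx, hy])
    (fun b hb Θ => by simp [h b hb Θ])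
  simpa [← sub_eq_add_neg, sub_eq_zero] using this

theorem br_value_eq {s t : List L} {x y : Word G} (hx : Tng x s t) (hy : Tng y s t)
    (h : ∀ b : List B, b.map m.und = s → ∀ Θ : List B → (Ctx OPiece Dir → K) →ₗ[K] K,
      m.localValue P x b Θ = m.localValue P y b Θ) :
    br (m.value P) s t x = br (m.value P) s t y := by
  rw [br_value_eq_smul (1 : K) hx hy fun b hb Θ => by rw [h b hb Θ, one_mul], one_smul]

theorem prefix_drop_iff {l b c r : List B} (h : c.length = b.length) :
    (l.length ≤ (l ++ (b ++ r)).length ∧ c <+: (l ++ (b ++ r)).drop l.length) ↔ c = b := by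
  rw [List.drop_left]
  constructor
  · rintro ⟨-, r', h1⟩
    exact List.append_inj_left h1 h
  · rintro rfl
    exact ⟨by simp, List.prefix_append _ _⟩

theorem runs_cons {i : ℕ} {g : G} (x : Word G) (l b r : List B) (hi : l.length = i)
    (hb : b.map m.und = bot g) :
    m.runs ((i, g) :: x) (l ++ (b ++ r)) = (m.tab g).flatMap fun s =>
      if s.bot = b then (m.runs x (l ++ (s.top ++ r))).map fun p =>
        (s.weight * p.1, p.2.1, shift (l.filterMap m.red).length s.word ++ p.2.2) else [] := by
  subst hi
  rw [runs]
  refine List.flatMap_congr fun s hs => ?_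
  have hl : s.bot.length = b.length := by
    simpa [← hb] using congrArg List.length (m.bot_eq g s hs)
  simp only [prefix_drop_iff hl]
  refine if_congr Iff.rfl ?_ rfl
  rw [List.take_left, ← List.drop_drop, List.drop_left, hl, List.drop_left]


/-- The sum over the states of the lowest piece. -/
theorem localValue_cons {i : ℕ} {g : G} (x : Word G) (l b r : List B) (hi : l.length = i)
    (hb : b.map m.und = bot g) (Θ : List B → (Ctx OPiece Dir → K) →ₗ[K] K) :
    m.localValue P ((i, g) :: x) (l ++ (b ++ r)) Θ = ((m.tab g).map fun s =>
      if s.bot = b then ((m.runs x (l ++ (s.top ++ r))).map fun p => s.weight * p.1 *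
        Θ p.2.1 (br P ((l ++ (b ++ r)).filterMap m.red) (p.2.1.filterMap m.red)
          (shift (l.filterMap m.red).length s.word ++ p.2.2))).sum else 0).sum := by
  rw [localValue, runs_cons x l b r hi hb, sum_map_flatMap]
  refine congrArg List.sum (List.map_congr_left fun s _ => ?_)
  split_ifs
  · rw [List.map_map]; rfl
  · rfl

end piece

section exchange
variable [CrossSys G L] {m : StateModel K G L B} {P : Word OPiece → K}

/-- Since `g`, `h` and `M` are arbitrary, no finite check is possible. The states of the two pieces
are chosen independently with the same product of weights in either order, and their remaining words
commute. -/
theorem br_value_exchange (hP : Isotopy P) (g h : G) (M : List L) :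
    br (m.value P) (bot g ++ (M ++ bot h)) (top g ++ (M ++ top h))
        [(0, g), ((top g).length + M.length, h)] =
      br (m.value P) (bot g ++ (M ++ bot h)) (top g ++ (M ++ top h))
        [((bot g).length + M.length, h), (0, g)] := by
  refine br_value_eq ?_ ?_ fun b hb Θ => ?_
  · exact (Tng.single [] (M ++ bot h) g).append (by simpa using Tng.single (top g ++ M) [] h)
  · simpa using (Tng.single (bot g ++ M) [] h).append
      (by simpa using Tng.single [] (M ++ top h) g)
  · obtain ⟨b₁, b', rfl, h1, hb'⟩ := List.map_eq_append_iff.1 hb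
    obtain ⟨b₂, b₃, rfl, h2, h3⟩ := List.map_eq_append_iff.1 hb'
    have e1 := localValue_cons (m := m) (P := P) (i := 0) [((top g).length + M.length, h)] [] b₁
      (b₂ ++ b₃) rfl h1 Θ
    have e2 := localValue_cons (m := m) (P := P) [(0, g)] (b₁ ++ b₂) b₃ []
      (i := (bot g).length + M.length) (by simp [← h1, ← h2]) h3 Θ
    simp only [List.nil_append, List.append_nil, List.append_assoc] at e1 e2
    rw [e1, e2]
    have e3 : ∀ s ∈ m.tab g, (if s.bot = b₁ then
        ((m.runs [((top g).length + M.length, h)] (s.top ++ (b₂ ++ b₃))).map fun p =>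
          s.weight * p.1 * Θ p.2.1 (br P ((b₁ ++ (b₂ ++ b₃)).filterMap m.red)
            (p.2.1.filterMap m.red)
            (shift (([] : List B).filterMap m.red).length s.word ++ p.2.2))).sum else 0) =
        ((m.tab h).map fun s' => if s.bot = b₁ ∧ s'.bot = b₃ then
          s.weight * s'.weight * Θ (s.top ++ (b₂ ++ s'.top))
            (br P ((b₁ ++ (b₂ ++ b₃)).filterMap m.red) ((s.top ++ (b₂ ++ s'.top)).filterMap m.red)
              (s.word ++ shift ((s.top ++ b₂).filterMap m.red).length s'.word)) else 0).sum := by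
      intro s hs
      by_cases hsb : s.bot = b₁
      · have e4 := runs_cons (m := m) [] (s.top ++ b₂) b₃ []
          (i := (top g).length + M.length) (by simp [← m.top_eq g s hs, ← h2]) h3
        simp only [List.append_nil, List.append_assoc] at e4
        rw [if_pos hsb, e4, sum_map_flatMap]
        refine congrArg List.sum (List.map_congr_left fun s' _ => ?_)
        by_cases hsb' : s'.bot = b₃
        · simp [hsb, hsb', runs, shift_zero]
        · simp [hsb']
      · simp [hsb]
    have e5 : ∀ s' ∈ m.tab h, (if s'.bot = b₃ then
        ((m.runs [(0, g)] (b₁ ++ (b₂ ++ s'.top))).map fun p =>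
          s'.weight * p.1 * Θ p.2.1 (br P ((b₁ ++ (b₂ ++ b₃)).filterMap m.red)
            (p.2.1.filterMap m.red)
            (shift ((b₁ ++ b₂).filterMap m.red).length s'.word ++ p.2.2))).sum else 0) =
        ((m.tab g).map fun s => if s.bot = b₁ ∧ s'.bot = b₃ then
          s.weight * s'.weight * Θ (s.top ++ (b₂ ++ s'.top))
            (br P ((b₁ ++ (b₂ ++ b₃)).filterMap m.red) ((s.top ++ (b₂ ++ s'.top)).filterMap m.red)
              (s.word ++ shift ((s.top ++ b₂).filterMap m.red).length s'.word)) else 0).sum := by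
      intro s' hs'
      by_cases hsb' : s'.bot = b₃
      · have e4 := runs_cons (m := m) [] [] b₁ (b₂ ++ s'.top) (i := 0) rfl h1
        simp only [List.nil_append] at e4
        rw [if_pos hsb', e4, sum_map_flatMap]
        refine congrArg List.sum (List.map_congr_left fun s hs => ?_)
        by_cases hsb : s.bot = b₁
        -- Erasing strands keeps the two words side by side, with the remaining strands of `b₂`
        -- between them.
        · have e6 := hP.exchange_word (m.tng g s hs)
            ((m.tng h s' hs').whisker (b₂.filterMap m.red) [])
          simp only [hsb, hsb', List.append_nil, shift_shift, ← List.length_append,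
            ← List.filterMap_append, List.append_assoc] at e6
          simp only [hsb, hsb', runs, List.map_cons, List.map_nil, List.sum_cons, List.sum_nil,
            if_true, and_self, List.filterMap_nil, List.length_nil, shift_zero, List.append_nil,
            add_zero, e6]
          ring
        · simp [hsb]
      · simp [hsb']
    rw [List.map_congr_left e3, List.map_congr_left e5, sum_map_comm]

end exchange

end StateModel

end Jaeger

namespace Jaeger
open PieceSys Reversal CrossSys

/-! ### Symbolic scalars -/

/-- Sums of terms `n * z ^ i * q ^ j * a ^ k`, where `z = q - q⁻¹`. -/
abbrev Coef : Type := List (ℤ × ℤ × ℤ × ℤ)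

namespace Coef

def term (n i j k : ℤ) : Coef := [(n, i, j, k)]

instance : One Coef := ⟨term 1 0 0 0⟩

instance : Mul Coef := ⟨fun c d => List.flatMap (fun x => List.map (fun y =>
  (x.1 * y.1, x.2.1 + y.2.1, x.2.2.1 + y.2.2.1, x.2.2.2 + y.2.2.2)) d) c⟩

variable {K : Type*} [Field K]

/-- Value of a term. -/
def termValue (q a : K) (m : ℤ × ℤ × ℤ × ℤ) : K :=
  m.1 * ((q - q⁻¹) ^ m.2.1 * q ^ m.2.2.1 * a ^ m.2.2.2)

def eval (q a : K) (c : Coef) : K := (List.map (termValue q a) c).sum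

variable {q a : K}

@[simp] theorem eval_term (n i j k : ℤ) :
    (term n i j k).eval q a = n * ((q - q⁻¹) ^ i * q ^ j * a ^ k) := by
  simp [eval, term, termValue]

@[simp] theorem eval_one : (1 : Coef).eval q a = 1 := by
  rw [show (1 : Coef) = term 1 0 0 0 from rfl]; simp

theorem eval_mul (hz : q - q⁻¹ ≠ 0) (hq : q ≠ 0) (ha : a ≠ 0) (c d : Coef) :
    (c * d).eval q a = c.eval q a * d.eval q a := by
  change (List.map _ (List.flatMap _ _)).sum = _
  rw [StateModel.sum_map_flatMap, eval, ← List.sum_map_mul_right]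
  refine congrArg List.sum (List.map_congr_left fun x _ => ?_)
  rw [eval, ← List.sum_map_mul_left, List.map_map]
  refine congrArg List.sum (List.map_congr_left fun y _ => ?_)
  simp only [termValue, Function.comp_apply, zpow_add₀ hz, zpow_add₀ hq, zpow_add₀ ha,
    Int.cast_mul]
  ring

end Coef

/-! ### Collecting terms -/

section collect
variable {κ : Type*} [DecidableEq κ]

/-- Adds a term to a list of terms with different keys. -/
def insertTerm (n : ℤ) (k : κ) : List (ℤ × κ) → List (ℤ × κ)
  | [] => [(n, k)]
  | (m, k') :: X => if k = k' then (n + m, k') :: X else (m, k') :: insertTerm n k X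

/-- Collects the terms with equal keys. -/
def collect (X : List (ℤ × κ)) : List (ℤ × κ) := X.foldr (fun x Y => insertTerm x.1 x.2 Y) []

theorem sum_insertTerm {K : Type*} [Field K] (g : κ → K) (n : ℤ) (k : κ) (X : List (ℤ × κ)) :
    ((insertTerm n k X).map fun x => (x.1 : K) * g x.2).sum =
      n * g k + (X.map fun x => (x.1 : K) * g x.2).sum := by
  induction X with
  | nil => rfl
  | cons x X ih =>
    obtain ⟨m, k'⟩ := x
    rw [insertTerm]
    split_ifs with h
    · subst h; simp [add_mul, add_assoc]
    · simp [ih, add_left_comm]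

theorem sum_collect {K : Type*} [Field K] (g : κ → K) (X : List (ℤ × κ)) :
    ((collect X).map fun x => (x.1 : K) * g x.2).sum = (X.map fun x => (x.1 : K) * g x.2).sum := by
  induction X with
  | nil => rfl
  | cons x X ih =>
    rw [collect, List.foldr_cons, sum_insertTerm]
    simp only [collect] at ih
    simp [ih]

/-- Multiplies a term without `z` by `z ^ n`, in terms of `q`. -/
def expandTerm {β : Type*} : ℕ → ℤ × (ℤ × ℤ) × β → List (ℤ × (ℤ × ℤ) × β)
  | 0, x => [x]
  | n + 1, x => expandTerm n (x.1, (x.2.1.1 + 1, x.2.1.2), x.2.2) ++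
      expandTerm n (-x.1, (x.2.1.1 - 1, x.2.1.2), x.2.2)

/-- Decides whether a sum of terms vanishes after multiplication by `z ^ 2`. -/
def vanishes {β : Type*} [DecidableEq β] (X : List (ℤ × (ℤ × ℤ × ℤ) × β)) : Bool :=
  let Y := (collect X).filter fun x => x.1 ≠ 0
  -- Negative powers of `z` come from circle factors. The test fails if an exponent below `-2`
  -- survives the first collection.
  (Y.all fun x => decide (0 ≤ x.2.1.1 + 2)) &&
    ((collect (Y.flatMap fun x => expandTerm (x.2.1.1 + 2).toNat (x.1, x.2.1.2, x.2.2))).all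
      fun x => decide (x.1 = 0))

theorem sum_expandTerm {K : Type*} [Field K] {q a : K} (hq : q ≠ 0) {β : Type*} (g : β → K)
    (n : ℕ) (x : ℤ × (ℤ × ℤ) × β) :
    ((expandTerm n x).map fun x => (x.1 : K) * (q ^ x.2.1.1 * a ^ x.2.1.2 * g x.2.2)).sum =
      (q - q⁻¹) ^ n * (x.1 * (q ^ x.2.1.1 * a ^ x.2.1.2 * g x.2.2)) := by
  induction n generalizing x with
  | zero => simp [expandTerm]
  | succ n ih =>
    rw [expandTerm, List.map_append, List.sum_append, ih, ih, zpow_add_one₀ hq, zpow_sub_one₀ hq]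
    push_cast
    ring

/-- As `z` is invertible, the sum may be multiplied by `z ^ 2`. Then `z = q - q⁻¹` can be expanded,
and all integral coefficients cancel for every value of the unknowns `g`. Only this direction is
needed. -/
theorem eq_zero_of_vanishes {K : Type*} [Field K] {q a : K} (hq : q ≠ 0) (hz : q - q⁻¹ ≠ 0)
    {β : Type*} [DecidableEq β] (g : β → K) {X : List (ℤ × (ℤ × ℤ × ℤ) × β)}
    (h : vanishes X = true) :
    (X.map fun x => (x.1 : K) *
      ((q - q⁻¹) ^ x.2.1.1 * q ^ x.2.1.2.1 * a ^ x.2.1.2.2 * g x.2.2)).sum = 0 := by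
  simp only [vanishes, Bool.and_eq_true, List.all_eq_true, decide_eq_true_eq] at h
  obtain ⟨h1, h2⟩ := h
  set G : (ℤ × ℤ × ℤ) × β → K := fun x => (q - q⁻¹) ^ x.1.1 * q ^ x.1.2.1 * a ^ x.1.2.2 * g x.2
    with hG
  set Y := (collect X).filter fun x => x.1 ≠ 0 with hY
  have e1 : (X.map fun x => (x.1 : K) * G x.2).sum = (Y.map fun x => (x.1 : K) * G x.2).sum := by
    rw [← sum_collect, hY]
    induction collect X with
    | nil => rfl
    | cons y Z ih =>
      by_cases hy : y.1 = 0
      · simp [hy, ih]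
      · simp [hy, ih]
  have e2 : (q - q⁻¹) ^ 2 * (Y.map fun x => (x.1 : K) * G x.2).sum = 0 := by
    rw [← List.sum_map_mul_left]
    have e3 : ∀ x ∈ Y, (q - q⁻¹) ^ 2 * ((x.1 : K) * G x.2) =
        ((expandTerm (x.2.1.1 + 2).toNat (x.1, x.2.1.2, x.2.2)).map fun x =>
          (x.1 : K) * (q ^ x.2.1.1 * a ^ x.2.1.2 * g x.2.2)).sum := by
      intro x hx
      rw [sum_expandTerm hq]
      have e4 : (q - q⁻¹) ^ (x.2.1.1 + 2).toNat = (q - q⁻¹) ^ 2 * (q - q⁻¹) ^ x.2.1.1 := by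
        rw [← zpow_natCast, Int.toNat_of_nonneg (h1 x hx), zpow_add₀ hz, mul_comm]
        norm_cast
      rw [e4, hG]
      ring
    rw [List.map_congr_left e3, ← StateModel.sum_map_flatMap,
      ← sum_collect (fun y : (ℤ × ℤ) × β => q ^ y.1.1 * a ^ y.1.2 * g y.2)]
    refine List.sum_eq_zero fun y hy => ?_
    obtain ⟨x, hx, rfl⟩ := List.mem_map.1 hy
    simp [h2 x hx]
  change (X.map fun x => (x.1 : K) * G x.2).sum = 0
  rw [e1]
  exact (mul_eq_zero.1 e2).resolve_left (pow_ne_zero _ hz)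

end collect

/-! ### Rewriting of tangle words -/

instance : DecidableEq OPiece := fun g h =>
  match g, h with
  | .cup x, .cup y => decidable_of_iff (x = y) (by simp)
  | .cap x, .cap y => decidable_of_iff (x = y) (by simp)
  | .cross e x y, .cross e' x' y' => decidable_of_iff (e = e' ∧ x = x' ∧ y = y') (by simp)
  | .cup _, .cap _ => isFalse (by simp)
  | .cup _, .cross _ _ _ => isFalse (by simp)
  | .cap _, .cup _ => isFalse (by simp)
  | .cap _, .cross _ _ _ => isFalse (by simp)
  | .cross _ _ _, .cup _ => isFalse (by simp)
  | .cross _ _ _, .cap _ => isFalse (by simp)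

/-- A rule that replaces a tangle word by a linear combination of others. -/
structure Rule where
  src : List Dir
  tgt : List Dir
  lhs : Word OPiece
  rhs : List (Coef × Word OPiece)

/-- The value of the tangle word `x` is that of the linear combination `X`. -/
def Expands {K : Type*} [Field K] (q a : K) (P : Word OPiece → K) (s t : List Dir)
    (x : Word OPiece) (X : List (Coef × Word OPiece)) : Prop :=
  Tng x s t ∧ (∀ y ∈ X, Tng y.2 s t) ∧
    br P s t x = (X.map fun y => y.1.eval q a • br P s t y.2).sum

/-- The rules for words that begin with a given piece. -/
def rules (zc : Coef) (κ : Bool → Dir → Coef) (δ : Dir → Coef) : OPiece → List Rule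
  | .cap _ => []
  | .cup x =>
    [⟨[], [], [(0, .cup x), (0, .cap x)], [(δ x, [])]⟩,
     ⟨[x.op], [x.op], [(1, .cup x), (0, .cap x.op)], [(1, [])]⟩,
     ⟨[x], [x], [(0, .cup x), (1, .cap x.op)], [(1, [])]⟩,
     ⟨[], [x.op, x], [(0, .cup x), (0, .cross true x x.op)], [(κ true x, [(0, .cup x.op)])]⟩,
     ⟨[x], [x], [(1, .cup x), (0, .cross true x x), (1, .cap x)], [(κ false x, [])]⟩] ++
    [Dir.up, .down].flatMap fun y =>
      [⟨[y], [x, y, x.op], [(0, .cup x), (1, .cross true x.op y)],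
          [(1, [(1, .cup x), (0, .cross false y x)])]⟩,
       ⟨[y], [x, x.op, y], [(1, .cup x), (0, .cross true y x), (1, .cross true y x.op)],
          [(1, [(0, .cup x)])]⟩]
  -- The pieces `cross false` are always eliminated by the skein relation, so the other left-hand
  -- sides contain `cross true` only.
  | .cross false x y =>
    [⟨[x, y], [y, x], [(0, .cross false x y)],
      if x = y then [(1, [(0, .cross true x y)]), (.term (-1) 0 0 0 * zc, [])]
      else [(1, [(0, .cross true x y)]), (zc, [(0, .cap x), (0, .cup y)])]⟩]
  | .cross true x y =>
    (if x = y then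
      [⟨[x, y], [x, y], [(0, .cross true x y), (0, .cross true y x)],
        [(1, []), (zc, [(0, .cross true x y)])]⟩]
    else
      [⟨[x, y], [x, y], [(0, .cross true x y), (0, .cross true y x)],
        [(1, []), (.term (-1) 0 0 0 * zc, [(0, .cross true x y), (0, .cap y), (0, .cup x)])]⟩,
       ⟨[x, y], [], [(0, .cross true x y), (0, .cap y)], [(κ true y, [(0, .cap x)])]⟩]) ++
    [⟨[y.op, x, y], [x], [(1, .cross true x y), (0, .cap y.op)],
        [(1, [(0, .cross false y.op x), (1, .cap y.op)])]⟩,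
     ⟨[x.op, x, y], [y], [(1, .cross true x y), (0, .cross true x.op y), (1, .cap x.op)],
        [(1, [(0, .cap x.op)])]⟩] ++
    [Dir.up, .down].map fun w =>
      ⟨[x, y, w], [w, y, x], [(0, .cross true x y), (1, .cross true x w), (0, .cross true y w)],
        [(1, [(1, .cross true y w), (0, .cross true x w), (1, .cross true x y)])]⟩

/-- Applies a rule at the beginning of a word. -/
def Rule.apply (r : Rule) (s : List Dir) : Word OPiece → Option (List (Coef × Word OPiece))
  | [] => none
  | w@((i, _) :: _) =>
    match r.lhs with
    | [] => none
    | (j, _) :: _ =>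
      -- For `i < j` the truncated difference is `0`, and the comparison of the first pieces fails.
      if shift (i - j) r.lhs <+: w ∧ i - j ≤ s.length ∧ r.src <+: s.drop (i - j) then
        some (r.rhs.map fun y => (y.1, shift (i - j) y.2 ++ w.drop r.lhs.length))
      else none

/-- Applies the first possible rule. -/
def rewriteHead (s : List Dir) (w : Word OPiece) : List Rule → Option (List (Coef × Word OPiece))
  | [] => none
  | r :: R => match r.apply s w with
    | some X => some X
    | none => rewriteHead s w R

/-- Applies a rule at the first possible place. -/
def rewriteWord (R : OPiece → List Rule) : List Dir → Word OPiece →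
    Option (List (Coef × Word OPiece))
  | _, [] => none
  | s, p :: w => match rewriteHead s (p :: w) (R p.2) with
    | some X => some X
    | none => match step p s with
      | none => none
      | some s' => (rewriteWord R s' w).map fun X => X.map fun y => (y.1, p :: y.2)

/-- Applies rules repeatedly. -/
def normalize (R : OPiece → List Rule) (s : List Dir) : ℕ → Word OPiece → List (Coef × Word OPiece)
  | 0, w => [(1, w)]
  | n + 1, w => match rewriteWord R s w with
    | none => [(1, w)]
    | some X => X.flatMap fun x => (normalize R s n x.2).map fun y => (x.1 * y.1, y.2)

section soundness
variable {K : Type*} [Field K] {q a : K} {P : Word OPiece → K}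

theorem Expands.refl {s t : List Dir} {x : Word OPiece} (h : Tng x s t) :
    Expands q a P s t x [(1, x)] := ⟨h, by simpa using h, by simp⟩

theorem Expands.place {s t s' t' : List Dir} {x : Word OPiece} {X : List (Coef × Word OPiece)}
    (h : Expands q a P s t x X) (l r : List Dir) (u v : Word OPiece)
    (hu : Tng u s' (l ++ (s ++ r))) (hv : Tng v (l ++ (t ++ r)) t') :
    Expands q a P s' t' (u ++ (shift l.length x ++ v))
      (X.map fun y => (y.1, u ++ (shift l.length y.2 ++ v))) := by
  refine ⟨hu.append ((h.1.whisker l r).append hv), ?_, ?_⟩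
  · intro y hy
    obtain ⟨y', hy', rfl⟩ := List.mem_map.1 hy
    exact hu.append (((h.2.1 y' hy').whisker l r).append hv)
  · rw [← ext_br (R := K) P hu hv, h.2.2, map_list_sum, List.map_map, List.map_map]
    refine congrArg List.sum (List.map_congr_left fun y _ => ?_)
    simp only [Function.comp_apply, map_smul, ext_br P hu hv]

theorem Expands.trans (hz : q - q⁻¹ ≠ 0) (hq : q ≠ 0) (ha : a ≠ 0) {s t : List Dir}
    {x : Word OPiece} {X : List (Coef × Word OPiece)} (h : Expands q a P s t x X)
    (f : Word OPiece → List (Coef × Word OPiece))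
    (hf : ∀ y, Tng y s t → Expands q a P s t y (f y)) :
    Expands q a P s t x (X.flatMap fun y => (f y.2).map fun y' => (y.1 * y'.1, y'.2)) := by
  refine ⟨h.1, ?_, ?_⟩
  · intro y hy
    obtain ⟨y1, h1, h2⟩ := List.mem_flatMap.1 hy
    obtain ⟨y2, h3, rfl⟩ := List.mem_map.1 h2
    exact (hf _ (h.2.1 y1 h1)).2.1 y2 h3
  · rw [h.2.2, List.flatMap, List.map_flatten, List.sum_flatten, List.map_map, List.map_map]
    refine congrArg List.sum (List.map_congr_left fun y hy => ?_)
    rw [(hf _ (h.2.1 y hy)).2.2, Function.comp_apply, Function.comp_apply, List.map_map,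
      List.smul_sum, List.map_map]
    refine congrArg List.sum (List.map_congr_left fun y' _ => ?_)
    simp [Coef.eval_mul hz hq ha, mul_smul]

/-- All rules are valid. -/
def Valid (q a : K) (P : Word OPiece → K) (R : OPiece → List Rule) : Prop :=
  ∀ g, ∀ r ∈ R g, Expands q a P r.src r.tgt r.lhs r.rhs

theorem Expands.apply {r : Rule} (hr : Expands q a P r.src r.tgt r.lhs r.rhs) {s t : List Dir}
    {w : Word OPiece} (hw : Tng w s t) {X : List (Coef × Word OPiece)}
    (h : r.apply s w = some X) : Expands q a P s t w X := by
  rcases w with _ | ⟨⟨i, g⟩, w'⟩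
  · simp [Rule.apply] at h
  rw [Rule.apply] at h
  split at h
  · simp at h
  rename_i j g' x' hlhs
  split_ifs at h with hc
  obtain ⟨⟨v, hv⟩, h1, r', hr'⟩ := hc
  set k := i - j
  have hs : s = s.take k ++ (r.src ++ r') := by rw [hr', List.take_append_drop]
  have hk : (s.take k).length = k := by simpa using h1
  rw [← hv, hs] at hw
  obtain ⟨t1, h2, h3⟩ := tng_append_iff.1 hw
  have h4 := hr.1.whisker (s.take k) r'
  rw [hk] at h4
  obtain rfl := h2.unique h4
  have h5 := hr.place (s.take k) r' [] v (by rw [← hs]; exact Tng.nil s) h3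
  rw [hk, List.nil_append, hv] at h5
  have h6 : ((i, g) :: w').drop r.lhs.length = v := by
    rw [← hv]; exact List.drop_left' (by simp [shift])
  rw [h6] at h
  obtain rfl := Option.some.inj h
  simpa using h5

theorem Expands.rewriteHead {s t : List Dir} {w : Word OPiece} (hw : Tng w s t) {R : List Rule}
    (hR : ∀ r ∈ R, Expands q a P r.src r.tgt r.lhs r.rhs) {X : List (Coef × Word OPiece)}
    (h : rewriteHead s w R = some X) : Expands q a P s t w X := by
  induction R with
  | nil => simp [Jaeger.rewriteHead] at h
  | cons r R ih =>
    rw [Jaeger.rewriteHead] at h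
    split at h
    · rename_i X' h'
      obtain rfl := Option.some.inj h
      exact (hR r (by simp)).apply hw h'
    · exact ih (fun r hr => hR r (by simp [hr])) h

theorem Valid.rewriteWord {R : OPiece → List Rule} (hR : Valid q a P R) {s t : List Dir}
    {w : Word OPiece} (hw : Tng w s t) {X : List (Coef × Word OPiece)}
    (h : rewriteWord R s w = some X) : Expands q a P s t w X := by
  induction w generalizing s X with
  | nil => simp [Jaeger.rewriteWord] at h
  | cons p w ih =>
    rw [Jaeger.rewriteWord] at h
    split at h
    · rename_i X' h'
      obtain rfl := Option.some.inj h
      exact Expands.rewriteHead hw (hR p.2) h'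
    · split at h
      · simp at h
      · rename_i s' hs'
        obtain ⟨s'', h1, h2⟩ := Option.bind_eq_some_iff.1 hw
        obtain rfl : s' = s'' := Option.some.inj (hs'.symm.trans h1)
        obtain ⟨Y, hY, rfl⟩ := Option.map_eq_some_iff.1 h
        have hp : Tng [p] s s' := by simp [Tng, run, hs']
        have := (ih h2 hY).place [] [] [p] [] (by simpa using hp) (by simpa using Tng.nil t)
        simpa [shift_zero] using this

/-- The result of any number of steps is a valid expansion. Neither termination nor confluence is
needed: missing a common normal form could only make a check fail. -/
theorem Valid.normalize {R : OPiece → List Rule} (hR : Valid q a P R) (hz : q - q⁻¹ ≠ 0)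
    (hq : q ≠ 0) (ha : a ≠ 0) (n : ℕ) {s t : List Dir} {w : Word OPiece} (hw : Tng w s t) :
    Expands q a P s t w (normalize R s n w) := by
  induction n generalizing w with
  | zero => exact Expands.refl hw
  | succ n ih =>
    rw [Jaeger.normalize]
    split
    · exact Expands.refl hw
    · rename_i X hX
      exact (hR.rewriteWord hw hX).trans hz hq ha _ fun y hy => ih hy

theorem Expands.of_smul {s t : List Dir} {x y : Word OPiece} {c : Coef} (hx : Tng x s t)
    (hy : Tng y s t) (h : br P s t x = c.eval q a • br P s t y) :
    Expands q a P s t x [(c, y)] := ⟨hx, by simpa using hy, by simpa using h⟩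

theorem Expands.of_eq {s t : List Dir} {x y : Word OPiece} (hx : Tng x s t)
    (hy : Tng y s t) (h : br P s t x = br P s t y) :
    Expands q a P s t x [(1, y)] := .of_smul hx hy (by simpa using h)

theorem Expands.of_add {s t : List Dir} {x y y' : Word OPiece} {c : Coef} (hx : Tng x s t)
    (hy : Tng y s t) (hy' : Tng y' s t) (h : br P s t x = br P s t y + c.eval q a • br P s t y') :
    Expands q a P s t x [(1, y), (c, y')] :=
  ⟨hx, by simp [hy, hy'], by simpa using h⟩

/-- Each rule is a relation of `OSkein` or a short consequence: pulling a strand over a minimum or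
maximum, a curl on a maximum, or the skein relation multiplied by a crossing. -/
theorem OSkein.valid {κ : Bool → Dir → K} {δ : Dir → K} (h : OSkein P (q - q⁻¹) κ δ)
    (hz : q - q⁻¹ ≠ 0) (hq : q ≠ 0) (ha : a ≠ 0)
    {κc : Bool → Dir → Coef} {δc : Dir → Coef} (hκ : ∀ e x, (κc e x).eval q a = κ e x)
    (hδ : ∀ x, (δc x).eval q a = δ x) : Valid q a P (rules (.term 1 1 0 0) κc δc) := by
  have hP := h.toIsotopy
  have hzc : (Coef.term 1 1 0 0).eval q a = q - q⁻¹ := by simp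
  have hzc' : (Coef.term (-1) 0 0 0 * Coef.term 1 1 0 0).eval q a = -(q - q⁻¹) := by
    rw [Coef.eval_mul hz hq ha, hzc]; simp
  have same : ∀ x : Dir, br P [x, x] [x, x] [(0, .cross false x x)] =
      br P [x, x] [x, x] [(0, .cross true x x)] + (-(q - q⁻¹)) • br P [x, x] [x, x] [] := by
    intro x
    have := skein_same hP h.skein x
    rw [neg_smul, ← this]; abel
  have opp : ∀ x : Dir, br P [x, x.op] [x.op, x] [(0, .cross false x x.op)] =
      br P [x, x.op] [x.op, x] [(0, .cross true x x.op)] +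
        (q - q⁻¹) • br P [x, x.op] [x.op, x] [(0, .cap x), (0, .cup x.op)] := by
    intro x
    cases x
    · have := skein_up_down hP h.skein
      rw [show Dir.up.op = Dir.down from rfl, ← this]; abel
    · have := skein_down_up hP h.skein
      rw [show Dir.down.op = Dir.up from rfl, ← this]; abel
  intro g r hr
  cases g with
  | cap x => simp [rules] at hr
  | cup x =>
    simp only [rules, List.cons_append, List.nil_append, List.mem_cons, List.mem_flatMap,
      List.not_mem_nil, or_false, exists_eq_or_imp, exists_eq_left] at hr
    have slide : ∀ y : Dir, Expands q a P [y] [x, y, x.op]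
        [(0, .cup x), (1, .cross true x.op y)] [(1, [(1, .cup x), (0, .cross false y x)])] :=
      fun y => .of_eq (by cases x <;> cases y <;> rfl) (by cases x <;> cases y <;> rfl)
        (hP.slide_cup true x y)
    have under : ∀ y : Dir, Expands q a P [y] [x, x.op, y]
        [(1, .cup x), (0, .cross true y x), (1, .cross true y x.op)] [(1, [(0, .cup x)])] :=
      fun y => .of_eq (by cases x <;> cases y <;> rfl) (by cases x <;> cases y <;> rfl)
        (hP.over_cup y x)
    rcases hr with rfl | rfl | rfl | rfl | rfl | (rfl | rfl) | rfl | rfl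
    · exact .of_smul (by cases x <;> rfl) rfl (by rw [hδ]; exact h.loop x)
    · refine .of_eq (by cases x <;> rfl) rfl ?_
      have := hP.zigzag_left x.op
      rwa [show op x.op = x from dir_op_op x] at this
    · exact .of_eq (by cases x <;> rfl) rfl (hP.zigzag_right x)
    · exact .of_smul (by cases x <;> rfl) (by cases x <;> rfl) (by rw [hκ]; exact h.curl true x)
    · exact .of_smul (by cases x <;> rfl) rfl (by
        rw [hκ]; exact hP.curl_right (e := true) (h.curl false x))
    · exact slide .up
    · exact under .up
    · exact slide .down
    · exact under .down
  | cross e x y =>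
    cases e
    · simp only [rules, List.mem_singleton] at hr
      subst hr
      by_cases hxy : x = y
      · subst hxy
        simp only [if_true]
        exact .of_add (by cases x <;> rfl) (by cases x <;> rfl) rfl (by rw [hzc']; exact same x)
      · obtain rfl : y = x.op := by revert hxy; cases x <;> cases y <;> simp [Dir.op]
        simp only [hxy, if_false]
        exact .of_add (by cases x <;> rfl) (by cases x <;> rfl) (by cases x <;> rfl)
          (by rw [hzc]; exact opp x)
    · simp only [rules, List.mem_append, List.mem_cons, List.mem_map, List.not_mem_nil, or_false,
        exists_eq_or_imp, exists_eq_left] at hr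
      rcases hr with (hr | rfl | rfl) | hr
      · by_cases hxy : x = y
        · subst hxy
          simp only [if_true, List.mem_singleton] at hr
          subst hr
          refine .of_add (by cases x <;> rfl) rfl (by cases x <;> rfl) ?_
          -- The skein relation is preceded by `cross true`; the product of opposite crossings then
          -- disappears by the second move.
          have h1 := congrArg (ext K [x, x] [x, x] [] [] [(0, .cross true x x)] []) (same x)
          have hu : Tng [(0, OPiece.cross true x x)] [x, x] ([] ++ ([x, x] ++ [])) := by
            cases x <;> rfl
          have hv : Tng ([] : Word OPiece) ([] ++ ([x, x] ++ [])) [x, x] := rfl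
          rw [map_add, map_smul, ext_br _ hu hv, ext_br _ hu hv, ext_br _ hu hv] at h1
          have h2 : br P [x, x] [x, x] [(0, .cross true x x), (0, .cross false x x)] = _ :=
            hP.r2 true x x
          simp only [shift, List.map_cons, List.map_nil, List.length_nil, Nat.add_zero,
            List.append_nil, List.cons_append, List.nil_append] at h1
          rw [hzc, ← h2, h1, neg_smul]
          abel
        · obtain rfl : y = x.op := by revert hxy; cases x <;> cases y <;> simp [Dir.op]
          simp only [hxy, if_false, List.mem_cons, List.not_mem_nil, or_false] at hr
          rcases hr with rfl | rfl
          · refine .of_add (by cases x <;> rfl) rfl (by cases x <;> rfl) ?_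
            have h1 := congrArg (ext K [x, x.op] [x, x.op] [] [] [(0, .cross true x x.op)] [])
              (opp x.op)
            rw [dir_op_op] at h1
            have hu : Tng [(0, OPiece.cross true x x.op)] [x, x.op] ([] ++ ([x.op, x] ++ [])) := by
              cases x <;> rfl
            have hv : Tng ([] : Word OPiece) ([] ++ ([x, x.op] ++ [])) [x, x.op] := rfl
            rw [map_add, map_smul, ext_br _ hu hv, ext_br _ hu hv, ext_br _ hu hv] at h1
            have h2 : br P [x, x.op] [x, x.op]
              [(0, .cross true x x.op), (0, .cross false x.op x)] = _ := hP.r2 true x x.op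
            simp only [shift, List.map_cons, List.map_nil, List.length_nil, Nat.add_zero,
              List.append_nil, List.cons_append, List.nil_append] at h1
            rw [hzc', ← h2, h1, neg_smul]
            abel
          · exact .of_smul (by cases x <;> rfl) (by cases x <;> rfl) (by
              rw [hκ]; exact hP.capCurl (h.curl true x.op))
      · refine .of_eq (by cases x <;> cases y <;> rfl) (by cases x <;> cases y <;> rfl) ?_
        have := hP.slide_cap true y.op x
        rwa [show op y.op = y from dir_op_op y] at this
      · refine .of_eq (by cases x <;> cases y <;> rfl) (by cases x <;> cases y <;> rfl) ?_
        have e1 := br_pre (hP.slide_cap false x.op y) (s' := [x.op, x, y]) [(1, cross true x y)]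
          (by cases x <;> cases y <;> rfl)
        have e2 := br_congr (hP.r2 true x y) [x.op] [] [] [(0, .cap x.op)]
          (s' := [x.op, x, y]) (t' := [y]) (by cases x <;> cases y <;> rfl)
          (by cases x <;> cases y <;> rfl)
        rw [show op x.op = x from dir_op_op x] at e1
        exact e1.symm.trans e2
      · have third : ∀ w : Dir, Expands q a P [x, y, w] [w, y, x]
            [(0, .cross true x y), (1, .cross true x w), (0, .cross true y w)]
            [(1, [(1, .cross true y w), (0, .cross true x w), (1, .cross true x y)])] :=
          fun w => .of_eq (by cases x <;> cases y <;> cases w <;> rfl)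
            (by cases x <;> cases y <;> cases w <;> rfl) (h.r3 true x y w)
        rcases hr with rfl | rfl
        · exact third .up
        · exact third .down

end soundness

end Jaeger

/-! ### Verification of relations between state sums by computation. -/

namespace Jaeger
open PieceSys Reversal CrossSys

/-- A state with symbolic weight as a state with weight in `K`. -/
def PieceState.eval {K : Type*} [Field K] (q a : K) {B : Type} (s : PieceState Coef B) :
    PieceState K B := ⟨s.bot, s.top, s.weight.eval q a, s.word⟩

namespace StateModel
variable {K : Type*} [Field K] {q a : K} {G L B : Type} [PieceSys G L] [DecidableEq L]
  [DecidableEq B]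

/-- A state model with symbolic weights as a state model with weights in `K`. -/
def eval (m : StateModel Coef G L B) (q a : K) : StateModel K G L B where
  und := m.und
  red := m.red
  tab g := (m.tab g).map (PieceState.eval q a)
  bot_eq g s hs := by
    obtain ⟨s, hs', rfl⟩ := List.mem_map.1 hs
    exact m.bot_eq g s hs'
  top_eq g s hs := by
    obtain ⟨s, hs', rfl⟩ := List.mem_map.1 hs
    exact m.top_eq g s hs'
  tng g s hs := by
    obtain ⟨s, hs', rfl⟩ := List.mem_map.1 hs
    exact m.tng g s hs'

theorem runs_eval (m : StateModel Coef G L B) (hz : q - q⁻¹ ≠ 0) (hq : q ≠ 0) (ha : a ≠ 0)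
    (x : Word G) (b : List B) :
    (m.eval q a).runs x b = (m.runs x b).map fun p => (p.1.eval q a, p.2) := by
  induction x generalizing b with
  | nil => simp [runs]
  | cons p x ih =>
    obtain ⟨i, g⟩ := p
    rw [runs, runs, eval, List.flatMap_map, List.map_flatMap]
    refine List.flatMap_congr fun s _ => ?_
    simp only [PieceState.eval]
    split_ifs
    · have := ih (b.take i ++ (s.top ++ b.drop (i + s.bot.length)))
      rw [eval] at this
      rw [this, List.map_map, List.map_map]
      refine List.map_congr_left fun p _ => ?_
      simp [Coef.eval_mul hz hq ha]
    · rfl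

/-- All lists of labels that belong to a given list. -/
def lifts (fib : L → List B) : List L → List (List B)
  | [] => [[]]
  | x :: s => (fib x).flatMap fun y => (lifts fib s).map fun b => y :: b

theorem mem_lifts {m : StateModel K G L B} {fib : L → List B} (hf : ∀ y, y ∈ fib (m.und y))
    (b : List B) : b ∈ lifts fib (b.map m.und) := by
  induction b with
  | nil => simp [lifts]
  | cons y b ih =>
    simp only [List.map_cons, lifts, List.mem_flatMap, List.mem_map]
    exact ⟨y, hf y, b, ih, rfl⟩

/-- The terms of the local value of a linear combination of words. -/
def terms (m : StateModel Coef G L B) (R : OPiece → List Rule) (n : ℕ) (b : List B)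
    (X : List (Coef × Word G)) : List (ℤ × (ℤ × ℤ × ℤ) × (List B × Word OPiece)) :=
  X.flatMap fun x => (m.runs x.2 b).flatMap fun p =>
    (normalize R (b.filterMap m.red) n p.2.2).flatMap fun y =>
      List.map (fun t => (t.1, t.2, (p.2.1, y.2))) (x.1 * (p.1 * y.1))

/-- Decides whether a linear combination of words has local values `0`. -/
def checks (m : StateModel Coef G L B) (R : OPiece → List Rule) (fib : L → List B) (n : ℕ)
    (s : List L) (X : List (Coef × Word G)) : Bool :=
  (lifts fib s).all fun b => vanishes (m.terms R n b X)

/-- The check treats `q`, `a` and the values on oriented tangles as unknowns, so one computation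
covers all fields, all parameters and all surroundings. -/
theorem br_of_checks {P : Word OPiece → K} (hz : q - q⁻¹ ≠ 0) (hq : q ≠ 0) (ha : a ≠ 0)
    (m : StateModel Coef G L B) {R : OPiece → List Rule} (hR : Valid q a P R) {fib : L → List B}
    (hf : ∀ y, y ∈ fib (m.und y)) (n : ℕ) {s t : List L} (X : List (Coef × Word G))
    (hX : ∀ x ∈ X, Tng x.2 s t) (h : m.checks R fib n s X = true) :
    (X.map fun x => x.1.eval q a • br ((m.eval q a).value P) s t x.2).sum = 0 := by
  have := br_value_relation (m := m.eval q a) (P := P) (s := s) (t := t)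
    (X.map fun x => (x.1.eval q a, x.2)) (fun x hx => by
      obtain ⟨x', hx', rfl⟩ := List.mem_map.1 hx
      exact hX x' hx') ?_
  · simpa [List.map_map, Function.comp_def] using this
  · intro b hb Θ
    have h1 := List.all_eq_true.1 h b (by rw [← hb]; exact mem_lifts (m := m.eval q a) hf b)
    -- The unknowns are indexed by the top labels of a state and by its normalized remaining word.
    have h2 := eq_zero_of_vanishes (a := a) hq hz
      (fun y : List B × Word OPiece =>
        Θ y.1 (br P (b.filterMap m.red) (y.1.filterMap m.red) y.2)) h1
    rw [← h2, terms, sum_map_flatMap, List.map_map]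
    refine congrArg List.sum (List.map_congr_left fun x hx => ?_)
    rw [sum_map_flatMap, Function.comp_apply, localValue, runs_eval m hz hq ha, List.map_map,
      ← List.sum_map_mul_left]
    refine congrArg List.sum (List.map_congr_left fun p hp => ?_)
    have h3 := (hR.normalize hz hq ha n (runs_spec hp).2).2.2
    simp only [Function.comp_apply, eval] at h3 ⊢
    rw [h3, sum_map_flatMap, map_list_sum, List.map_map, ← List.sum_map_mul_left,
      ← List.sum_map_mul_left]
    refine congrArg List.sum (List.map_congr_left fun y _ => ?_)
    have h4 : ((x.1 * (p.1 * y.1) : Coef).eval q a) *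
        Θ p.2.1 (br P (b.filterMap m.red) (p.2.1.filterMap m.red) y.2) =
        (List.map (fun t => ((t.1 : ℤ) : K) * ((q - q⁻¹) ^ t.2.1.1 * q ^ t.2.1.2.1 *
          a ^ t.2.1.2.2 * Θ t.2.2.1 (br P (b.filterMap m.red)
            (t.2.2.1.filterMap m.red) t.2.2.2)))
          (List.map (fun t => (t.1, t.2, (p.2.1, y.2))) (x.1 * (p.1 * y.1) : Coef))).sum := by
      rw [Coef.eval, ← List.sum_map_mul_right, List.map_map]
      refine congrArg List.sum (List.map_congr_left fun t _ => ?_)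
      simp only [Coef.termValue, Function.comp_apply]
      ring
    rw [← h4, Coef.eval_mul hz hq ha, Coef.eval_mul hz hq ha]
    simp only [Function.comp_apply, map_smul, smul_eq_mul]
    ring

theorem br_eq_of_checks {P : Word OPiece → K} (hz : q - q⁻¹ ≠ 0) (hq : q ≠ 0) (ha : a ≠ 0)
    (m : StateModel Coef G L B) {R : OPiece → List Rule} (hR : Valid q a P R) {fib : L → List B}
    (hf : ∀ y, y ∈ fib (m.und y)) (n : ℕ) {s t : List L} {x y : Word G} (c : Coef)
    (hx : Tng x s t) (hy : Tng y s t)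
    (h : m.checks R fib n s [(.term (-1) 0 0 0, x), (c, y)] = true) :
    br ((m.eval q a).value P) s t x = c.eval q a • br ((m.eval q a).value P) s t y := by
  have := br_of_checks hz hq ha m hR hf n _ (by simpa using ⟨hx, hy⟩) h
  simpa [neg_add_eq_zero] using this

end StateModel

end Jaeger

namespace Jaeger
open PieceSys Reversal CrossSys

/-! ### Normalization by the rotation number -/

section twist
variable {K : Type*} [Field K] {q a : K}

theorem rot_append (u v : Word OPiece) : rot (u ++ v) = rot u + rot v := by simp [rot]

theorem rot_shift (k : ℕ) (u : Word OPiece) : rot (shift k u) = rot u := by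
  simp [rot, shift, Function.comp_def]

/-- The value of `P`, multiplied by a power of `a` that depends on the rotation number. -/
noncomputable def twist (a : K) (P : Word OPiece → K) (w : Word OPiece) : K :=
  a ^ (-rot w) * P w

/-- The effect of the surroundings on the normalization. -/
noncomputable def twistMap (a : K) : (Ctx OPiece Dir → K) →ₗ[K] (Ctx OPiece Dir → K) where
  toFun h c := a ^ (-(rot c.2.2.1 + rot c.2.2.2)) * h c
  map_add' h h' := by funext c; simp [mul_add]
  map_smul' b h := by funext c; simp [mul_left_comm]

/-- The rotation number is additive over pieces, so the normalization splits into a constant for the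
tangle and a linear map for the surroundings. -/
theorem br_twist (ha : a ≠ 0) (P : Word OPiece → K) (s t : List Dir) (x : Word OPiece) :
    br (twist a P) s t x = a ^ (-rot x) • twistMap a (br P s t x) := by
  funext c
  by_cases hc : c.Fits s t
  · simp only [br_of_fits _ _ hc, Pi.smul_apply, twistMap, LinearMap.coe_mk, AddHom.coe_mk, twist,
      Ctx.fill, rot_append, rot_shift, smul_eq_mul]
    rw [← mul_assoc, ← zpow_add₀ ha]
    congr 2
    ring
  · simp [br_of_not_fits _ _ hc, twistMap]

theorem br_twist_eq (ha : a ≠ 0) {P : Word OPiece → K} {s t : List Dir} {x y : Word OPiece}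
    (hr : rot x = rot y) (h : br P s t x = br P s t y) :
    br (twist a P) s t x = br (twist a P) s t y := by
  rw [br_twist ha, br_twist ha, h, hr]

theorem br_twist_eq_smul (ha : a ≠ 0) {P : Word OPiece → K} {s t : List Dir} {x y : Word OPiece}
    {κ : K} (h : br P s t x = κ • br P s t y) :
    br (twist a P) s t x = (κ * a ^ (rot y - rot x)) • br (twist a P) s t y := by
  rw [br_twist ha, br_twist ha, h, map_smul, smul_smul, smul_smul]
  have : a ^ (rot y - rot x) * a ^ (-rot y) = a ^ (-rot x) := by
    rw [← zpow_add₀ ha]; congr 1; ring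
  rw [← this]
  congr 1
  ring

/-- Isotopies and the smoothing of two upward strands preserve the rotation number, so these
relations survive unchanged. Removing a curl or a circle changes it, and only `κ` and `δ` acquire
powers of `a`. -/
theorem OSkein.twist {P : Word OPiece → K} {z : K} {κ : Bool → Dir → K} {δ : Dir → K}
    (h : OSkein P z κ δ) (ha : a ≠ 0) :
    OSkein (twist a P) z (fun e x => κ e x * a ^ (rot [(0, .cup x.op)] - rot [(0, .cup x)]))
      (fun x => δ x * a ^ (-rot [(0, .cup x), (0, .cap x)])) where
  exchange g g' m := br_twist_eq ha (by simp [rot, add_comm]) (h.exchange g g' m)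
  zigzag_left s := br_twist_eq ha (by cases s <;> rfl) (h.zigzag_left s)
  zigzag_right s := br_twist_eq ha (by cases s <;> rfl) (h.zigzag_right s)
  slide_cap e x y := br_twist_eq ha (by cases x <;> rfl) (h.slide_cap e x y)
  slide_cup e x y := br_twist_eq ha (by cases x <;> rfl) (h.slide_cup e x y)
  r2 e x y := br_twist_eq ha rfl (h.r2 e x y)
  r3 e x y w := br_twist_eq ha rfl (h.r3 e x y w)
  skein := by
    have := congrArg (twistMap a) h.skein
    rw [map_sub, map_smul] at this
    simp only [br_twist ha]
    simpa [rot, OPiece.rot] using this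
  curl e x := by
    have := br_twist_eq_smul ha (h.curl e x)
    cases x <;> exact this
  loop x := by
    have := br_twist_eq_smul ha (h.loop x)
    cases x <;> exact this

end twist

/-! ### The relations between unoriented diagrams -/

/-- `P` satisfies the skein relations of the Kauffman polynomial with parameter `z`; a curl of a
minimum contributes the factor `κ`, a circle the factor `δ`. -/
structure USkein {M R : Type*} [AddCommGroup M] [CommRing R] [Module R M] (P : Word Piece → M)
    (z κ δ : R) : Prop extends Isotopy P where
  r3 : ThirdMove P true true true () () ()
  skein : br P [(), ()] [(), ()] [(0, .cross true)] - br P [(), ()] [(), ()] [(0, .cross false)] =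
    z • (br P [(), ()] [(), ()] [] - br P [(), ()] [(), ()] [(0, .cap), (0, .cup)])
  curl : CupCurl P true () κ
  loop : br P [] [] [(0, .cup), (0, .cap)] = δ • br P [] [] []

/-! ### The state sum -/

open Coef in
/-- The local states of the `B_n` assignment. -/
def jaegerStates : Piece → List (PieceState Coef (Option Dir))
  | .cup =>
    [⟨[], [some .up, some .down], 1, [(0, .cup .up)]⟩,
     ⟨[], [some .down, some .up], 1, [(0, .cup .down)]⟩,
     ⟨[], [none, none], 1, []⟩]
  | .cap =>
    [⟨[some .up, some .down], [], 1, [(0, .cap .up)]⟩,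
     ⟨[some .down, some .up], [], 1, [(0, .cap .down)]⟩,
     ⟨[none, none], [], 1, []⟩]
  | .cross true =>
    [⟨[some .down, some .up], [some .down, some .up], term 1 1 0 0, []⟩,
     ⟨[none, some .up], [none, some .up], term 1 1 0 0, []⟩,
     ⟨[some .down, none], [some .down, none], term 1 1 0 0, []⟩,
     ⟨[some .down, some .up], [some .down, some .up], term (-1) 1 0 0,
        [(0, .cap .down), (0, .cup .down)]⟩,
     ⟨[some .down, some .up], [none, none], term (-1) 1 0 0, [(0, .cap .down)]⟩,
     ⟨[none, none], [some .down, some .up], term (-1) 1 0 0, [(0, .cup .down)]⟩] ++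
      jaegerCrossings true
  | .cross false =>
    [⟨[some .up, some .down], [some .up, some .down], term 1 1 0 0,
        [(0, .cap .up), (0, .cup .up)]⟩,
     ⟨[none, none], [some .up, some .down], term 1 1 0 0, [(0, .cup .up)]⟩,
     ⟨[some .up, some .down], [none, none], term 1 1 0 0, [(0, .cap .up)]⟩,
     ⟨[some .up, some .down], [some .up, some .down], term (-1) 1 0 0, []⟩,
     ⟨[some .up, none], [some .up, none], term (-1) 1 0 0, []⟩,
     ⟨[none, some .down], [none, some .down], term (-1) 1 0 0, []⟩] ++
      jaegerCrossings false
where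
  /-- The states in which the strands cross. -/
  jaegerCrossings (e : Bool) : List (PieceState Coef (Option Dir)) :=
    [⟨[none, none], [none, none], 1, []⟩,
     ⟨[some .up, some .up], [some .up, some .up], 1, [(0, .cross e .up .up)]⟩,
     ⟨[some .down, some .down], [some .down, some .down], 1, [(0, .cross e .down .down)]⟩,
     ⟨[some .up, some .down], [some .down, some .up], 1, [(0, .cross e .up .down)]⟩,
     ⟨[some .down, some .up], [some .up, some .down], 1, [(0, .cross e .down .up)]⟩,
     ⟨[some .up, none], [none, some .up], term (-1) 0 0 0, []⟩,
     ⟨[none, some .up], [some .up, none], term (-1) 0 0 0, []⟩,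
     ⟨[some .down, none], [none, some .down], term (-1) 0 0 0, []⟩,
     ⟨[none, some .down], [some .down, none], term (-1) 0 0 0, []⟩]

/-- The `B_n` assignment as a state model. -/
def jaegerModel : StateModel Coef Piece Unit (Option Dir) where
  und _ := ()
  red := id
  tab := jaegerStates
  bot_eq g := by
    rcases g with _ | _ | _ | _ <;> simp [jaegerStates, jaegerStates.jaegerCrossings] <;> decide
  top_eq g := by
    rcases g with _ | _ | _ | _ <;> simp [jaegerStates, jaegerStates.jaegerCrossings] <;> decide
  tng g := by
    rcases g with _ | _ | _ | _ <;> simp [jaegerStates, jaegerStates.jaegerCrossings] <;>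
      simp [Tng, run, step, opiece_bot, opiece_top, OPiece.bot, OPiece.top, Dir.op]

theorem localStates_eq {K : Type*} [Field K] (q a : K) (g : Piece) :
    localStates q g =
      ((jaegerModel.eval q a).tab g).map fun s => ⟨s.bot, s.top, s.weight, s.word⟩ := by
  rcases g with _ | _ | _ | _ <;>
  simp [localStates, jaegerModel, StateModel.eval, jaegerStates, jaegerStates.jaegerCrossings,
    PieceState.eval]

theorem states_eq_total {K : Type*} [Field K] (q a : K) (w : Word Piece) (t : List (Option Dir)) :
    states q w t = (jaegerModel.eval q a).total w t := by
  induction w generalizing t with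
  | nil => rfl
  | cons p w ih =>
    obtain ⟨i, g⟩ := p
    rw [states, StateModel.total, localStates_eq q a, List.flatMap_map]
    refine List.flatMap_congr fun s _ => ?_
    simp only [ih, List.append_assoc]
    rfl

/-- `stateSum` carries proofs that its oriented diagrams are coherent; here it is identified with
the proof-free state sum to which the general theory applies. -/
theorem stateSum_eq {K : Type*} [Field K] (a q : K) (P : ODiagram → K) (D : Diagram) :
    stateSum a q P D = (jaegerModel.eval q a).value (twist a (oval P)) D.word := by
  rw [stateSum, StateModel.value, ← states_eq_total]
  conv_rhs => rw [← List.attach_map_subtype_val (states q D.word []), List.map_map]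
  refine congrArg List.sum (List.map_congr_left fun σ _ => ?_)
  rw [Function.comp_apply, twist, oval_eq P (states_isOTangle q D.word [] σ.1 σ.2)]

end Jaeger

/-! ### The state sum satisfies the Kauffman relations. -/

namespace Jaeger
open PieceSys Reversal CrossSys

open Coef in
/-- Curl factors for the normalized HOMFLY-PT polynomial. -/
def jaegerCurl : Bool → Dir → Coef
  | true, .up => 1
  | true, .down => term 1 0 0 (-2)
  | false, .up => term 1 0 0 2
  | false, .down => 1

/-- Circle factors for the normalized HOMFLY-PT polynomial. -/
def jaegerLoop : Dir → Coef
  | .up => [(1, -1, 0, 2), (-1, -1, 0, 0)]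
  | .down => [(1, -1, 0, 0), (-1, -1, 0, -2)]

/-- The rewriting rules for the normalized HOMFLY-PT polynomial. -/
def jaegerRules : OPiece → List Rule := rules (.term 1 1 0 0) jaegerCurl jaegerLoop

/-- The labels of the strands of a state. -/
def jaegerLabels (_ : Unit) : List (Option Dir) := [none, some .up, some .down]

section
variable {K : Type*} [Field K] {q a : K}

theorem jaeger_valid (hz : q - q⁻¹ ≠ 0) (hq : q ≠ 0) (ha : a ≠ 0) {P : ODiagram → K}
    (h : IsHomfly a q P) : Valid q a (twist a (oval P)) jaegerRules := by
  refine ((h.oskein hz).twist ha).valid hz hq ha (fun e x => ?_) fun x => ?_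
  · cases e <;> cases x <;>
      simp [jaegerCurl, curlFactor, rot, OPiece.rot, Dir.op, ha] <;> field_simp
  · cases x <;>
      simp [jaegerLoop, Coef.eval, Coef.termValue, rot, OPiece.rot] <;>
      field_simp <;> ring

theorem jaeger_br (hz : q - q⁻¹ ≠ 0) (hq : q ≠ 0) (ha : a ≠ 0) {P : ODiagram → K}
    (h : IsHomfly a q P) {s t : List Unit} {x y : Word Piece} (c : Coef) (hx : Tng x s t)
    (hy : Tng y s t) (hc : jaegerModel.checks jaegerRules jaegerLabels 40 s
      [(.term (-1) 0 0 0, x), (c, y)] = true) :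
    br ((jaegerModel.eval q a).value (twist a (oval P))) s t x =
      c.eval q a • br ((jaegerModel.eval q a).value (twist a (oval P))) s t y :=
  StateModel.br_eq_of_checks hz hq ha jaegerModel (jaeger_valid hz hq ha h)
    (fun y => by rcases y with _ | _ | _ <;> simp [jaegerLabels]) 40 c hx hy hc

theorem jaeger_br_eq (hz : q - q⁻¹ ≠ 0) (hq : q ≠ 0) (ha : a ≠ 0) {P : ODiagram → K}
    (h : IsHomfly a q P) {s t : List Unit} {x y : Word Piece} (hx : Tng x s t)
    (hy : Tng y s t) (hc : jaegerModel.checks jaegerRules jaegerLabels 40 s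
      [(.term (-1) 0 0 0, x), (1, y)] = true) :
    br ((jaegerModel.eval q a).value (twist a (oval P))) s t x =
      br ((jaegerModel.eval q a).value (twist a (oval P))) s t y := by
  rw [jaeger_br hz hq ha h 1 hx hy hc, Coef.eval_one, one_smul]

/-- The heart of the theorem: for each relation, the contributions of the states with given outer
labels cancel modulo the normalized HOMFLY-PT relations. The factor `a ^ (-2)` is `A⁻¹ * q` for `A =
a ^ 2 * q`. -/
theorem jaeger_uskein (hz : q - q⁻¹ ≠ 0) (hq : q ≠ 0) (ha : a ≠ 0) {P : ODiagram → K}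
    (h : IsHomfly a q P) :
    USkein ((jaegerModel.eval q a).value (twist a (oval P))) (q - q⁻¹) (a ^ (-2 : ℤ))
      ((a ^ (2 : ℤ) - a ^ (-2 : ℤ)) / (q - q⁻¹) + 1) where
  exchange := StateModel.br_value_exchange ((h.oskein hz).twist ha).toIsotopy
  zigzag_left := fun () => jaeger_br_eq hz hq ha h rfl rfl (by decide +kernel)
  zigzag_right := fun () => jaeger_br_eq hz hq ha h rfl rfl (by decide +kernel)
  slide_cap := fun e () () => by
    cases e <;> exact jaeger_br_eq hz hq ha h rfl rfl (by decide +kernel)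
  slide_cup := fun e () () => by
    cases e <;> exact jaeger_br_eq hz hq ha h rfl rfl (by decide +kernel)
  r2 := fun e () () => by
    cases e <;> exact jaeger_br_eq hz hq ha h rfl rfl (by decide +kernel)
  r3 := jaeger_br_eq hz hq ha h rfl rfl (by decide +kernel)
  skein := by
    have := StateModel.br_of_checks hz hq ha jaegerModel (jaeger_valid hz hq ha h)
      (fib := jaegerLabels) (fun y => by rcases y with _ | _ | _ <;> simp [jaegerLabels]) 40
      (s := [(), ()]) (t := [(), ()])
      [(1, [(0, .cross true)]), (.term (-1) 0 0 0, [(0, .cross false)]), (.term (-1) 1 0 0, []),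
        (.term 1 1 0 0, [(0, .cap), (0, .cup)])]
      (by simpa using ⟨rfl, rfl, rfl, rfl⟩) (by decide +kernel)
    rw [← sub_eq_zero, ← this]
    simp only [List.map_cons, List.map_nil, List.sum_cons, List.sum_nil, Coef.eval_one,
      Coef.eval_term]
    simp only [Int.cast_one, Int.cast_neg, zpow_one, zpow_zero, mul_one, one_mul]
    module
  curl := by
    have := jaeger_br hz hq ha h (s := []) (t := [(), ()]) (x := [(0, .cup), (0, .cross true)])
      (y := [(0, .cup)]) (.term 1 0 0 (-2)) rfl rfl (by decide +kernel)
    rw [CupCurl, show a ^ (-2 : ℤ) = Coef.eval q a (.term 1 0 0 (-2)) by simp]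
    exact this
  -- The two orientations of the circle contribute `(a ^ 2 - 1) / z` and `(1 - a ^ (-2)) / z`, and
  -- the dashed circle contributes `1`.
  loop := by
    have := jaeger_br hz hq ha h (s := []) (t := []) (x := [(0, .cup), (0, .cap)])
      (y := []) [(1, -1, 0, 2), (-1, -1, 0, -2), (1, 0, 0, 0)] rfl rfl (by decide +kernel)
    rw [this]
    congr 1
    simp [Coef.eval, Coef.termValue]
    field_simp
    ring

end

end Jaeger

namespace Jaeger
open PieceSys Reversal CrossSys

/-! ### Families of functions with the same relations -/

section pi
variable {ι R : Type*} {M : ι → Type*} [CommRing R] [∀ i, AddCommGroup (M i)] [∀ i, Module R (M i)]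

/-- Brackets are computed componentwise. Hence solutions of the same relations form one solution in
the product, and `Reducible.exists_smul` gives a scalar common to all of them. -/
theorem br_pi {G L : Type} [PieceSys G L] [DecidableEq L] (P : ∀ i, Word G → M i) (s t : List L)
    (x : Word G) : br (fun w i => P i w) s t x = fun c i => br (P i) s t x c := by
  funext c i
  by_cases hc : c.Fits s t
  · rw [br_of_fits _ _ hc, br_of_fits _ _ hc]
  · rw [br_of_not_fits _ _ hc, br_of_not_fits _ _ hc]; rfl

theorem Isotopy.pi {G L : Type} [CrossSys G L] [DecidableEq L] {P : ∀ i, Word G → M i}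
    (h : ∀ i, Isotopy (P i)) : Isotopy (fun w i => P i w) where
  exchange g g' m := by simp only [br_pi, (h _).exchange g g' m]
  zigzag_left s := by simp only [br_pi, (h _).zigzag_left s]
  zigzag_right s := by simp only [br_pi, (h _).zigzag_right s]
  slide_cap e x y := by simp only [br_pi, (h _).slide_cap e x y]
  slide_cup e x y := by simp only [br_pi, (h _).slide_cup e x y]
  r2 e x y := by simp only [br_pi, (h _).r2 e x y]

theorem OSkein.pi {P : ∀ i, Word OPiece → M i} {z : R} {κ : Bool → Dir → R} {δ : Dir → R}
    (h : ∀ i, OSkein (P i) z κ δ) : OSkein (fun w i => P i w) z κ δ where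
  toIsotopy := .pi fun i => (h i).toIsotopy
  r3 e x y w := by
    have := fun i => (h i).r3 e x y w
    simp only [ThirdMove] at this ⊢
    simp only [br_pi, this]
  skein := by
    have := fun i => (h i).skein
    simp only [br_pi]
    funext c i
    exact congrFun (this i) c
  curl e x := by
    have := fun i => (h i).curl e x
    simp only [CupCurl] at this ⊢
    simp only [br_pi]
    funext c i
    exact congrFun (this i) c
  loop x := by
    have := fun i => (h i).loop x
    simp only [br_pi]
    funext c i
    exact congrFun (this i) c

theorem USkein.pi {P : ∀ i, Word Piece → M i} {z κ δ : R} (h : ∀ i, USkein (P i) z κ δ) :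
    USkein (fun w i => P i w) z κ δ where
  toIsotopy := .pi fun i => (h i).toIsotopy
  r3 := by
    have := fun i => (h i).r3
    simp only [ThirdMove] at this ⊢
    simp only [br_pi, this]
  skein := by
    have := fun i => (h i).skein
    simp only [br_pi]
    funext c i
    exact congrFun (this i) c
  curl := by
    have := fun i => (h i).curl
    simp only [CupCurl] at this ⊢
    simp only [br_pi]
    funext c i
    exact congrFun (this i) c
  loop := by
    have := fun i => (h i).loop
    simp only [br_pi]
    funext c i
    exact congrFun (this i) c

end pi

/-! ### Unoriented diagrams -/

section unoriented
variable {K M : Type*} [Field K] [AddCommGroup M] [Module K M]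

/-- Adding the opposite crossing to the curl cancels its crossing by the second move, so `κ` times
the opposite curl is the plain minimum. -/
theorem CupCurl.inv {P : Word Piece → M} (hP : Isotopy P) {e : Bool} {κ : K} (hκ : κ ≠ 0)
    (h : CupCurl P e () κ) : CupCurl P (!e) () κ⁻¹ := by
  have h1 := congrArg (ext K [] [(), ()] [] [] [] [(0, .cross !e)]) h
  have hu : Tng ([] : Word Piece) [] ([] ++ ([] ++ [])) := rfl
  have hv : Tng [(0, Piece.cross !e)] ([] ++ ([(), ()] ++ [])) [(), ()] := rfl
  have e1 := ext_br (R := K) P hu hv [(0, cup ()), (0, cross e () ())]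
  have e2 := ext_br (R := K) P hu hv [(0, cup ())]
  rw [map_smul, show ext K [] [(), ()] [] [] [] [(0, Piece.cross !e)] (br P [] [op (), ()]
    [(0, cup ()), (0, cross e () (op ()))]) = _ from e1, show ext K [] [(), ()] [] [] []
    [(0, Piece.cross !e)] (br P [] [op (), ()] [(0, cup (op ()))]) = _ from e2] at h1
  have h2 := br_pre (hP.r2 e () ()) (s' := []) [(0, .cup)] rfl
  have h3 : κ • br P [] [(), ()] [(0, .cup), (0, .cross !e)] = br P [] [(), ()] [(0, .cup)] :=
    h1.symm.trans h2
  have : br P [] [(), ()] [(0, .cup), (0, .cross !e)] = κ⁻¹ • br P [] [(), ()] [(0, .cup)] := by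
    rw [← h3, smul_smul, inv_mul_cancel₀ hκ, one_smul]
  exact this

theorem USkein.reducible {P : Word Piece → M} {z κ δ : K} (h : USkein P z κ δ) (hκ : κ ≠ 0) :
    Reducible K P where
  toIsotopy := h.toIsotopy
  exhaust := piece_exhaust
  r3 := fun () () () => h.r3
  switch := fun () () => ⟨z, -z, fun h => absurd rfl h, fun h => absurd rfl h, by
    rw [neg_smul, ← sub_eq_add_neg, ← smul_sub]; exact h.skein⟩
  curl e := fun () => by
    cases e
    · exact ⟨_, h.curl.inv h.toIsotopy hκ⟩
    · exact ⟨_, h.curl⟩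
  loop := fun () => ⟨_, h.loop⟩

open Classical in
/-- A function on diagrams as a function on words. -/
noncomputable def uval {M : Type*} [Zero M] (F : Diagram → M) (w : Word Piece) : M :=
  if h : IsTangle w 0 0 then F ⟨w, h⟩ else 0

theorem uval_eq {M : Type*} [Zero M] (F : Diagram → M) {w : Word Piece}
    (h : IsTangle w 0 0) : uval F w = F ⟨w, h⟩ := dif_pos h

theorem Ctx.Fits.isTangle {c : Ctx Piece Unit} {s t : List Unit} (hc : c.Fits s t)
    {w : Word Piece} (hw : Tng w s t) : IsTangle (c.fill w) 0 0 := isTangle_iff.2 (hc.tng hw)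

variable {A q : K}

theorem IsKauffman.br_eq {F : Diagram → K} (h : IsKauffman A q F) {x y : Word Piece}
    (hm : Move x y) {s t : List Unit} (hx : Tng x s t) (hy : Tng y s t) :
    br (uval F) s t x = br (uval F) s t y := by
  funext c
  by_cases hc : c.Fits s t
  · rw [br_of_fits _ _ hc, br_of_fits _ _ hc, uval_eq F (hc.isTangle hx),
      uval_eq F (hc.isTangle hy)]
    exact h.invariant x y c.2.2.1 c.2.2.2 c.1.length _ _ hm (by simp [Ctx.fill])
      (by simp [Ctx.fill])
  · rw [br_of_not_fits _ _ hc, br_of_not_fits _ _ hc]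

theorem unit_list_eq {s t : List Unit} (h : s.length = t.length) : s = t := by
  rw [List.eq_replicate_of_mem (a := ()) (l := s) (fun _ _ => rfl),
    List.eq_replicate_of_mem (a := ()) (l := t) (fun _ _ => rfl), h]

theorem length_bot (g : Piece) : (bot g).length = g.bot := by simp [bot]

theorem length_top (g : Piece) : (top g).length = g.top := by simp [top]

theorem IsKauffman.isotopy {F : Diagram → K} (h : IsKauffman A q F) : Isotopy (uval F) where
  exchange g g' m := by
    have h1 := h.br_eq (.exchange g g' m.length) (s := bot g ++ (m ++ bot g'))
      (t := top g ++ (m ++ top g'))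
    rw [← length_bot, ← length_top] at h1
    refine h1 ?_ ?_
    · exact (Tng.single [] (m ++ bot g') g).append (by
        simpa using Tng.single (top g ++ m) [] g')
    · simpa using (Tng.single (bot g ++ m) [] g').append (by
        simpa using Tng.single [] (m ++ top g') g)
  zigzag_left := fun () => h.br_eq .zigzag_left rfl rfl
  zigzag_right := fun () => h.br_eq .zigzag_right rfl rfl
  slide_cap e := fun () () => h.br_eq (.slide_cap e) rfl rfl
  slide_cup e := fun () () => h.br_eq (.slide_cup e) rfl rfl
  r2 e := fun () () => h.br_eq (.reidemeister_two e) rfl rfl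

theorem IsKauffman.curl_left {F : Diagram → K} (h : IsKauffman A q F) :
    br (uval F) [()] [()] [(0, .cup), (1, .cross false), (0, .cap)] =
      (A⁻¹ * q) • br (uval F) [()] [()] [] := by
  funext c
  by_cases hc : c.Fits [()] [()]
  · rw [Pi.smul_apply, br_of_fits _ _ hc, br_of_fits _ _ hc, 
      uval_eq F (hc.isTangle (w := [(0, .cup), (1, .cross false), (0, .cap)]) rfl),
      uval_eq F (hc.isTangle (w := []) rfl)]
    exact h.curl c.2.2.1 c.2.2.2 c.1.length _ _ (by simp [Ctx.fill])
      (by simp [Ctx.fill, shift_nil])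
  · rw [Pi.smul_apply, br_of_not_fits _ _ hc, br_of_not_fits _ _ hc, smul_zero]

theorem IsKauffman.skein_br {F : Diagram → K} (h : IsKauffman A q F) :
    br (uval F) [(), ()] [(), ()] [(0, .cross true)] -
      br (uval F) [(), ()] [(), ()] [(0, .cross false)] =
    (q - q⁻¹) • (br (uval F) [(), ()] [(), ()] [] -
      br (uval F) [(), ()] [(), ()] [(0, .cap), (0, .cup)]) := by
  funext c
  by_cases hc : c.Fits [(), ()] [(), ()]
  · simp only [Pi.sub_apply, Pi.smul_apply, br_of_fits _ _ hc]
    rw [uval_eq F (hc.isTangle (w := [(0, .cross true)]) rfl),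
      uval_eq F (hc.isTangle (w := [(0, .cross false)]) rfl),
      uval_eq F (hc.isTangle (w := []) rfl),
      uval_eq F (hc.isTangle (w := [(0, .cap), (0, .cup)]) rfl)]
    exact h.skein c.2.2.1 c.2.2.2 c.1.length _ _ _ _ (by simp [Ctx.fill]) (by simp [Ctx.fill])
      (by simp [Ctx.fill, shift_nil]) (by simp [Ctx.fill])
  · simp [br_of_not_fits _ _ hc]

/-- Only one curl and the isolated circle are given. The opposite curl has the inverse factor, and
circles elsewhere are evaluated by closing one strand of the skein relation. -/
theorem IsKauffman.uskein {F : Diagram → K} (h : IsKauffman A q F) (hz : q - q⁻¹ ≠ 0)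
    (hq : q ≠ 0) (hA : A ≠ 0) :
    USkein (uval F) (q - q⁻¹) (A⁻¹ * q) ((A * q⁻¹ - A⁻¹ * q) / (q - q⁻¹) + 1) := by
  have hP := h.isotopy
  have hκ : A⁻¹ * q ≠ 0 := mul_ne_zero (inv_ne_zero hA) hq
  have hright : br (uval F) [()] [()] [(1, .cup), (0, .cross false), (1, .cap)] =
      (A⁻¹ * q) • br (uval F) [()] [()] [] :=
    (h.br_eq (s := [()]) (t := [()]) (.framed_one false) rfl rfl).trans h.curl_left
  have hc : CupCurl (uval F) true () (A⁻¹ * q) :=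
    hP.cupCurl_of_curl_right (e := false) (s := ()) hright
  have hright' : br (uval F) [()] [()] [(1, .cup), (0, .cross true), (1, .cap)] =
      (A⁻¹ * q)⁻¹ • br (uval F) [()] [()] [] :=
    hP.curl_right (e := true) (s := ()) (hc.inv hP hκ)
  refine ⟨hP, h.br_eq (.reidemeister_three true) rfl rfl, h.skein_br, hc, ?_⟩
  refine hP.loop_of piece_exhaust (d := ()) (fun x => ?_) ?_
  · have h1 := congrArg (ext K [()] [()] [] [()] [(1, .cup)] [(1, .cap)]) h.skein_br
    have hu : Tng [(1, Piece.cup)] [()] ([] ++ ([(), ()] ++ [()])) := rfl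
    have hv : Tng [(1, Piece.cap)] ([] ++ ([(), ()] ++ [()])) [()] := rfl
    rw [map_sub, map_smul, map_sub, ext_br _ hu hv, ext_br _ hu hv, ext_br _ hu hv,
      ext_br _ hu hv] at h1
    -- The closed horizontal smoothing is a strand with two zigzags, so the relation reads `κ⁻¹ - κ
    -- = z * (circle - 1)` with `κ = A⁻¹ * q`.
    have h2 : br (uval F) [()] [()] [(1, .cup), (0, .cap), (0, .cup), (1, .cap)] =
        br (uval F) [()] [()] [] :=
      (br_post (hP.zigzag_left ()) (t' := [()]) [(0, .cup), (1, .cap)] rfl).trans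
        (hP.zigzag_right ())
    simp only [shift, List.map_cons, List.map_nil, List.length_nil, Nat.add_zero,
      List.cons_append, List.nil_append] at h1
    rw [hright, hright', h2, ← sub_smul, smul_sub, eq_sub_iff_add_eq, ← add_smul] at h1
    refine (smul_eq_div_smul hz h1.symm).trans ?_
    rw [div_add_one hz]
    congr 2
    field_simp
  · change uval F [(0, Piece.cup), (0, Piece.cap)] = _
    rw [uval_eq F (isTangle_iff.2 (show Tng [(0, Piece.cup), (0, Piece.cap)] [] [] from rfl)), uval_eq F (IsTangle.nil _), h.loop _ rfl, h.empty _ rfl]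
    simp

theorem Move.br_eq {P : Word Piece → M} (hP : Isotopy P)
    (r3 : ∀ e, ThirdMove P e e e () () ())
    (framed : ∀ e, br P [()] [()] [(1, .cup), (0, .cross e), (1, .cap)] =
      br P [()] [()] [(0, .cup), (1, .cross e), (0, .cap)])
    {x y : Word Piece} (h : Move x y) :
    (∃ g h m, x = [(0, g), (g.top + m, h)] ∧ y = [(g.bot + m, h), (0, g)]) ∨
      ∃ s t, Occupies x s t ∧ br P s t x = br P s t y := by
  -- All labels are equal, so occupying strands is a matter of counting them.
  have pre : ∀ {x : Word Piece} {s : List Unit},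
      (∀ s' t', Tng x s' t' → s.length ≤ s'.length) → ∀ s' t', Tng x s' t' → s <+: s' := by
    intro x s h s' t' ht
    refine ⟨s'.drop s.length, unit_list_eq ?_⟩
    have := h s' t' ht
    simp; omega
  have step1 : ∀ {i : ℕ} {g : Piece} {w : Word Piece} {s t : List Unit},
      Tng ((i, g) :: w) s t → i + g.bot ≤ s.length := by
    intro i g w s t h
    obtain ⟨l, r, rfl, rfl, -⟩ := tng_cons_iff.1 h
    simp [← length_bot]
  have step2 : ∀ {i : ℕ} {g : Piece} {w : Word Piece} {s t : List Unit},
      Tng ((i, g) :: w) s t → ∃ s', s'.length + g.bot = s.length + g.top ∧ Tng w s' t := by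
    intro i g w s t h
    obtain ⟨l, r, rfl, rfl, h1⟩ := tng_cons_iff.1 h
    exact ⟨_, by simp [← length_bot, ← length_top]; omega, h1⟩
  cases h with
  | exchange g h m => exact Or.inl ⟨g, h, m, rfl, rfl⟩
  | zigzag_left =>
    refine Or.inr ⟨[()], [()], ⟨rfl, by simp, pre fun s' t' h => ?_⟩, hP.zigzag_left ()⟩
    simpa [Piece.bot] using step1 h
  | zigzag_right =>
    refine Or.inr ⟨[()], [()], ⟨rfl, by simp, pre fun s' t' h => ?_⟩, hP.zigzag_right ()⟩
    obtain ⟨s, h1, h2⟩ := step2 h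
    have := step1 h2
    simp [Piece.bot, Piece.top] at h1 this ⊢; omega
  | slide_cap e =>
    refine Or.inr ⟨[(), (), ()], [()], ⟨rfl, by simp, pre fun s' t' h => ?_⟩, hP.slide_cap e () ()⟩
    simpa [Piece.bot] using step1 h
  | slide_cup e =>
    refine Or.inr ⟨[()], [(), (), ()], ⟨rfl, by simp, pre fun s' t' h => ?_⟩, hP.slide_cup e () ()⟩
    obtain ⟨s, h1, h2⟩ := step2 h
    have := step1 h2
    simp [Piece.bot, Piece.top] at h1 this ⊢; omega
  | reidemeister_two e =>
    refine Or.inr ⟨[(), ()], [(), ()], ⟨by cases e <;> rfl, by simp, pre fun s' t' h => ?_⟩,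
      hP.r2 e () ()⟩
    simpa [Piece.bot] using step1 h
  | reidemeister_three e =>
    refine Or.inr ⟨[(), (), ()], [(), (), ()], ⟨rfl, by simp, pre fun s' t' h => ?_⟩, r3 e⟩
    obtain ⟨s, h1, h2⟩ := step2 h
    have := step1 h2
    simp [Piece.bot, Piece.top] at h1 this ⊢; omega
  | framed_one e =>
    refine Or.inr ⟨[()], [()], ⟨rfl, by simp, pre fun s' t' h => ?_⟩, framed e⟩
    simpa [Piece.bot] using step1 h

theorem USkein.isKauffman {P : Word Piece → K} (hq : q ≠ 0) (hA : A ≠ 0)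
    (h : USkein P (q - q⁻¹) (A⁻¹ * q) ((A * q⁻¹ - A⁻¹ * q) / (q - q⁻¹) + 1)) (h1 : P [] = 1) :
    IsKauffman A q (fun D => P D.word) := by
  have hκ : A⁻¹ * q ≠ 0 := mul_ne_zero (inv_ne_zero hA) hq
  have hP := h.toIsotopy
  have hc : ∀ e, CupCurl P e () (if e then A⁻¹ * q else (A⁻¹ * q)⁻¹) := by
    intro e
    cases e
    · exact h.curl.inv hP hκ
    · exact h.curl
  have right : ∀ e, br P [()] [()] [(1, .cup), (0, .cross e), (1, .cap)] = _ :=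
    fun e => hP.curl_right (e := e) (s := ()) (hc _)
  have left : ∀ e, br P [()] [()] [(0, .cup), (1, .cross e), (0, .cap)] = _ :=
    fun e => hP.curl_left (e := e) (s := ()) (hc _)
  have closed : ∀ D : Diagram, Tng D.word [] [] := fun D => isTangle_iff.1 D.closed
  have occ : ∀ e, Occupies [(0, Piece.cross e)] [(), ()] [(), ()] := by
    refine fun e => ⟨rfl, by simp, fun s t h => ?_⟩
    obtain ⟨l, r, h7, rfl, -⟩ := tng_cons_iff.1 h
    obtain rfl := List.length_eq_zero_iff.1 h7
    exact ⟨r, rfl⟩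
  refine ⟨?_, ?_, ?_, ?_, ?_⟩
  · intro x y u v k D₁ D₂ hm h2 h3
    have h4 := closed D₁
    simp only [h2, h3] at h4 ⊢
    rcases Move.br_eq hP (fun e => ThirdMove.all_of_same hP h.r3 e e e fun _ => rfl)
      (fun e => by rw [right, left]) hm with ⟨g, g', m, rfl, rfl⟩ | ⟨s, t, h5, h6⟩
    · rw [← length_bot, ← length_top] at *
      exact exchange_apply hP g g' m h4
    · exact apply_eq_of_br h5 h6 h4
  · intro u v k D₁ D₂ D₃ D₄ h2 h3 h4 h5
    have h6 := closed D₁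
    rw [h2] at h6
    obtain ⟨c, hc, hf⟩ := (occ true).ctx h6
    have h8 := congrFun h.skein c
    simp only [Pi.sub_apply, Pi.smul_apply, br_of_fits _ _ hc, hf] at h8
    rw [← h2, ← h3, ← h5, shift_nil, List.append_nil, ← h4] at h8
    exact h8
  · intro u v k D₁ D₂ h2 h3
    have h6 := closed D₁
    rw [h2] at h6
    have h7 : Occupies [(0, Piece.cup), (1, Piece.cross false), (0, Piece.cap)] [()] [()] := by
      refine ⟨rfl, by simp, fun s' t h => ?_⟩
      rcases s' with _ | ⟨b, s'⟩
      · exact absurd h (by simp [Tng, run, step, bot, top, Piece.bot, Piece.top])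
      · exact ⟨s', rfl⟩
    obtain ⟨c, hc, hf⟩ := h7.ctx h6
    have h8 := congrFun (left false) c
    simp only [Pi.smul_apply, br_of_fits _ _ hc, hf] at h8
    rw [← h2, shift_nil, List.append_nil, ← h3] at h8
    exact h8
  · intro D hD
    have hf : Ctx.Fits (G := Piece) ([], [], [], []) ([] : List Unit) [] :=
      ⟨Tng.nil _, Tng.nil _⟩
    have := congrFun h.loop ([], [], [], [])
    rw [Pi.smul_apply, br_of_fits P _ hf, br_of_fits P _ hf] at this
    simpa [Ctx.fill, shift, h1, hD] using this
  · intro D hD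
    rw [hD, h1]

end unoriented

/-! ### Uniqueness -/

section uniqueness
variable {K : Type*} [Field K] {a q A : K}

theorem IsHomfly.oval_nil {P : ODiagram → K} (h : IsHomfly a q P) : oval P [] = 1 := by
  rw [oval_eq P (IsOTangle.nil _), h.empty _ rfl]

/-- The pair `(P, P')` is one solution with values in `Bool → K`, so both are the same multiple of
their common value `1` on the empty diagram. -/
theorem IsHomfly.unique (hz : q - q⁻¹ ≠ 0) {P P' : ODiagram → K} (h : IsHomfly a q P)
    (h' : IsHomfly a q P') : P = P' := by
  funext D
  have h1 := OSkein.pi (P := fun b : Bool => oval (if b then P else P'))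
    (fun b => by cases b; exacts [h'.oskein hz, h.oskein hz])
  obtain ⟨c, hc⟩ := h1.reducible.exists_smul (isOTangle_iff.1 D.closed)
  have h2 := congrFun hc true
  have h3 := congrFun hc false
  simp only [Pi.smul_apply, if_true, Bool.false_eq_true, if_false] at h2 h3
  rw [h.oval_nil] at h2
  rw [h'.oval_nil] at h3
  exact (oval_eq P D.closed).symm.trans ((h2.trans h3.symm).trans (oval_eq P' D.closed))

theorem IsKauffman.unique (hz : q - q⁻¹ ≠ 0) (hq : q ≠ 0) (hA : A ≠ 0) {F F' : Diagram → K}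
    (h : IsKauffman A q F) (h' : IsKauffman A q F') : F = F' := by
  funext D
  have h1 := USkein.pi (P := fun b : Bool => uval (if b then F else F'))
    (fun b => by cases b; exacts [h'.uskein hz hq hA, h.uskein hz hq hA])
  obtain ⟨c, hc⟩ := (h1.reducible (mul_ne_zero (inv_ne_zero hA) hq)).exists_smul
    (isTangle_iff.1 D.closed)
  have h2 := congrFun hc true
  have h3 := congrFun hc false
  simp only [Pi.smul_apply, if_true, Bool.false_eq_true, if_false] at h2 h3
  rw [uval_eq F (IsTangle.nil _), h.empty _ rfl] at h2
  rw [uval_eq F' (IsTangle.nil _), h'.empty _ rfl] at h3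
  exact (uval_eq F D.closed).symm.trans ((h2.trans h3.symm).trans (uval_eq F' D.closed))

/-- The state sum is the Kauffman polynomial. -/
theorem IsHomfly.isKauffman (hz : q - q⁻¹ ≠ 0) (hq : q ≠ 0) (ha : a ≠ 0) {P : ODiagram → K}
    (h : IsHomfly a q P) : IsKauffman (a ^ 2 * q) q (stateSum a q P) := by
  have h1 := jaeger_uskein hz hq ha h
  have e1 : a ^ (-2 : ℤ) = (a ^ 2 * q)⁻¹ * q := by
    rw [zpow_neg]; field_simp
  have e2 : a ^ (2 : ℤ) = a ^ 2 * q * q⁻¹ := by field_simp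
  rw [e1, e2] at h1
  have h2 := h1.isKauffman hq (mul_ne_zero (pow_ne_zero _ ha) hq) (by
    simp [StateModel.value, StateModel.total, twist, rot, h.oval_nil])
  convert h2 using 1
  funext D
  exact stateSum_eq a q P D

end uniqueness

end Jaeger

namespace Jaeger
open PieceSys Reversal CrossSys

/-! ### Existence of the HOMFLY-PT polynomial at powers of `q` -/

/-- The state model that expresses the HOMFLY-PT polynomial at `a * q` in terms of that at `a`.
Strands are labelled by their orientation, and by `true` if they remain. -/
def colourStates : OPiece → List (PieceState Coef (Dir × Bool))
  | .cup .up =>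
    [⟨[], [(.up, true), (.down, true)], 1, [(0, .cup .up)]⟩,
     ⟨[], [(.up, false), (.down, false)], 1, []⟩]
  | .cup .down =>
    [⟨[], [(.down, true), (.up, true)], .term 1 0 1 0, [(0, .cup .down)]⟩,
     ⟨[], [(.down, false), (.up, false)], .term 1 0 0 (-1), []⟩]
  | .cap .down =>
    [⟨[(.down, true), (.up, true)], [], 1, [(0, .cap .down)]⟩,
     ⟨[(.down, false), (.up, false)], [], 1, []⟩]
  | .cap .up =>
    [⟨[(.up, true), (.down, true)], [], .term 1 0 (-1) 0, [(0, .cap .up)]⟩,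
     ⟨[(.up, false), (.down, false)], [], .term 1 0 0 1, []⟩]
  | .cross e x y =>
    [⟨[(x, true), (y, true)], [(y, true), (x, true)], 1, [(0, .cross e x y)]⟩,
     ⟨[(x, false), (y, false)], [(y, false), (x, false)],
        .term 1 0 (if e = decide (x = y) then 1 else -1) 0, []⟩,
     ⟨[(x, true), (y, false)], [(y, false), (x, true)], 1, []⟩,
     ⟨[(x, false), (y, true)], [(y, true), (x, false)], 1, []⟩,
     match e, x, y with
     | true, .up, .up => ⟨[(.up, true), (.up, false)], [(.up, true), (.up, false)], .term 1 1 0 0, []⟩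
     | false, .up, .up =>
        ⟨[(.up, false), (.up, true)], [(.up, false), (.up, true)], .term (-1) 1 0 0, []⟩
     | true, .down, .down =>
        ⟨[(.down, false), (.down, true)], [(.down, false), (.down, true)], .term 1 1 0 0, []⟩
     | false, .down, .down =>
        ⟨[(.down, true), (.down, false)], [(.down, true), (.down, false)], .term (-1) 1 0 0, []⟩
     | false, .down, .up =>
        ⟨[(.down, true), (.up, true)], [(.up, false), (.down, false)], .term 1 1 0 0,
          [(0, .cap .down)]⟩
     | true, .down, .up =>
        ⟨[(.down, false), (.up, false)], [(.up, true), (.down, true)], .term (-1) 1 0 0,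
          [(0, .cup .up)]⟩
     | false, .up, .down =>
        ⟨[(.up, false), (.down, false)], [(.down, true), (.up, true)], .term 1 1 1 1,
          [(0, .cup .down)]⟩
     | true, .up, .down =>
        ⟨[(.up, true), (.down, true)], [(.down, false), (.up, false)], .term (-1) 1 (-1) (-1),
          [(0, .cap .up)]⟩]

/-- The state model that expresses the HOMFLY-PT polynomial at `a * q` in terms of that at `a`. -/
def colourModel : StateModel Coef OPiece Dir (Dir × Bool) where
  und := Prod.fst
  red b := if b.2 then some b.1 else none
  tab := colourStates
  bot_eq g := by
    rcases g with (_ | _) | (_ | _) | ⟨_ | _, _ | _, _ | _⟩ <;> simp [colourStates] <;> decide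
  top_eq g := by
    rcases g with (_ | _) | (_ | _) | ⟨_ | _, _ | _, _ | _⟩ <;> simp [colourStates] <;> decide
  tng g := by
    rcases g with (_ | _) | (_ | _) | ⟨_ | _, _ | _, _ | _⟩ <;> simp [colourStates] <;>
      simp [Tng, run, step, opiece_bot, opiece_top, OPiece.bot, OPiece.top, Dir.op]

open Coef in
/-- Curl factors for the HOMFLY-PT polynomial. -/
def homflyCurl (e : Bool) (_ : Dir) : Coef := if e then term 1 0 0 (-1) else term 1 0 0 1

/-- Circle factors for the HOMFLY-PT polynomial. -/
def homflyLoop (_ : Dir) : Coef := [(1, -1, 0, 1), (-1, -1, 0, -1)]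

/-- The rewriting rules for the HOMFLY-PT polynomial. -/
def homflyRules : OPiece → List Rule := rules (.term 1 1 0 0) homflyCurl homflyLoop

/-- The labels of the strands of a state. -/
def colourLabels (x : Dir) : List (Dir × Bool) := [(x, true), (x, false)]

section
variable {K : Type*} [Field K] {q a : K}

/-- `P` satisfies the relations of the HOMFLY-PT polynomial at `a`, `q`. -/
abbrev HSkein (a q : K) (P : Word OPiece → K) : Prop :=
  OSkein P (q - q⁻¹) (curlFactor a) (fun _ => (a - a⁻¹) / (q - q⁻¹))

theorem HSkein.valid (hz : q - q⁻¹ ≠ 0) (hq : q ≠ 0) (ha : a ≠ 0) {P : Word OPiece → K}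
    (h : HSkein a q P) : Valid q a P homflyRules := by
  refine OSkein.valid h hz hq ha (fun e x => ?_) fun x => ?_
  · cases e <;> simp [homflyCurl, curlFactor]
  · simp [homflyLoop, Coef.eval, Coef.termValue]
    field_simp
    ring

theorem colour_br (hz : q - q⁻¹ ≠ 0) (hq : q ≠ 0) (ha : a ≠ 0) {P : Word OPiece → K}
    (h : HSkein a q P) {s t : List Dir} {x y : Word OPiece} (c : Coef) (hx : Tng x s t)
    (hy : Tng y s t) (hc : colourModel.checks homflyRules colourLabels 40 s
      [(.term (-1) 0 0 0, x), (c, y)] = true) :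
    br ((colourModel.eval q a).value P) s t x = c.eval q a •
      br ((colourModel.eval q a).value P) s t y :=
  StateModel.br_eq_of_checks hz hq ha colourModel (h.valid hz hq ha)
    (fun y => by rcases y with ⟨_, _ | _⟩ <;> simp [colourLabels, colourModel]) 40 c hx hy hc

theorem colour_br_eq (hz : q - q⁻¹ ≠ 0) (hq : q ≠ 0) (ha : a ≠ 0) {P : Word OPiece → K}
    (h : HSkein a q P) {s t : List Dir} {x y : Word OPiece} (hx : Tng x s t)
    (hy : Tng y s t) (hc : colourModel.checks homflyRules colourLabels 40 s
      [(.term (-1) 0 0 0, x), (1, y)] = true) :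
    br ((colourModel.eval q a).value P) s t x = br ((colourModel.eval q a).value P) s t y := by
  rw [colour_br hz hq ha h 1 hx hy hc, Coef.eval_one, one_smul]

theorem colour_isotopy (hz : q - q⁻¹ ≠ 0) (hq : q ≠ 0) (ha : a ≠ 0) {P : Word OPiece → K}
    (h : HSkein a q P) : Isotopy ((colourModel.eval q a).value P) where
  exchange := StateModel.br_value_exchange h.toIsotopy
  zigzag_left s := by cases s <;> exact colour_br_eq hz hq ha h rfl rfl (by decide +kernel)
  zigzag_right s := by cases s <;> exact colour_br_eq hz hq ha h rfl rfl (by decide +kernel)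
  slide_cap e x y := by
    cases e <;> cases x <;> cases y <;> exact colour_br_eq hz hq ha h rfl rfl (by decide +kernel)
  slide_cup e x y := by
    cases e <;> cases x <;> cases y <;> exact colour_br_eq hz hq ha h rfl rfl (by decide +kernel)
  r2 e x y := by
    cases e <;> cases x <;> cases y <;> exact colour_br_eq hz hq ha h rfl rfl (by decide +kernel)

/-- Strands labelled `true` carry `P` at `a`. Those labelled `false` behave as in the `sl_1` theory,
where diagrams have only powers of `q` as values, so they are erased. The extra powers of `q` and
`a` at minima and maxima are a normalization by rotation numbers. The third move need only be
checked for three upward strands. -/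
theorem colour_hskein (hz : q - q⁻¹ ≠ 0) (hq : q ≠ 0) (ha : a ≠ 0) {P : Word OPiece → K}
    (h : HSkein a q P) : HSkein (a * q) q ((colourModel.eval q a).value P) where
  toIsotopy := colour_isotopy hz hq ha h
  r3 e x y z := ThirdMove.all_dir (colour_isotopy hz hq ha h)
    (colour_br_eq hz hq ha h rfl rfl (by decide +kernel)) x y z e e e fun _ => rfl
  skein := by
    have := StateModel.br_of_checks hz hq ha colourModel (h.valid hz hq ha)
      (fib := colourLabels) (fun y => by rcases y with ⟨_, _ | _⟩ <;> simp [colourLabels, colourModel])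
      40 (s := [.up, .up]) (t := [.up, .up])
      [(1, [(0, .cross true .up .up)]), (.term (-1) 0 0 0, [(0, .cross false .up .up)]),
        (.term (-1) 1 0 0, [])]
      (by simpa using ⟨rfl, rfl, rfl⟩) (by decide +kernel)
    rw [← sub_eq_zero, ← this]
    simp only [List.map_cons, List.map_nil, List.sum_cons, List.sum_nil, Coef.eval_one,
      Coef.eval_term]
    simp only [Int.cast_one, Int.cast_neg, zpow_one, zpow_zero, mul_one]
    module
  curl e x := by
    have hc : curlFactor (a * q) e x =
        Coef.eval q a (if e then .term 1 0 (-1) (-1) else .term 1 0 1 1) := by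
      cases e <;> simp [curlFactor, mul_comm]
    rw [CupCurl, hc]
    cases e <;> cases x <;> exact colour_br hz hq ha h _ rfl rfl (by decide +kernel)
  -- Depending on its direction, the circle gives `q⁻¹ * δ + a` or `q * δ + a⁻¹` with `δ = (a - a⁻¹)
  -- / z`. Both equal the circle factor at `a * q`.
  loop x := by
    have hc : (a * q - (a * q)⁻¹) / (q - q⁻¹) =
        Coef.eval q a [(1, -1, 1, 1), (-1, -1, -1, -1)] := by
      simp [Coef.eval, Coef.termValue]
      field_simp
      ring
    rw [hc]
    cases x <;> exact colour_br hz hq ha h _ rfl rfl (by decide +kernel)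

/-- A diagram that contains a piece of the tangle, or strands passing through its place, is not
empty. So every relation between such tangles reads `0 = 0`. -/
theorem br_trivial {s t : List Dir} {x : Word OPiece} (h : s ≠ [] ∨ x ≠ []) :
    br (fun w : Word OPiece => if w = [] then (1 : K) else 0) s t x = 0 := by
  funext c
  by_cases hc : c.Fits s t
  · rw [br_of_fits _ _ hc, if_neg]
    · rfl
    · intro h1
      simp only [Ctx.fill, List.append_eq_nil_iff] at h1
      have h2 := hc.1
      rw [h1.1, tng_nil_iff] at h2
      rcases h with h | h
      · exact h (List.append_eq_nil_iff.1 (List.append_eq_nil_iff.1 h2.symm).2).1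
      · exact h (List.map_eq_nil_iff.1 h1.2.1)
  · rw [br_of_not_fits _ _ hc]; rfl

/-- At `a = 1` the HOMFLY-PT polynomial vanishes on non-empty diagrams. -/
theorem hskein_one : HSkein (1 : K) q (fun w => if w = [] then 1 else 0) where
  exchange g h m := by rw [br_trivial (by simp), br_trivial (by simp)]
  zigzag_left s := by rw [br_trivial (by simp), br_trivial (by simp)]
  zigzag_right s := by rw [br_trivial (by simp), br_trivial (by simp)]
  slide_cap e x y := by rw [br_trivial (by simp), br_trivial (by simp)]
  slide_cup e x y := by rw [br_trivial (by simp), br_trivial (by simp)]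
  r2 e x y := by rw [br_trivial (by simp), br_trivial (by simp)]
  r3 e x y w := by rw [ThirdMove, br_trivial (by simp), br_trivial (by simp)]
  skein := by
    rw [br_trivial (by simp), br_trivial (by simp), br_trivial (by simp), smul_zero, sub_zero]
  curl e x := by rw [CupCurl, br_trivial (by simp), br_trivial (by simp), smul_zero]
  loop x := by rw [br_trivial (by simp)]; simp

theorem exists_hskein_pow (hz : q - q⁻¹ ≠ 0) (hq : q ≠ 0) (n : ℕ) :
    ∃ P : Word OPiece → K, HSkein (q ^ n) q P ∧ P [] = 1 := by
  induction n with
  | zero => exact ⟨_, by rw [pow_zero]; exact hskein_one, if_pos rfl⟩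
  | succ n ih =>
    obtain ⟨P, h, h1⟩ := ih
    refine ⟨_, by rw [pow_succ]; exact colour_hskein hz hq (pow_ne_zero n hq) h, ?_⟩
    simp [StateModel.value, StateModel.total, h1]

end

end Jaeger

namespace Jaeger
open PieceSys Reversal CrossSys
open Polynomial

/-! ### Interpolation -/

/-- Integral polynomials in `q` (the inner variable) and `a` (the outer variable). -/
abbrev BiPoly : Type := ℤ[X][X]

/-- The element `q * a * (q ^ 2 - 1)`. -/
noncomputable def denom : BiPoly := C X * X * (C X ^ 2 - 1)

/-- The universal ring of coefficients of the HOMFLY-PT polynomial. -/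
abbrev Univ : Type := Localization.Away denom

namespace Univ

noncomputable def q : Univ := algebraMap BiPoly Univ (C X)

noncomputable def a : Univ := algebraMap BiPoly Univ X

/-- Inverting this product makes `q`, `a` and `z = q⁻¹ * (q ^ 2 - 1)` invertible, which is just what
the hypotheses on a field guarantee. -/
theorem isUnit_denom : IsUnit (q * a * (q ^ 2 - 1)) := by
  have := IsLocalization.Away.algebraMap_isUnit (S := Univ) denom
  simpa [denom, q, a] using this

noncomputable def qUnit : Univˣ :=
  (isUnit_of_dvd_unit ⟨a * (q ^ 2 - 1), by ring⟩ isUnit_denom : IsUnit q).unit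

noncomputable def aUnit : Univˣ :=
  (isUnit_of_dvd_unit ⟨q * (q ^ 2 - 1), by ring⟩ isUnit_denom : IsUnit a).unit

theorem isUnit_z : IsUnit (q - (qUnit⁻¹ : Univˣ)) := by
  have h : q * (qUnit⁻¹ : Univˣ) = 1 := qUnit.mul_inv
  refine isUnit_of_dvd_unit ⟨q * (q * a), ?_⟩ isUnit_denom
  linear_combination (q * a) * h

noncomputable def zUnit : Univˣ := isUnit_z.unit

section lift
variable {F : Type*} [Field F] {x y : F}

/-- Evaluation at `q = x` and `a = y`. -/
noncomputable def evalPoly (x y : F) : BiPoly →+* F :=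
  eval₂RingHom (eval₂RingHom (Int.castRingHom F) x) y

theorem isUnit_evalPoly (hx : x ≠ 0) (hy : y ≠ 0) (hx2 : x ^ 2 ≠ 1) :
    IsUnit (evalPoly x y denom) := by
  rw [isUnit_iff_ne_zero, denom]
  simp only [map_mul, map_sub, map_pow, map_one]
  simp [evalPoly, hx, hy, sub_eq_zero, hx2]

/-- Evaluation at `q = x` and `a = y`. -/
noncomputable def lift (hx : x ≠ 0) (hy : y ≠ 0) (hx2 : x ^ 2 ≠ 1) : Univ →+* F :=
  IsLocalization.Away.lift denom (isUnit_evalPoly hx hy hx2)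

variable (hx : x ≠ 0) (hy : y ≠ 0) (hx2 : x ^ 2 ≠ 1)

theorem lift_algebraMap (p : BiPoly) : lift hx hy hx2 (algebraMap BiPoly Univ p) = evalPoly x y p :=
  IsLocalization.Away.lift_eq denom (isUnit_evalPoly hx hy hx2) p

theorem lift_q : lift hx hy hx2 qUnit = x := by
  change lift hx hy hx2 q = x
  rw [q, lift_algebraMap]; simp [evalPoly]

theorem lift_a : lift hx hy hx2 aUnit = y := by
  change lift hx hy hx2 a = y
  rw [a, lift_algebraMap]; simp [evalPoly]

theorem lift_inv (u : Univˣ) : lift hx hy hx2 (u⁻¹ : Univˣ) = (lift hx hy hx2 u)⁻¹ := by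
  rw [map_units_inv]

theorem lift_z : lift hx hy hx2 zUnit = x - x⁻¹ := by
  change lift hx hy hx2 (qUnit - (qUnit⁻¹ : Univˣ)) = _
  rw [map_sub, lift_inv, lift_q]

end lift

/-- The rational functions in `q`. -/
abbrev Rat : Type := FractionRing ℤ[X]

/-- The variable `q`. -/
noncomputable def var : Rat := algebraMap ℤ[X] Rat X

theorem var_ne_zero : var ≠ 0 := by
  simp [var]

theorem var_sq_ne_one : var ^ 2 ≠ 1 := by
  rw [var, ← map_pow, ← map_one (algebraMap ℤ[X] Rat)]
  intro h
  have h1 := IsFractionRing.injective ℤ[X] Rat h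
  have := congrArg natDegree h1
  simp at this

/-- Evaluation at `a = q ^ n`. -/
noncomputable def spec (n : ℕ) : Univ →+* Rat :=
  lift var_ne_zero (pow_ne_zero n var_ne_zero) var_sq_ne_one

/-- Up to a power of `denom`, the element is a polynomial in `a` over the domain `ℤ[q]`. It has the
infinitely many roots `q ^ n`, hence is zero. -/
theorem spec_injective {r : Univ} (h : ∀ n, spec n r = 0) : r = 0 := by
  obtain ⟨m, p, hp⟩ := IsLocalization.Away.surj denom r
  have h1 : p = 0 := by
    refine Polynomial.eq_zero_of_infinite_isRoot p
      (Set.infinite_of_injective_forall_mem (f := fun n : ℕ => (X : ℤ[X]) ^ n) ?_ fun n => ?_)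
    · intro n n' hn
      simpa using congrArg natDegree hn
    · have h2 := congrArg (spec n) hp
      rw [map_mul, h n, zero_mul, spec, lift_algebraMap] at h2
      have h3 : evalPoly var (var ^ n) p = algebraMap ℤ[X] Rat (p.eval (X ^ n)) := by
        rw [evalPoly, coe_eval₂RingHom, eval, hom_eval₂, RingHom.comp_id, map_pow]
        congr 1
        ext1
        · exact RingHom.ext_int _ _
        · simp [var]
      rw [h3] at h2
      exact IsFractionRing.injective ℤ[X] Rat (by rw [← h2, map_zero])
  rw [h1, map_zero] at hp
  have h4 := IsLocalization.Away.algebraMap_isUnit (S := Univ) denom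
  exact (h4.pow m).mul_left_eq_zero.1 hp

end Univ

/-- The rational functions in `q`, with the variable `a` acting as `q ^ n`. -/
def Spec (_ : ℕ) : Type := Univ.Rat

noncomputable instance (n : ℕ) : Field (Spec n) := inferInstanceAs (Field Univ.Rat)

/-- The index in the type keeps the different actions of `Univ` on the same field apart, so that all
of them can be used in one product. -/
noncomputable instance (n : ℕ) : Module Univ (Spec n) := Module.compHom Univ.Rat (Univ.spec n)

/-! ### From powers of `q` to arbitrary parameters in an arbitrary field. -/

section existence

theorem sub_inv_ne_zero {K : Type*} [Field K] {q : K} (hq : q ≠ 0) (hq2 : q ^ 2 ≠ 1) :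
    q - q⁻¹ ≠ 0 := by
  intro h
  apply hq2
  field_simp at h
  linear_combination h

/-- The variable `q`. -/
noncomputable def Spec.var (n : ℕ) : Spec n := Univ.var

theorem Spec.exists_hskein (n : ℕ) :
    ∃ P : Word OPiece → Spec n, HSkein (var n ^ n) (var n) P ∧ P [] = 1 :=
  exists_hskein_pow (sub_inv_ne_zero Univ.var_ne_zero Univ.var_sq_ne_one) Univ.var_ne_zero n

/-- The curl factors in the universal ring. -/
noncomputable def univCurl (e : Bool) (_ : Dir) : Univ :=
  if e then (Univ.aUnit⁻¹ : Univˣ) else Univ.aUnit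

/-- The circle factor in the universal ring. -/
noncomputable def univLoop (_ : Dir) : Univ :=
  (Univ.aUnit - (Univ.aUnit⁻¹ : Univˣ)) * (Univ.zUnit⁻¹ : Univˣ)

/-- The scalars in the relations at `a = q ^ n` are images of elements of `Univ` independent of `n`,
so the relations for all `n` have common coefficients. -/
theorem HSkein.univ {n : ℕ} {P : Word OPiece → Spec n} (h : HSkein (Spec.var n ^ n) (Spec.var n) P) :
    OSkein P (Univ.zUnit : Univ) univCurl univLoop where
  toIsotopy := h.toIsotopy
  r3 := h.r3
  skein := by
    refine h.skein.trans ?_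
    rw [← show Univ.spec n Univ.zUnit = Spec.var n - (Spec.var n)⁻¹ from Univ.lift_z _ _ _]
    rfl
  curl e x := by
    refine (h.curl e x).trans ?_
    have : curlFactor (Spec.var n ^ n) e x = Univ.spec n (univCurl e x) := by
      cases e
      · exact (Univ.lift_a _ _ _).symm
      · change (Spec.var n ^ n)⁻¹ = Univ.spec n (Univ.aUnit⁻¹ : Univˣ)
        exact (congrArg _ (Univ.lift_a _ _ _).symm).trans (Univ.lift_inv _ _ _ _).symm
    rw [this]
    rfl
  loop x := by
    refine (h.loop x).trans ?_
    have : (Spec.var n ^ n - (Spec.var n ^ n)⁻¹) / (Spec.var n - (Spec.var n)⁻¹) =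
        Univ.spec n (univLoop x) := by
      rw [univLoop, map_mul, map_sub, Univ.spec, Univ.lift_inv, Univ.lift_inv, Univ.lift_a,
        Univ.lift_z]
      rfl
    rw [this]
    rfl

/-- The HOMFLY-PT polynomial exists, with values in the universal ring. -/
theorem exists_univ : ∃ c : ODiagram → Univ, ∀ n, ∃ P : ODiagram → Univ.Rat,
    IsHomfly (Univ.var ^ n) Univ.var P ∧ ∀ D, Univ.spec n (c D) = P D := by
  choose P hP h1 using Spec.exists_hskein
  -- The whole sequence of polynomials is treated as one solution, so that `c` does not depend on
  -- `n`.
  have h := (OSkein.pi fun n => (hP n).univ).reducible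
  have h2 : ∀ D : ODiagram, ∃ c : Univ, (fun n => P n D.word) = c • fun n => P n [] :=
    fun D => h.exists_smul (isOTangle_iff.1 D.closed)
  choose c hc using h2
  refine ⟨c, fun n => ⟨fun D => P n D.word, (hP n).isHomfly (h1 n), fun D => ?_⟩⟩
  have := congrFun (hc D) n
  rw [Pi.smul_apply, h1] at this
  exact (this.trans (mul_one (Univ.spec n (c D)))).symm

/-- Each relation holds for `c` in `Univ` because it holds after every specialization `a = q ^ n`;
the ring homomorphism `Univ.lift` carries it to the given field. -/
theorem exists_isHomfly {K : Type*} [Field K] {a q : K} (ha : a ≠ 0) (hq : q ≠ 0)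
    (hq2 : q ^ 2 ≠ 1) : ∃ P : ODiagram → K, IsHomfly a q P := by
  obtain ⟨c, hc⟩ := exists_univ
  choose P hP hcP using hc
  have inj : ∀ r r' : Univ, (∀ n, Univ.spec n r = Univ.spec n r') → r = r' := fun r r' h =>
    sub_eq_zero.1 (Univ.spec_injective fun n => by rw [map_sub, h n, sub_self])
  have sa : ∀ n, Univ.spec n Univ.aUnit = Univ.var ^ n := fun n => Univ.lift_a _ _ _
  have sz : ∀ n, Univ.spec n Univ.zUnit = Univ.var - Univ.var⁻¹ := fun n => Univ.lift_z _ _ _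
  have sinv : ∀ n (u : Univˣ), Univ.spec n (u⁻¹ : Univˣ) = (Univ.spec n u)⁻¹ :=
    fun n u => Univ.lift_inv _ _ _ u
  refine ⟨fun D => Univ.lift hq ha hq2 (c D), ?_, ?_, ?_, ?_, ?_, ?_⟩
  · intro x y u v k D₁ D₂ hm h1 h2
    rw [inj (c D₁) (c D₂) fun n => by
      rw [hcP, hcP]; exact (hP n).invariant x y u v k D₁ D₂ hm h1 h2]
  · intro u v k D₁ D₂ D₃ h1 h2 h3
    have := inj (c D₁ - c D₂) (Univ.zUnit * c D₃) fun n => by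
      rw [map_sub, map_mul, hcP, hcP, hcP, sz]; exact (hP n).skein u v k D₁ D₂ D₃ h1 h2 h3
    rw [← map_sub, this, map_mul, Univ.lift_z]
  · intro u v k s D₁ D₂ h1 h2
    have := inj (c D₁) (Univ.aUnit * c D₂) fun n => by
      rw [map_mul, hcP, hcP, sa]; exact (hP n).curl_pos u v k s D₁ D₂ h1 h2
    rw [this, map_mul, Univ.lift_a]
  · intro u v k s D₁ D₂ h1 h2
    have := inj (c D₁) ((Univ.aUnit⁻¹ : Univˣ) * c D₂) fun n => by
      rw [map_mul, hcP, hcP, sinv, sa]; exact (hP n).curl_neg u v k s D₁ D₂ h1 h2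
    rw [this, map_mul, Univ.lift_inv, Univ.lift_a]
  · intro s D hD
    have := inj (c D) (univLoop s) fun n => by
      rw [hcP, (hP n).loop s D hD, univLoop, map_mul, map_sub, sinv, sinv, sa, sz, div_eq_mul_inv]
    rw [this, univLoop, map_mul, map_sub, Univ.lift_inv, Univ.lift_inv, Univ.lift_a, Univ.lift_z,
      div_eq_mul_inv]
  · intro D hD
    have := inj (c D) 1 fun n => by rw [hcP, (hP n).empty D hD, map_one]
    rw [this, map_one]

end existence

end Jaeger

open Jaeger in
theorem mainTheorem2 {K : Type*} [Field K] (q : K) (hq : q ≠ 0) (hq2 : q ^ 2 ≠ 1) :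
    (∀ a : K, a ≠ 0 →
      (∃! P : ODiagram → K, IsHomfly a q P) ∧
      (∃! F : Diagram → K, IsKauffman (a ^ 2 * q) q F) ∧
      ∀ (P : ODiagram → K) (F : Diagram → K), IsHomfly a q P → IsKauffman (a ^ 2 * q) q F →
        ∀ D : Diagram, stateSum a q P D = F D) ∧
    (∀ n : ℕ,
      (∃! P : ODiagram → K, IsSl n q P) ∧
      (∃! F : Diagram → K, IsSo (2 * n + 1) q F) ∧
      ∀ (P : ODiagram → K) (F : Diagram → K), IsSl n q P → IsSo (2 * n + 1) q F →
        ∀ D : Diagram, stateSum (q ^ n) q P D = F D) := by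
  have hz := sub_inv_ne_zero hq hq2
  have main : ∀ a : K, a ≠ 0 →
      (∃! P : ODiagram → K, IsHomfly a q P) ∧
      (∃! F : Diagram → K, IsKauffman (a ^ 2 * q) q F) ∧
      ∀ (P : ODiagram → K) (F : Diagram → K), IsHomfly a q P → IsKauffman (a ^ 2 * q) q F →
        ∀ D : Diagram, stateSum a q P D = F D := by
    intro a ha
    have hA : a ^ 2 * q ≠ 0 := mul_ne_zero (pow_ne_zero 2 ha) hq
    obtain ⟨P, hP⟩ := exists_isHomfly ha hq hq2
    exact ⟨⟨P, hP, fun P' hP' => hP'.unique hz hP⟩,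
      ⟨_, hP.isKauffman hz hq ha, fun F hF => hF.unique hz hq hA (hP.isKauffman hz hq ha)⟩,
      fun P' F hP' hF D => congrFun ((hP'.isKauffman hz hq ha).unique hz hq hA hF) D⟩
  refine ⟨main, fun n => ?_⟩
  have h := main (q ^ n) (pow_ne_zero n hq)
  rwa [show (q ^ n) ^ 2 * q = q ^ (2 * n + 1) by ring] at h
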